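/- Let $p_0,\dots,p_{n-1}$ ($n\ge 1$) be points of $\mathbf R^2$, one for each of $n$ events, listed in the order of time. They are arbitrary: coincident and collinear points are allowed. For $0\le i\le j<n$ let $w=j-i+1$ be the number of points in the time window $[p_i,p_j]$, and let $H_{i,j}$ be the convex hull of $\{p_i,\dots,p_j\}$. An edge of $H_{i,j}$ is a one-dimensional face; if the points of the window lie on a line but do not all coincide, $H_{i,j}$ is its own only edge, and if they all coincide there is no edge. The machine is a real RAM that runs finite programs: its cells hold natural or real numbers, memory is addressed indirectly, and at unit cost it can read or write a cell, add, subtract (truncated at $0$) and halve (rounded down) natural numbers, add, subtract and multiply real numbers, and compare two natural or two real numbers. There are fixed programs and a constant $C$, independent of $n$, of the points, of the window and of the query, such that a preprocessing program, given $n$ and $p_0,\dots,p_{n-1}$, builds a data structure in at most $C\,n\,(1+\log_2 n)$ steps, after which each of the following queries, any number of them in any order, is answered in at most $C\,(1+\log_2 w)^2$ steps, that is, in $O(\log^2 w)$ time for $w\ge 2$ and in constant time for $w=1$: 1. (vertical line stabbing) given $i\le j$ and $x_0\in\mathbf R$, find out whether the vertical line $\{x=x_0\}$ meets an edge of $H_{i,j}$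 and, if so, return (by the indices of its two ends) an edge of $H_{i,j}$ that contains the highest point of $H_{i,j}\cap\{x=x_0\}$ and an edge that contains the lowest point; 2. (membership) given $i\le j$ and $q\in\mathbf R^2$, decide whether $q$ lies on the boundary of $H_{i,j}$; 3. (containment) given $i\le j$ and $q\in\mathbf R^2$, decide whether $q$ lies in $H_{i,j}$. -/

import Mathlib

namespace WindowHull

/-! ### The computer: a real RAM

Programs are finite texts in a small imperative language.  A state has registers and numbered
banks of memory cells, holding either natural numbers (indices, pointers) or real numbers
(coordinates).  Registers and banks are named by constants of the program, cells inside a bank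
are addressed indirectly.  Natural numbers can be added, subtracted (truncated at `0`), halved
(rounded down) and compared, real numbers can be added, subtracted, multiplied and compared; each
of these operations, each register access and each memory access costs one step. There is no
rounding of real numbers, and the only constants are natural numbers. -/

/-- Contents of the registers and of the memory. -/
structure State where
  nreg : ℕ → ℕ
  rreg : ℕ → ℝ
  /-- `nmem b k` is the `k`-th cell of the `b`-th bank of natural numbers -/
  nmem : ℕ → ℕ → ℕ
  /-- `rmem b k` is the `k`-th cell of the `b`-th bank of real numbers -/
  rmem : ℕ → ℕ → ℝ

/-- Expressions with a natural number as value. -/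
inductive NExp where
  | lit (k : ℕ)
  | reg (r : ℕ)
  | cell (bank : ℕ) (address : NExp)
  | add (a b : NExp)
  | sub (a b : NExp)
  | half (a : NExp)

/-- Expressions with a real number as value. -/
inductive RExp where
  | lit (k : ℕ)
  | reg (r : ℕ)
  | cell (bank : ℕ) (address : NExp)
  | add (a b : RExp)
  | sub (a b : RExp)
  | mul (a b : RExp)

/-- Tests. -/
inductive Test where
  | nlt (a b : NExp)
  | rlt (a b : RExp)
  | neg (p : Test)
  | conj (p q : Test)

/-- Programs. -/
inductive Prog where
  | skip
  | setN (r : ℕ) (e : NExp)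
  | setR (r : ℕ) (e : RExp)
  | storeN (bank : ℕ) (address : NExp) (e : NExp)
  | storeR (bank : ℕ) (address : NExp) (e : RExp)
  | seq (c d : Prog)
  | cond (p : Test) (c d : Prog)
  | loop (p : Test) (c : Prog)

def NExp.eval (s : State) : NExp → ℕ
  | .lit k => k
  | .reg r => s.nreg r
  | .cell b a => s.nmem b (a.eval s)
  | .add a b => a.eval s + b.eval s
  | .sub a b => a.eval s - b.eval s
  | .half a => a.eval s / 2

noncomputable def RExp.eval (s : State) : RExp → ℝ
  | .lit k => (k : ℝ)
  | .reg r => s.rreg r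
  | .cell b a => s.rmem b (a.eval s)
  | .add a b => a.eval s + b.eval s
  | .sub a b => a.eval s - b.eval s
  | .mul a b => a.eval s * b.eval s

def Test.holds (s : State) : Test → Prop
  | .nlt a b => a.eval s < b.eval s
  | .rlt a b => a.eval s < b.eval s
  | .neg p => ¬ p.holds s
  | .conj p q => p.holds s ∧ q.holds s

/-- Number of steps that the evaluation of an expression takes. -/
def NExp.cost : NExp → ℕ
  | .lit _ => 1
  | .reg _ => 1
  | .cell _ a => a.cost + 1
  | .add a b => a.cost + b.cost + 1
  | .sub a b => a.cost + b.cost + 1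
  | .half a => a.cost + 1

/-- Number of steps that the evaluation of an expression takes. -/
def RExp.cost : RExp → ℕ
  | .lit _ => 1
  | .reg _ => 1
  | .cell _ a => a.cost + 1
  | .add a b => a.cost + b.cost + 1
  | .sub a b => a.cost + b.cost + 1
  | .mul a b => a.cost + b.cost + 1

/-- Number of steps that the evaluation of a test takes. -/
def Test.cost : Test → ℕ
  | .nlt a b => a.cost + b.cost + 1
  | .rlt a b => a.cost + b.cost + 1
  | .neg p => p.cost + 1
  | .conj p q => p.cost + q.cost + 1

def State.setN (s : State) (r v : ℕ) : State :=
  { s with nreg := Function.update s.nreg r v }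

noncomputable def State.setR (s : State) (r : ℕ) (v : ℝ) : State :=
  { s with rreg := Function.update s.rreg r v }

def State.storeN (s : State) (b k v : ℕ) : State :=
  { s with nmem := Function.update s.nmem b (Function.update (s.nmem b) k v) }

noncomputable def State.storeR (s : State) (b k : ℕ) (v : ℝ) : State :=
  { s with rmem := Function.update s.rmem b (Function.update (s.rmem b) k v) }

/-- `Exec c s t s'`: the program `c`, started in the state `s`, halts after exactly `t` steps in
the state `s'`. -/
inductive Exec : Prog → State → ℕ → State → Prop
  | skip (s : State) : Exec .skip s 1 s
  | setN (s : State) (r : ℕ) (e : NExp) :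
      Exec (.setN r e) s (e.cost + 1) (s.setN r (e.eval s))
  | setR (s : State) (r : ℕ) (e : RExp) :
      Exec (.setR r e) s (e.cost + 1) (s.setR r (e.eval s))
  | storeN (s : State) (b : ℕ) (a e : NExp) :
      Exec (.storeN b a e) s (a.cost + e.cost + 1) (s.storeN b (a.eval s) (e.eval s))
  | storeR (s : State) (b : ℕ) (a : NExp) (e : RExp) :
      Exec (.storeR b a e) s (a.cost + e.cost + 1) (s.storeR b (a.eval s) (e.eval s))
  | seq {c d : Prog} {s s₁ s₂ : State} {t₁ t₂ : ℕ} :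
      Exec c s t₁ s₁ → Exec d s₁ t₂ s₂ → Exec (.seq c d) s (t₁ + t₂) s₂
  | cond_true {p : Test} {c d : Prog} {s s' : State} {t : ℕ} :
      p.holds s → Exec c s t s' → Exec (.cond p c d) s (p.cost + 1 + t) s'
  | cond_false {p : Test} {c d : Prog} {s s' : State} {t : ℕ} :
      ¬ p.holds s → Exec d s t s' → Exec (.cond p c d) s (p.cost + 1 + t) s'
  | loop_true {p : Test} {c : Prog} {s s₁ s₂ : State} {t₁ t₂ : ℕ} :
      p.holds s → Exec c s t₁ s₁ → Exec (.loop p c) s₁ t₂ s₂ →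
      Exec (.loop p c) s (p.cost + 1 + t₁ + t₂) s₂
  | loop_false {p : Test} {c : Prog} {s : State} :
      ¬ p.holds s → Exec (.loop p c) s (p.cost + 1) s

/-- Started in the state `s`, the program `c` halts within `bound` steps in a state that
satisfies `post`. -/
def HaltsWithin (c : Prog) (s : State) (bound : ℕ) (post : State → Prop) : Prop :=
  ∃ (t : ℕ) (s' : State), Exec c s t s' ∧ t ≤ bound ∧ post s'

/-! ### Input and query parameters -/

/-- The initial state: register `0` holds the number `n` of events, and the real banks `0` and
`1` hold the abscissas and the ordinates of the points, in the order of time. Everything else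
is zero. -/
noncomputable def State.input {n : ℕ} (p : Fin n → ℝ × ℝ) : State where
  nreg r := if r = 0 then n else 0
  rreg _ := 0
  nmem _ _ := 0
  rmem b k := if h : k < n then
      (if b = 0 then (p ⟨k, h⟩).1 else if b = 1 then (p ⟨k, h⟩).2 else 0)
    else 0

/-- Loads the window `i, j` into the registers `0` and `1`. -/
def State.window {n : ℕ} (s : State) (i j : Fin n) : State :=
  (s.setN 0 i).setN 1 j

/-! ### Hulls of windows and the answers to the queries -/

/-- The convex hull of the points with times from `i` to `j`. -/
def hull {n : ℕ} (p : Fin n → ℝ × ℝ) (i j : Fin n) : Set (ℝ × ℝ) :=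
  convexHull ℝ (p '' Set.Icc i j)

/-- The segment from `p a` to `p b` is an edge (a one-dimensional face) of the hull of the window.
If all points of the window lie on a line, but do not all coincide, then the hull is its own only
edge. -/
def IsEdge {n : ℕ} (p : Fin n → ℝ × ℝ) (i j a b : Fin n) : Prop :=
  a ∈ Set.Icc i j ∧ b ∈ Set.Icc i j ∧ p a ≠ p b ∧
    IsExposed ℝ (hull p i j) (segment ℝ (p a) (p b))

/-- The answer to stabbing the hull with the vertical line at abscissa `x`, left in the registers.
Register `0` holds `0` if the line meets no edge of the hull.  Otherwise it holds `1`, the registers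
`1`, `2` hold the ends of an intersected edge that is furthest in the upward direction of the
line, and the registers `3`, `4` those of one that is furthest in the downward direction. -/
def StabAnswer {n : ℕ} (p : Fin n → ℝ × ℝ) (i j : Fin n) (x : ℝ) (s : State) : Prop :=
  (s.nreg 0 = 0 ∧ ∀ (a b : Fin n) (y : ℝ), IsEdge p i j a b → (x, y) ∉ segment ℝ (p a) (p b)) ∨
  (s.nreg 0 = 1 ∧
    (∃ a b : Fin n, s.nreg 1 = a ∧ s.nreg 2 = b ∧ IsEdge p i j a b ∧
      ∃ y : ℝ, (x, y) ∈ segment ℝ (p a) (p b) ∧ ∀ y' : ℝ, (x, y') ∈ hull p i j → y' ≤ y) ∧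
    (∃ a b : Fin n, s.nreg 3 = a ∧ s.nreg 4 = b ∧ IsEdge p i j a b ∧
      ∃ y : ℝ, (x, y) ∈ segment ℝ (p a) (p b) ∧ ∀ y' : ℝ, (x, y') ∈ hull p i j → y ≤ y'))

/-- The answer to a yes-no question, left in register `0`. -/
def YesNoAnswer (Q : Prop) (s : State) : Prop :=
  (Q ∧ s.nreg 0 = 1) ∨ (¬ Q ∧ s.nreg 0 = 0)

/-- The bound `C (1 + log w)²` for a query to the window `i, j`, which has `w = j - i + 1`
points. -/
def queryTime {n : ℕ} (C : ℕ) (i j : Fin n) : ℕ :=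
  C * (1 + Nat.log 2 ((j : ℕ) - (i : ℕ) + 1)) ^ 2

end WindowHull

/-! The data structure is a complete binary tree over the time axis, padded to `2 ^ K < 2 * n`
leaves. Each node keeps the upper hull of its block of points as a chain of vertices (`Chain`). The
lower hull is the upper hull of the points reflected in the horizontal axis, so a second tree with
negated ordinates takes care of it. The hulls of two siblings may overlap in abscissa, but both are
sorted, and a stack scan in lexicographic order merges them in linear time (`mergeChains_spec`).
Every level thus costs `O(n)`, and the tree `O(n log n)`.

Points are rated by the linear functional `val` of a direction, ties being broken by abscissa. Along
a chain the slopes decrease, and the extreme vertices sit where they pass the slope of the direction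
(`Chain.dom_turn`). Fractional cascading avoids a binary search in every node: the sorted edge list
of a node consists of the edges of its hull and of every second entry of the lists of its children,
with counts that turn a position in it into positions in its parts (`Merged.isRank`); one more
comparison then gives the position in the full list of a child (`IsRank.of_odd`). A window of `w`
points meets at most two adjacent blocks of length `2 ^ h`, where `h ≤ 1 + log w`. On the ways from
these blocks down to the leaves of the two ends of the window, the children inside the window, with
the two ends themselves, exhaust it (`covered_of_paths`). After one binary search at the top of each
way, a level takes a bounded number of comparisons and visits, so that extreme points in a given
direction are found in `O(log w)` steps (`extreme_spec`). Starting at level `h` and not at the root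
makes the bound depend on `w` only.

The edge over a vertical line is found by parametric search. Its slope is unknown, yet the same
descent can be run for it, because the descent uses the direction only through comparisons
(`Visitor`). To compare the unknown slope with a known one, find the leftmost extreme point in the
known direction and look on which side of the line it is (`Crossing.left_iff`). This makes `O(log
w)` comparisons of `O(log w)` steps each. The best points visited on the two sides of the line span
the line of the edge, and one more search in their direction gives its ends (`bridge_spec`).

Given the edges above and below, stabbing is answered, containment amounts to two sign tests, and
the boundary is the closed hull minus its interior, which is described by strict inequalities
(`OverEdge.mem_interior_iff`). Windows contained in the vertical line of the query are treated
apart. -/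

namespace WindowHull

/-! ### Reasoning about programs -/

/-- The program `c`, started in `s`, halts, and running time and final state satisfy `Q`. -/
def WP (c : Prog) (s : State) (Q : ℕ → State → Prop) : Prop :=
  ∃ (t : ℕ) (s' : State), Exec c s t s' ∧ Q t s'

theorem WP.mono {c : Prog} {s : State} {Q R : ℕ → State → Prop} (h : WP c s Q)
    (hQR : ∀ t s', Q t s' → R t s') : WP c s R := by
  obtain ⟨t, s', he, hq⟩ := h
  exact ⟨t, s', he, hQR _ _ hq⟩

theorem WP.halts {c : Prog} {s : State} {B : ℕ} {P : State → Prop}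
    (h : WP c s fun t s' => t ≤ B ∧ P s') : HaltsWithin c s B P := by
  obtain ⟨t, s', he, ht, hp⟩ := h
  exact ⟨t, s', he, ht, hp⟩

@[simp] theorem wp_skip {s : State} {Q : ℕ → State → Prop} : WP .skip s Q ↔ Q 1 s :=
  ⟨fun ⟨_, _, he, hq⟩ => by cases he; exact hq, fun h => ⟨_, _, .skip s, h⟩⟩

@[simp] theorem wp_setN {s : State} {r : ℕ} {e : NExp} {Q : ℕ → State → Prop} :
    WP (.setN r e) s Q ↔ Q (e.cost + 1) (s.setN r (e.eval s)) :=
  ⟨fun ⟨_, _, he, hq⟩ => by cases he; exact hq, fun h => ⟨_, _, .setN s r e, h⟩⟩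

@[simp] theorem wp_setR {s : State} {r : ℕ} {e : RExp} {Q : ℕ → State → Prop} :
    WP (.setR r e) s Q ↔ Q (e.cost + 1) (s.setR r (e.eval s)) :=
  ⟨fun ⟨_, _, he, hq⟩ => by cases he; exact hq, fun h => ⟨_, _, .setR s r e, h⟩⟩

@[simp] theorem wp_storeN {s : State} {b : ℕ} {a e : NExp} {Q : ℕ → State → Prop} :
    WP (.storeN b a e) s Q ↔ Q (a.cost + e.cost + 1) (s.storeN b (a.eval s) (e.eval s)) :=
  ⟨fun ⟨_, _, he, hq⟩ => by cases he; exact hq, fun h => ⟨_, _, .storeN s b a e, h⟩⟩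

@[simp] theorem wp_storeR {s : State} {b : ℕ} {a : NExp} {e : RExp} {Q : ℕ → State → Prop} :
    WP (.storeR b a e) s Q ↔ Q (a.cost + e.cost + 1) (s.storeR b (a.eval s) (e.eval s)) :=
  ⟨fun ⟨_, _, he, hq⟩ => by cases he; exact hq, fun h => ⟨_, _, .storeR s b a e, h⟩⟩

theorem wp_seq {c d : Prog} {s : State} {Q : ℕ → State → Prop} :
    WP (.seq c d) s Q ↔ WP c s fun t₁ s₁ => WP d s₁ fun t₂ s₂ => Q (t₁ + t₂) s₂ := by
  constructor
  · rintro ⟨_, _, he, hq⟩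
    cases he with
    | seq h₁ h₂ => exact ⟨_, _, h₁, _, _, h₂, hq⟩
  · rintro ⟨_, _, h₁, _, _, h₂, hq⟩
    exact ⟨_, _, .seq h₁ h₂, hq⟩

@[simp] theorem wp_cond {p : Test} {c d : Prog} {s : State} {Q : ℕ → State → Prop} :
    WP (.cond p c d) s Q ↔ (p.holds s → WP c s fun t s' => Q (p.cost + 1 + t) s') ∧
      (¬ p.holds s → WP d s fun t s' => Q (p.cost + 1 + t) s') := by
  constructor
  · rintro ⟨_, _, he, hq⟩
    cases he with
    | cond_true hp h => exact ⟨fun _ => ⟨_, _, h, hq⟩, fun hn => absurd hp hn⟩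
    | cond_false hp h => exact ⟨fun hn => absurd hn hp, fun _ => ⟨_, _, h, hq⟩⟩
  · rintro ⟨h₁, h₂⟩
    by_cases hp : p.holds s
    · obtain ⟨_, _, h, hq⟩ := h₁ hp
      exact ⟨_, _, .cond_true hp h, hq⟩
    · obtain ⟨_, _, h, hq⟩ := h₂ hp
      exact ⟨_, _, .cond_false hp h, hq⟩

/-- Loop rule: `μ` pays for the running time. -/
theorem WP.loop {p : Test} {c : Prog} (I : State → Prop) (μ : State → ℕ)
    (body : ∀ s, I s → p.holds s →
      WP c s fun t s' => I s' ∧ p.cost + 1 + t + μ s' ≤ μ s ∧ μ s' < μ s)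
    {s : State} (hs : I s) :
    WP (.loop p c) s fun t s' => (I s' ∧ ¬ p.holds s') ∧ t + μ s' ≤ μ s + (p.cost + 1) := by
  induction hm : μ s using Nat.strong_induction_on generalizing s with
  | _ m ih =>
    by_cases hp : p.holds s
    · obtain ⟨t₁, s₁, h₁, hI, hle, hlt⟩ := body s hs hp
      obtain ⟨t₂, s₂, h₂, hI₂, hle₂⟩ := ih (μ s₁) (by omega) hI rfl
      exact ⟨_, _, .loop_true hp h₁ h₂, hI₂, by omega⟩
    · exact ⟨_, _, .loop_false hp, ⟨hs, hp⟩, by omega⟩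

/-- Programs in sequence. -/
def block : List Prog → Prog
  | [] => .skip
  | c :: l => .seq c (block l)

@[simp] theorem wp_block_nil {s : State} {Q : ℕ → State → Prop} : WP (block []) s Q ↔ Q 1 s :=
  wp_skip

@[simp] theorem wp_block_cons {c : Prog} {l : List Prog} {s : State} {Q : ℕ → State → Prop} :
    WP (block (c :: l)) s Q ↔ WP c s fun t₁ s₁ => WP (block l) s₁ fun t₂ s₂ => Q (t₁ + t₂) s₂ :=
  wp_seq

/-! ### Expressions and states -/

instance : Add NExp := ⟨.add⟩
instance : Sub NExp := ⟨.sub⟩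
instance : Sub RExp := ⟨.sub⟩
instance : Mul RExp := ⟨.mul⟩

/-- register -/
abbrev nr : ℕ → NExp := NExp.reg
/-- constant -/
abbrev nl : ℕ → NExp := NExp.lit
/-- memory cell -/
abbrev nc : ℕ → NExp → NExp := NExp.cell
/-- register -/
abbrev rr : ℕ → RExp := RExp.reg
/-- constant -/
abbrev rl : ℕ → RExp := RExp.lit
/-- memory cell -/
abbrev rc : ℕ → NExp → RExp := RExp.cell

section
variable (s : State) (k r v b : ℕ) (a e : NExp) (f g : RExp) (z : ℝ) (p q : Test)

@[simp] theorem NExp.eval_lit : (NExp.lit k).eval s = k := rfl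
@[simp] theorem NExp.eval_reg : (NExp.reg k).eval s = s.nreg k := rfl
@[simp] theorem NExp.eval_cell : (NExp.cell b a).eval s = s.nmem b (a.eval s) := rfl
@[simp] theorem NExp.eval_add : (a + e).eval s = a.eval s + e.eval s := rfl
@[simp] theorem NExp.eval_sub : (a - e).eval s = a.eval s - e.eval s := rfl
@[simp] theorem NExp.eval_half : (NExp.half a).eval s = a.eval s / 2 := rfl
@[simp] theorem RExp.eval_lit : (RExp.lit k).eval s = k := rfl
@[simp] theorem RExp.eval_reg : (RExp.reg k).eval s = s.rreg k := rfl
@[simp] theorem RExp.eval_cell : (RExp.cell b a).eval s = s.rmem b (a.eval s) := rfl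
@[simp] theorem RExp.eval_sub : (f - g).eval s = f.eval s - g.eval s := rfl
@[simp] theorem RExp.eval_mul : (f * g).eval s = f.eval s * g.eval s := rfl
@[simp] theorem Test.holds_nlt : (Test.nlt a e).holds s ↔ a.eval s < e.eval s := Iff.rfl
@[simp] theorem Test.holds_rlt : (Test.rlt f g).holds s ↔ f.eval s < g.eval s := Iff.rfl
@[simp] theorem Test.holds_neg : (Test.neg p).holds s ↔ ¬ p.holds s := Iff.rfl
@[simp] theorem Test.holds_conj : (Test.conj p q).holds s ↔ p.holds s ∧ q.holds s := Iff.rfl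

@[simp] theorem NExp.cost_lit : (NExp.lit k).cost = 1 := rfl
@[simp] theorem NExp.cost_reg : (NExp.reg k).cost = 1 := rfl
@[simp] theorem NExp.cost_cell : (NExp.cell b a).cost = a.cost + 1 := rfl
@[simp] theorem NExp.cost_add : (a + e).cost = a.cost + e.cost + 1 := rfl
@[simp] theorem NExp.cost_sub : (a - e).cost = a.cost + e.cost + 1 := rfl
@[simp] theorem NExp.cost_half : (NExp.half a).cost = a.cost + 1 := rfl
@[simp] theorem RExp.cost_lit : (RExp.lit k).cost = 1 := rfl
@[simp] theorem RExp.cost_reg : (RExp.reg k).cost = 1 := rfl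
@[simp] theorem RExp.cost_cell : (RExp.cell b a).cost = a.cost + 1 := rfl
@[simp] theorem RExp.cost_sub : (f - g).cost = f.cost + g.cost + 1 := rfl
@[simp] theorem RExp.cost_mul : (f * g).cost = f.cost + g.cost + 1 := rfl
@[simp] theorem Test.cost_nlt : (Test.nlt a e).cost = a.cost + e.cost + 1 := rfl
@[simp] theorem Test.cost_rlt : (Test.rlt f g).cost = f.cost + g.cost + 1 := rfl
@[simp] theorem Test.cost_neg : (Test.neg p).cost = p.cost + 1 := rfl
@[simp] theorem Test.cost_conj : (Test.conj p q).cost = p.cost + q.cost + 1 := rfl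

@[simp] theorem State.setN_nreg : (s.setN r v).nreg k = if k = r then v else s.nreg k := by
  simp [State.setN, Function.update_apply]
@[simp] theorem State.setN_rreg : (s.setN r v).rreg = s.rreg := rfl
@[simp] theorem State.setN_nmem : (s.setN r v).nmem = s.nmem := rfl
@[simp] theorem State.setN_rmem : (s.setN r v).rmem = s.rmem := rfl
@[simp] theorem State.setR_rreg : (s.setR r z).rreg k = if k = r then z else s.rreg k := by
  simp [State.setR, Function.update_apply]
@[simp] theorem State.setR_nreg : (s.setR r z).nreg = s.nreg := rfl
@[simp] theorem State.setR_nmem : (s.setR r z).nmem = s.nmem := rfl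
@[simp] theorem State.setR_rmem : (s.setR r z).rmem = s.rmem := rfl
@[simp] theorem State.storeN_nreg : (s.storeN b k v).nreg = s.nreg := rfl
@[simp] theorem State.storeN_rreg : (s.storeN b k v).rreg = s.rreg := rfl
@[simp] theorem State.storeN_rmem : (s.storeN b k v).rmem = s.rmem := rfl
@[simp] theorem State.storeN_nmem (c l : ℕ) : (s.storeN b k v).nmem c l =
    if c = b then if l = k then v else s.nmem b l else s.nmem c l := by
  by_cases h : c = b
  · subst h; simp [State.storeN, Function.update_apply]
  · simp [State.storeN, h]
@[simp] theorem State.storeR_nreg : (s.storeR b k z).nreg = s.nreg := rfl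
@[simp] theorem State.storeR_rreg : (s.storeR b k z).rreg = s.rreg := rfl
@[simp] theorem State.storeR_nmem : (s.storeR b k z).nmem = s.nmem := rfl
@[simp] theorem State.storeR_rmem (c l : ℕ) : (s.storeR b k z).rmem c l =
    if c = b then if l = k then z else s.rmem b l else s.rmem c l := by
  by_cases h : c = b
  · subst h; simp [State.storeR, Function.update_apply]
  · simp [State.storeR, h]
end

/-! ### What a program leaves alone -/

/-- The program never writes to the natural register `r`. -/
def Prog.KeepsN (r : ℕ) : Prog → Prop
  | .setN r' _ => r ≠ r'
  | .seq c d => c.KeepsN r ∧ d.KeepsN r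
  | .cond _ c d => c.KeepsN r ∧ d.KeepsN r
  | .loop _ c => c.KeepsN r
  | _ => True

/-- The program never writes to the real register `r`. -/
def Prog.KeepsR (r : ℕ) : Prog → Prop
  | .setR r' _ => r ≠ r'
  | .seq c d => c.KeepsR r ∧ d.KeepsR r
  | .cond _ c d => c.KeepsR r ∧ d.KeepsR r
  | .loop _ c => c.KeepsR r
  | _ => True

/-- The program never writes to bank `b` of the natural memory. -/
def Prog.KeepsBank (b : ℕ) : Prog → Prop
  | .storeN b' _ _ => b ≠ b'
  | .seq c d => c.KeepsBank b ∧ d.KeepsBank b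
  | .cond _ c d => c.KeepsBank b ∧ d.KeepsBank b
  | .loop _ c => c.KeepsBank b
  | _ => True

/-- The program never writes to the real memory. -/
def Prog.KeepsRMem : Prog → Prop
  | .storeR _ _ _ => False
  | .seq c d => c.KeepsRMem ∧ d.KeepsRMem
  | .cond _ c d => c.KeepsRMem ∧ d.KeepsRMem
  | .loop _ c => c.KeepsRMem
  | _ => True

@[simp] theorem keepsN_block_nil (r : ℕ) : (block []).KeepsN r ↔ True := Iff.rfl
@[simp] theorem keepsN_block_cons (r : ℕ) (c : Prog) (l : List Prog) :
    (block (c :: l)).KeepsN r ↔ c.KeepsN r ∧ (block l).KeepsN r := Iff.rfl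
@[simp] theorem keepsR_block_nil (r : ℕ) : (block []).KeepsR r ↔ True := Iff.rfl
@[simp] theorem keepsR_block_cons (r : ℕ) (c : Prog) (l : List Prog) :
    (block (c :: l)).KeepsR r ↔ c.KeepsR r ∧ (block l).KeepsR r := Iff.rfl
@[simp] theorem keepsBank_block_nil (r : ℕ) : (block []).KeepsBank r ↔ True := Iff.rfl
@[simp] theorem keepsBank_block_cons (r : ℕ) (c : Prog) (l : List Prog) :
    (block (c :: l)).KeepsBank r ↔ c.KeepsBank r ∧ (block l).KeepsBank r := Iff.rfl
@[simp] theorem keepsRMem_block_nil : (block []).KeepsRMem ↔ True := Iff.rfl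
@[simp] theorem keepsRMem_block_cons (c : Prog) (l : List Prog) :
    (block (c :: l)).KeepsRMem ↔ c.KeepsRMem ∧ (block l).KeepsRMem := Iff.rfl

/-- Frame rule: the syntactic check on the text of the program spares carrying untouched registers
through every loop invariant. The next three lemmas do the same for real registers and the memory.
-/
theorem Exec.nreg_eq {c : Prog} {s s' : State} {t r : ℕ} (h : Exec c s t s') (hc : c.KeepsN r) :
    s'.nreg r = s.nreg r := by
  induction h with
  | setN s r' e => exact (State.setN_nreg ..).trans (if_neg hc)
  | seq _ _ ih₁ ih₂ => exact (ih₂ hc.2).trans (ih₁ hc.1)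
  | cond_true _ _ ih => exact ih hc.1
  | cond_false _ _ ih => exact ih hc.2
  | loop_true _ _ _ ih₁ ih₂ => exact (ih₂ hc).trans (ih₁ hc)
  | _ => rfl

theorem Exec.rreg_eq {c : Prog} {s s' : State} {t r : ℕ} (h : Exec c s t s') (hc : c.KeepsR r) :
    s'.rreg r = s.rreg r := by
  induction h with
  | setR s r' e => exact (State.setR_rreg ..).trans (if_neg hc)
  | seq _ _ ih₁ ih₂ => exact (ih₂ hc.2).trans (ih₁ hc.1)
  | cond_true _ _ ih => exact ih hc.1
  | cond_false _ _ ih => exact ih hc.2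
  | loop_true _ _ _ ih₁ ih₂ => exact (ih₂ hc).trans (ih₁ hc)
  | _ => rfl

theorem Exec.nmem_eq {c : Prog} {s s' : State} {t b : ℕ} (h : Exec c s t s')
    (hc : c.KeepsBank b) : s'.nmem b = s.nmem b := by
  induction h with
  | storeN s b' a e => exact funext fun _ => (State.storeN_nmem ..).trans (if_neg hc)
  | seq _ _ ih₁ ih₂ => exact (ih₂ hc.2).trans (ih₁ hc.1)
  | cond_true _ _ ih => exact ih hc.1
  | cond_false _ _ ih => exact ih hc.2
  | loop_true _ _ _ ih₁ ih₂ => exact (ih₂ hc).trans (ih₁ hc)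
  | _ => rfl

theorem Exec.rmem_eq {c : Prog} {s s' : State} {t : ℕ} (h : Exec c s t s') (hc : c.KeepsRMem) :
    s'.rmem = s.rmem := by
  induction h with
  | storeR => exact hc.elim
  | seq _ _ ih₁ ih₂ => exact (ih₂ hc.2).trans (ih₁ hc.1)
  | cond_true _ _ ih => exact ih hc.1
  | cond_false _ _ ih => exact ih hc.2
  | loop_true _ _ _ ih₁ ih₂ => exact (ih₂ hc).trans (ih₁ hc)
  | _ => rfl

/-- What the text of a program says about its runs can be used in specifications. -/
theorem WP.and_exec {c : Prog} {s : State} {Q : ℕ → State → Prop} (h : WP c s Q) :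
    WP c s fun t s' => Q t s' ∧ Exec c s t s' := by
  obtain ⟨t, s', he, hq⟩ := h
  exact ⟨t, s', he, hq, he⟩

/-! ### Directions, slopes and chains -/

/-- The linear functional with horizontal level lines for `(dx, dy) = (1, 0)`. -/
def val (x y : ℕ → ℝ) (dx dy : ℝ) (q : ℕ) : ℝ := dx * y q - dy * x q

/-- The slope of the line through two points. -/
noncomputable def slope (x y : ℕ → ℝ) (a b : ℕ) : ℝ := (y b - y a) / (x b - x a)

/-- `v` is at least as good as `q` for the functional `val`, ties being broken by `σ * x`. -/
def Dom (x y : ℕ → ℝ) (dx dy σ : ℝ) (q v : ℕ) : Prop :=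
  val x y dx dy q < val x y dx dy v ∨
    (val x y dx dy q = val x y dx dy v ∧ σ * x q ≤ σ * x v)

section
variable {x y : ℕ → ℝ} {dx dy σ : ℝ}

theorem Dom.refl (q : ℕ) : Dom x y dx dy σ q q := .inr ⟨rfl, le_rfl⟩

theorem Dom.trans {a b c : ℕ} (h₁ : Dom x y dx dy σ a b) (h₂ : Dom x y dx dy σ b c) :
    Dom x y dx dy σ a c := by
  rcases h₁ with h₁ | ⟨h₁, h₁'⟩ <;> rcases h₂ with h₂ | ⟨h₂, h₂'⟩
  · exact .inl (h₁.trans h₂)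
  · exact .inl (h₂ ▸ h₁)
  · exact .inl (h₁ ▸ h₂)
  · exact .inr ⟨h₁.trans h₂, h₁'.trans h₂'⟩

theorem Dom.val_le {a b : ℕ} (h : Dom x y dx dy σ a b) : val x y dx dy a ≤ val x y dx dy b := by
  rcases h with h | h
  exacts [h.le, h.1.le]

theorem val_sub {a b : ℕ} (h : x a < x b) :
    val x y dx dy b - val x y dx dy a = (dx * slope x y a b - dy) * (x b - x a) := by
  have : x b - x a ≠ 0 := by linarith
  rw [slope, sub_mul, mul_assoc, div_mul_cancel₀ _ this, val, val]
  ring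

/-- Comparing two points in a direction is comparing a slope with the direction, in a form without
division that still makes sense for `dx = 0`. Both readings are used: searches compare slopes,
programs evaluate `val`. -/
theorem val_le_iff {a b : ℕ} (h : x a < x b) :
    val x y dx dy a ≤ val x y dx dy b ↔ dy ≤ dx * slope x y a b := by
  rw [← sub_nonneg, val_sub h, mul_nonneg_iff_of_pos_right (by linarith), sub_nonneg]

theorem val_lt_iff {a b : ℕ} (h : x a < x b) :
    val x y dx dy a < val x y dx dy b ↔ dy < dx * slope x y a b := by
  rw [← sub_pos, val_sub h, mul_pos_iff_of_pos_right (by linarith), sub_pos]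

theorem dom_of_same_abscissa {a b : ℕ} (hdx : 0 ≤ dx) (hx : x a = x b) (hy : y a ≤ y b) :
    Dom x y dx dy σ a b := by
  rcases (mul_le_mul_of_nonneg_left hy hdx).lt_or_eq with h | h
  · left; simp only [val, hx]; linarith
  · right; simp only [val, hx]; exact ⟨by linarith, le_rfl⟩

/-- A point that is not above the segment between its neighbours is dominated by one of them. -/
theorem dom_of_not_above {u v p : ℕ} (hdx : 0 ≤ dx) (huv : x u < x v) (hvp : x v < x p)
    (hs : slope x y u v ≤ slope x y v p) : Dom x y dx dy σ v u ∨ Dom x y dx dy σ v p := by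
  have h₁ := val_sub (dx := dx) (dy := dy) (y := y) huv
  have h₂ := val_sub (dx := dx) (dy := dy) (y := y) hvp
  have hs' : dx * slope x y u v - dy ≤ dx * slope x y v p - dy := by
    have := mul_le_mul_of_nonneg_left hs hdx
    linarith
  have p₁ : 0 < x v - x u := by linarith
  have p₂ : 0 < x p - x v := by linarith
  -- If `val` falls on the way from `u` to `v`, then `u` is better; if it rises, it rises further to
  -- `p`. If it is constant up to `v` and does not rise afterwards, all three points tie, and the
  -- sign of `σ` decides between `u` and `p`.
  rcases lt_trichotomy (dx * slope x y u v - dy) 0 with h | h | h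
  · left; left
    have := mul_neg_of_neg_of_pos h p₁
    linarith
  · rw [h] at h₁ hs'
    rcases hs'.lt_or_eq with h' | h'
    · right; left
      have := mul_pos h' p₂
      linarith
    · rw [← h'] at h₂
      rcases le_total 0 σ with hσ | hσ
      · right; right
        exact ⟨by linarith, mul_le_mul_of_nonneg_left hvp.le hσ⟩
      · left; right
        exact ⟨by linarith, mul_le_mul_of_nonpos_left huv.le hσ⟩
  · right; left
    have := mul_pos (h.trans_le hs') p₂
    linarith

end

/-- Among the indices below `len`, exactly those below `r` satisfy `C`. -/
def IsRank (C : ℕ → Prop) (len r : ℕ) : Prop :=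
  r ≤ len ∧ (∀ k < r, C k) ∧ ∀ k, r ≤ k → k < len → ¬ C k

theorem exists_isRank {C : ℕ → Prop} {len : ℕ} (hC : ∀ k l, k ≤ l → l < len → C l → C k) :
    ∃ r, IsRank C len r := by
  classical
  have hex : ∃ r, r = len ∨ ¬ C r := ⟨len, .inl rfl⟩
  refine ⟨Nat.find hex, Nat.find_min' hex (.inl rfl), fun k hk => ?_, fun k hk hl hc => ?_⟩
  · have := Nat.find_min hex hk
    push Not at this
    exact this.2
  · rcases Nat.find_spec hex with h | h
    · omega
    · exact h (hC _ _ hk hl hc)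

theorem IsRank.iff {C : ℕ → Prop} {len r k : ℕ} (h : IsRank C len r) (hk : k < len) :
    C k ↔ k < r :=
  ⟨fun hc => by
    by_contra hn
    exact h.2.2 k (by omega) hk hc, h.2.1 k⟩

/-- The rank among all entries from the rank among the entries with odd index. -/
theorem IsRank.of_odd {C : ℕ → Prop} {len c : ℕ} (hC : ∀ k l, k ≤ l → l < len → C l → C k)
    (h : IsRank (fun k => C (2 * k + 1)) (len / 2) c) :
    (2 * c < len → C (2 * c) → IsRank C len (2 * c + 1)) ∧
      ((2 * c < len → ¬ C (2 * c)) → IsRank C len (2 * c)) := by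
  obtain ⟨h₁, h₂, h₃⟩ := h
  have lower : ∀ k < 2 * c, C k := fun k hk =>
    hC k (2 * (c - 1) + 1) (by omega) (by omega) (h₂ _ (by omega))
  -- An odd entry `2 * c + 1` that fails `C` rules out everything behind it. The last odd entry that
  -- satisfies `C`, in `lower`, settles everything before `2 * c`, so entry `2 * c` alone is open.
  have upper : ∀ k, 2 * c + 1 ≤ k → k < len → ¬ C k := fun k hk hl hc =>
    h₃ c le_rfl (by omega) (hC _ _ hk hl hc)
  refine ⟨fun hl hc => ⟨by omega, fun k hk => ?_, upper⟩, fun hc => ⟨by omega, lower, ?_⟩⟩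
  · rcases Nat.lt_succ_iff_lt_or_eq.1 hk with hk | rfl
    exacts [lower k hk, hc]
  · intro k hk hl
    rcases hk.eq_or_lt with rfl | hk
    exacts [hc hl, upper k hk hl]

/-- The vertices `H 0, …, H (len - 1)` form an upper hull of the points with index in `[lo, hi)`. -/
structure Chain (x y : ℕ → ℝ) (H : ℕ → ℕ) (len lo hi : ℕ) : Prop where
  pos : 0 < len
  mem : ∀ k < len, lo ≤ H k ∧ H k < hi
  inc : ∀ k, k + 1 < len → x (H k) < x (H (k + 1))
  concave : ∀ k, k + 2 < len →
    slope x y (H (k + 1)) (H (k + 2)) < slope x y (H k) (H (k + 1))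
  -- Since `σ` may have either sign, the chain contains both ends of every tie. The case `dx = 0` is
  -- included: there `val` is a multiple of the abscissa, and the chain reaches the leftmost and the
  -- rightmost abscissa of the block.
  dom : ∀ dx dy σ : ℝ, 0 ≤ dx → ∀ q, lo ≤ q → q < hi → ∃ k < len, Dom x y dx dy σ q (H k)

theorem Chain.slope_lt {x y : ℕ → ℝ} {H : ℕ → ℕ} {len lo hi : ℕ} (h : Chain x y H len lo hi)
    {k l : ℕ} (hkl : k < l) (hl : l + 1 < len) :
    slope x y (H l) (H (l + 1)) < slope x y (H k) (H (k + 1)) := by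
  induction l, hkl using Nat.le_induction with
  | base => exact h.concave k hl
  | succ l _ ih => exact (h.concave l hl).trans (ih (by omega))

/-- The vertices at and before the turn of the chain are optimal. -/
theorem Chain.dom_turn {x y : ℕ → ℝ} {H : ℕ → ℕ} {len lo hi : ℕ} (h : Chain x y H len lo hi)
    {dx dy : ℝ} (hdx : 0 ≤ dx) (hd : 0 < dx ∨ dy ≠ 0) {r : ℕ}
    (hr : IsRank (fun k => dy ≤ dx * slope x y (H k) (H (k + 1))) (len - 1) r)
    (σ : ℝ) (q : ℕ) (hq : lo ≤ q) (hq' : q < hi) :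
    Dom x y dx dy σ q (H r) ∨ Dom x y dx dy σ q (H (r - 1)) := by
  obtain ⟨k, hk, hdom⟩ := h.dom dx dy σ hdx q hq hq'
  obtain ⟨h₁, h₂, h₃⟩ := hr
  -- Edges from `r` on make `val` fall strictly, so no vertex behind the turn can be needed.
  have after : ∀ k, r < k → k < len → val x y dx dy (H k) < val x y dx dy (H r) := by
    intro k hrk
    have step : ∀ l, r ≤ l → l + 1 < len →
        val x y dx dy (H (l + 1)) < val x y dx dy (H l) := fun l hl hl' => by
      rw [← not_le, val_le_iff (h.inc l hl')]
      exact h₃ l hl (by omega)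
    induction k, hrk using Nat.le_induction with
    | base => exact step r le_rfl
    | succ k hk ih => exact fun hl => (step k (by omega) hl).trans (ih (by omega))
  -- Edges before the last one with `C` make `val` rise strictly: for `dx > 0` by strict concavity,
  -- for `dx = 0` because `dy ≠ 0`. Only the edge from `r - 1` to `r` may be level, which is why two
  -- candidates are returned. For `r = 0` they coincide by truncation.
  have before : ∀ l, k < l → l < r → val x y dx dy (H k) < val x y dx dy (H l) := by
    intro l hkl
    have step : ∀ l, l + 1 < r → val x y dx dy (H l) < val x y dx dy (H (l + 1)) := fun l hl => by
      rw [val_lt_iff (h.inc l (by omega))]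
      have e₁ := h₂ (l + 1) hl
      have e₂ := h.concave l (by omega)
      rcases hdx.lt_or_eq with h0 | h0
      · exact lt_of_le_of_lt e₁ (mul_lt_mul_of_pos_left e₂ h0)
      · rw [← h0, zero_mul] at e₁ ⊢
        exact lt_of_le_of_ne e₁ (hd.resolve_left (by simp [← h0]))
    induction l, hkl using Nat.le_induction with
    | base => exact step k
    | succ l hl ih => exact fun hl' => (ih (by omega)).trans (step l hl')
  rcases lt_trichotomy k r with hkr | rfl | hkr
  · right
    rcases (show k ≤ r - 1 by omega).eq_or_lt with rfl | hlt
    · exact hdom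
    · exact hdom.trans (.inl (before (r - 1) hlt (by omega)))
  · exact .inl hdom
  · exact .inl (hdom.trans (.inl (after k hkr hk)))

/-! ### Cascades -/

/-- `s` is the sorted union of three sorted lists `e κ`, and `c κ r` counts the entries of `e κ`
among the first `r` entries of `s`. -/
structure Merged (len : ℕ) (s : ℕ → ℝ) (l : Fin 3 → ℕ) (e : Fin 3 → ℕ → ℝ)
    (c : Fin 3 → ℕ → ℕ) : Prop where
  le : ∀ κ, ∀ r ≤ len, c κ r ≤ l κ
  zero : ∀ κ, c κ 0 = 0
  last : ∀ κ, c κ len = l κ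
  before : ∀ κ, ∀ r < len, ∀ k < c κ (r + 1), s r ≤ e κ k
  after : ∀ κ, ∀ r < len, ∀ k, c κ r ≤ k → k < l κ → e κ k ≤ s r

/-- Entries consumed within the first `r` steps are at least as large as entry `r - 1` of the merged
list, which satisfies `P`; entries not yet consumed are at most entry `r`, which does not. So the
stored count is the rank, for every upward closed `P` at once. This is the correctness of the
cascading tables. -/
theorem Merged.isRank {len : ℕ} {s : ℕ → ℝ} {l : Fin 3 → ℕ} {e : Fin 3 → ℕ → ℝ}
    {c : Fin 3 → ℕ → ℕ} (h : Merged len s l e c) {P : ℝ → Prop}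
    (hP : ∀ a b, a ≤ b → P a → P b) {r : ℕ} (hr : IsRank (fun k => P (s k)) len r) (κ : Fin 3) :
    IsRank (fun k => P (e κ k)) (l κ) (c κ r) := by
  refine ⟨h.le κ r hr.1, fun k hk => ?_, fun k hk hk' hp => ?_⟩
  · obtain _ | r := r
    · simp [h.zero] at hk
    · exact hP _ _ (h.before κ r hr.1 k hk) (hr.2.1 r (by omega))
  · rcases hr.1.lt_or_eq with hlt | rfl
    · exact hr.2.2 r le_rfl hlt (hP _ _ (h.after κ r hlt k hk hk') hp)
    · rw [h.last] at hk
      omega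

/-- Slope of the `k`-th edge in the list stored at address `A`. -/
noncomputable def edgeSlope (x y : ℕ → ℝ) (M : ℕ → ℕ → ℕ) (β A k : ℕ) : ℝ :=
  slope x y (M (β + 3) (A + k)) (M (β + 4) (A + k))

/-- The data stored at address `A` for the block `[b, b + p)`: the upper hull, and a sorted list of
edges in which the edges of the hull can be located. -/
structure Node (x y : ℕ → ℝ) (M : ℕ → ℕ → ℕ) (β A b p : ℕ) : Prop where
  chain : Chain x y (fun k => M (β + 1) (A + k)) (M β A) b (b + p)
  chain_len : M β A ≤ p
  -- The ranks run from `0` to the length inclusive, so the tables of counts need one cell more than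
  -- the list. All of them fit into the `2 * p` cells of the node. The halving of the lists of the
  -- children keeps this bound through the recursion.
  len : M (β + 2) A + 1 ≤ 2 * p
  edge : ∀ k < M (β + 2) A, x (M (β + 3) (A + k)) < x (M (β + 4) (A + k))
  sorted : ∀ k l, k ≤ l → l < M (β + 2) A → edgeSlope x y M β A l ≤ edgeSlope x y M β A k
  -- Quantifying over all upward closed `P` makes the table independent of the direction. It is
  -- applied to `dy ≤ dx * a` as a condition on `a`, which is upward closed as soon as `0 ≤ dx`.
  own : ∀ P : ℝ → Prop, (∀ a b, a ≤ b → P a → P b) →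
    ∀ r, IsRank (fun k => P (edgeSlope x y M β A k)) (M (β + 2) A) r →
      IsRank (fun k => P (slope x y (M (β + 1) (A + k)) (M (β + 1) (A + (k + 1)))))
        (M β A - 1) (M (β + 5) (A + r))

/-- The bank `c` links the list at address `A` to every second entry of the list at `A'`. -/
def Link (x y : ℕ → ℝ) (M : ℕ → ℕ → ℕ) (β c A A' : ℕ) : Prop :=
  ∀ P : ℝ → Prop, (∀ a b, a ≤ b → P a → P b) →
    ∀ r, IsRank (fun k => P (edgeSlope x y M β A k)) (M (β + 2) A) r →
      IsRank (fun k => P (edgeSlope x y M β A' (2 * k + 1))) (M (β + 2) A' / 2) (M c (A + r))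

/-- The whole structure for `2 ^ K` points; the address of the block with start `b` on level `t` is
`t * (2 * 2 ^ K) + (b + b)`. -/
structure Structure (x y : ℕ → ℝ) (M : ℕ → ℕ → ℕ) (β K : ℕ) : Prop where
  node : ∀ t ≤ K, ∀ b, 2 ^ t ∣ b → b < 2 ^ K →
    Node x y M β (t * (2 * 2 ^ K) + (b + b)) b (2 ^ t)
  link : ∀ t < K, ∀ b, 2 ^ (t + 1) ∣ b → b < 2 ^ K →
    Link x y M β (β + 6) ((t + 1) * (2 * 2 ^ K) + (b + b)) (t * (2 * 2 ^ K) + (b + b)) ∧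
    Link x y M β (β + 7) ((t + 1) * (2 * 2 ^ K) + (b + b))
      (t * (2 * 2 ^ K) + ((b + 2 ^ t) + (b + 2 ^ t)))

/-! ### Merging two upper hulls -/

/-- Lexicographic order of points. -/
def LexLe (x y : ℕ → ℝ) (a b : ℕ) : Prop := x a < x b ∨ (x a = x b ∧ y a ≤ y b)

/-- A stack `st 0, …, st (k - 1)` is an upper hull, and together with the points in `rem`,
which come later in the lexicographic order, it dominates all points of the block. -/
structure Scan (x y : ℕ → ℝ) (st : ℕ → ℕ) (k lo hi : ℕ) (rem : Set ℕ) : Prop where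
  mem : ∀ r < k, lo ≤ st r ∧ st r < hi
  inc : ∀ r, r + 1 < k → x (st r) < x (st (r + 1))
  concave : ∀ r, r + 2 < k →
    slope x y (st (r + 1)) (st (r + 2)) < slope x y (st r) (st (r + 1))
  dom : ∀ dx dy σ : ℝ, 0 ≤ dx → ∀ q, lo ≤ q → q < hi →
    ∃ v, Dom x y dx dy σ q v ∧ ((∃ r < k, v = st r) ∨ v ∈ rem)
  lex : 0 < k → ∀ v ∈ rem, LexLe x y (st (k - 1)) v

section
variable {x y : ℕ → ℝ} {st : ℕ → ℕ} {k lo hi p : ℕ} {rem : Set ℕ}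

/-- The top is dispensable for one of two reasons. Either `p` has the same abscissa and is not
lower, and then `p` dominates it; or the top is not above the segment from the vertex beneath it to
`p`, and `dom_of_not_above` applies. The lexicographic order excludes all other cases. -/
theorem Scan.pop (h : Scan x y st k lo hi (insert p rem)) (hk : 0 < k)
    (hpop : x (st (k - 1)) < x p → 1 < k ∧
      slope x y (st (k - 2)) (st (k - 1)) ≤ slope x y (st (k - 1)) p) :
    Scan x y st (k - 1) lo hi (insert p rem) := by
  refine ⟨fun r hr => h.mem r (by omega), fun r hr => h.inc r (by omega),
    fun r hr => h.concave r (by omega), fun dx dy σ hdx q hq hq' => ?_, fun hk' v hv => ?_⟩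
  · obtain ⟨v, hv, hv'⟩ := h.dom dx dy σ hdx q hq hq'
    rcases hv' with ⟨r, hr, rfl⟩ | hv'
    · rcases (show r ≤ k - 1 by omega).lt_or_eq with hlt | rfl
      · exact ⟨_, hv, .inl ⟨r, hlt, rfl⟩⟩
      · rcases h.lex hk p (Set.mem_insert _ _) with hx | ⟨hx, hy⟩
        · obtain ⟨h1, hs⟩ := hpop hx
          have := h.inc (k - 2) (by omega)
          rw [show k - 2 + 1 = k - 1 by omega] at this
          rcases dom_of_not_above (dy := dy) (σ := σ) hdx this hx hs with hd | hd
          · exact ⟨_, hv.trans hd, .inl ⟨k - 2, by omega, rfl⟩⟩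
          · exact ⟨_, hv.trans hd, .inr (Set.mem_insert _ _)⟩
        · exact ⟨p, hv.trans (dom_of_same_abscissa hdx hx hy), .inr (Set.mem_insert _ _)⟩
    · exact ⟨_, hv, .inr hv'⟩
  -- The new top has a smaller abscissa than the removed one, hence still precedes all remaining
  -- points.
  · have := h.inc (k - 2) (by omega)
    rw [show k - 2 + 1 = k - 1 by omega] at this
    rw [show k - 1 - 1 = k - 2 by omega]
    rcases h.lex hk v hv with hx | ⟨hx, hy⟩
    · exact .inl (this.trans hx)
    · exact .inl (hx ▸ this)

/-- The guard `hpush` is what remains when no removal is possible: the top lies strictly to the left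
and the turn is strictly concave, which are the two chain conditions at the new end. -/
theorem Scan.push (h : Scan x y st k lo hi (insert p rem)) (hp : lo ≤ p ∧ p < hi)
    (hmin : ∀ v ∈ rem, LexLe x y p v)
    (hpush : 0 < k → x (st (k - 1)) < x p ∧ (1 < k →
      slope x y (st (k - 1)) p < slope x y (st (k - 2)) (st (k - 1))))
    {st' : ℕ → ℕ} (heq : ∀ r < k, st' r = st r) (hk' : st' k = p) :
    Scan x y st' (k + 1) lo hi rem := by
  refine ⟨fun r hr => ?_, fun r hr => ?_, fun r hr => ?_, fun dx dy σ hdx q hq hq' => ?_,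
    fun _ v hv => ?_⟩
  · rcases Nat.lt_succ_iff_lt_or_eq.1 hr with hr | rfl
    · rw [heq r hr]; exact h.mem r hr
    · rwa [hk']
  · rcases (show r + 1 ≤ k by omega).lt_or_eq with hr | rfl
    · rw [heq r (by omega), heq _ hr]; exact h.inc r hr
    · rw [hk', heq r (by omega)]; exact (hpush (by omega)).1
  · rcases (show r + 2 ≤ k by omega).lt_or_eq with hr | rfl
    · rw [heq r (by omega), heq _ hr, heq (r + 1) (by omega)]; exact h.concave r hr
    · rw [hk', heq r (by omega), heq (r + 1) (by omega)]
      exact (hpush (by omega)).2 (by omega)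
  · obtain ⟨v, hv, hv'⟩ := h.dom dx dy σ hdx q hq hq'
    refine ⟨v, hv, ?_⟩
    rcases hv' with ⟨r, hr, rfl⟩ | rfl | hv'
    · exact .inl ⟨r, by omega, (heq r hr).symm⟩
    · exact .inl ⟨k, by omega, hk'.symm⟩
    · exact .inr hv'
  · rw [Nat.add_sub_cancel, hk']
    exact hmin v hv

theorem Scan.chain (h : Scan x y st k lo hi ∅) (hlh : lo < hi) : Chain x y st k lo hi := by
  have hdom : ∀ dx dy σ : ℝ, 0 ≤ dx → ∀ q, lo ≤ q → q < hi →
      ∃ r < k, Dom x y dx dy σ q (st r) := fun dx dy σ hdx q hq hq' => by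
    obtain ⟨v, hv, ⟨r, hr, rfl⟩ | hv'⟩ := h.dom dx dy σ hdx q hq hq'
    · exact ⟨r, hr, hv⟩
    · exact hv'.elim
  refine ⟨?_, h.mem, h.inc, h.concave, hdom⟩
  obtain ⟨r, hr, -⟩ := hdom 1 0 0 zero_le_one lo le_rfl hlh
  omega

end

/-- The vertices of two chains that have not yet been scanned. -/
def Remaining (f g : ℕ → ℕ) (ia la ib lb : ℕ) : Set ℕ :=
  {v | (∃ r, ia ≤ r ∧ r < la ∧ v = f r) ∨ ∃ r, ib ≤ r ∧ r < lb ∧ v = g r}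

theorem remaining_left {f g : ℕ → ℕ} {ia la ib lb : ℕ} (h : ia < la) :
    Remaining f g ia la ib lb = insert (f ia) (Remaining f g (ia + 1) la ib lb) := by
  ext v
  simp only [Remaining, Set.mem_ofPred_eq, Set.mem_insert_iff]
  constructor
  · rintro (⟨r, h₁, h₂, rfl⟩ | h')
    · rcases h₁.eq_or_lt with rfl | h₁
      exacts [.inl rfl, .inr (.inl ⟨r, h₁, h₂, rfl⟩)]
    · exact .inr (.inr h')
  · rintro (rfl | ⟨r, h₁, h₂, rfl⟩ | h')
    exacts [.inl ⟨ia, le_rfl, h, rfl⟩, .inl ⟨r, by omega, h₂, rfl⟩, .inr h']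

theorem remaining_swap {f g : ℕ → ℕ} {ia la ib lb : ℕ} :
    Remaining f g ia la ib lb = Remaining g f ib lb ia la := by
  ext v
  exact or_comm

theorem remaining_right {f g : ℕ → ℕ} {ia la ib lb : ℕ} (h : ib < lb) :
    Remaining f g ia la ib lb = insert (g ib) (Remaining f g ia la (ib + 1) lb) := by
  rw [remaining_swap, remaining_left h, remaining_swap]

theorem inc_of_consecutive {x : ℕ → ℝ} {f : ℕ → ℕ} {l : ℕ}
    (h : ∀ k, k + 1 < l → x (f k) < x (f (k + 1))) {i j : ℕ} (hij : i < j) (hj : j < l) :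
    x (f i) < x (f j) := by
  induction j, hij using Nat.le_induction with
  | base => exact h i hj
  | succ j _ ih => exact (ih (by omega)).trans (h j hj)

theorem LexLe.trans_lt {x y : ℕ → ℝ} {a b c : ℕ} (h : LexLe x y a b) (h' : x b < x c) :
    LexLe x y a c := by
  rcases h with h | h
  exacts [.inl (h.trans h'), .inl (h.1 ▸ h')]

/-- In each chain the abscissas increase strictly, so a next vertex precedes the rest of its own
chain, and one comparison of the two next vertices settles the order against the other chain. -/
theorem lexLe_remaining {x y : ℕ → ℝ} {f g : ℕ → ℕ} {ia la ib lb : ℕ}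
    (hf : ∀ k, k + 1 < la → x (f k) < x (f (k + 1)))
    (hg : ∀ k, k + 1 < lb → x (g k) < x (g (k + 1)))
    (h : ib < lb → LexLe x y (f ia) (g ib)) :
    ∀ v ∈ Remaining f g (ia + 1) la ib lb, LexLe x y (f ia) v := by
  rintro v (⟨r, h₁, h₂, rfl⟩ | ⟨r, h₁, h₂, rfl⟩)
  · exact .inl (inc_of_consecutive hf h₁ h₂)
  · rcases h₁.eq_or_lt with rfl | h₁
    · exact h h₂
    · exact (h (by omega)).trans_lt (inc_of_consecutive hg h₁ h₂)

/-- Next vertex of the left chain. -/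
abbrev headL (β : ℕ) : NExp := nc (β + 1) (nr 10 + nr 15)
/-- Next vertex of the right chain. -/
abbrev headR (β : ℕ) : NExp := nc (β + 1) (nr 11 + nr 16)
/-- Last vertex on the stack. -/
abbrev top1 (β : ℕ) : NExp := nc (β + 1) (nr 12 + nr 17 - nl 1)
/-- Last but one vertex on the stack. -/
abbrev top2 (β : ℕ) : NExp := nc (β + 1) (nr 12 + nr 17 - nl 2)

/-- Compares the slopes of `(a, b)` and `(c, d)`. -/
abbrev slopeLt (Y : ℕ) (a b c d : NExp) : Test :=
  .rlt ((rc Y b - rc Y a) * (rc 0 d - rc 0 c)) ((rc Y d - rc Y c) * (rc 0 b - rc 0 a))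

/-- Moves the next vertex in lexicographic order to register `18`. -/
def selectVertex (Y β : ℕ) : Prog :=
  .cond (.conj (.nlt (nr 15) (nr 13)) (.neg (.conj (.nlt (nr 16) (nr 14))
      (.neg (.conj (.neg (.rlt (rc 0 (headR β)) (rc 0 (headL β))))
        (.neg (.conj (.neg (.rlt (rc 0 (headL β)) (rc 0 (headR β))))
          (.rlt (rc Y (headR β)) (rc Y (headL β))))))))))
    (block [.setN 18 (headL β), .setN 15 (nr 15 + nl 1)])
    (block [.setN 18 (headR β), .setN 16 (nr 16 + nl 1)])

/-- The test of `popVertices`. -/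
def popTest (Y β : ℕ) : Test :=
  .conj (.nlt (nl 0) (nr 17)) (.neg (.conj (.rlt (rc 0 (top1 β)) (rc 0 (nr 18)))
    (.neg (.conj (.nlt (nl 1) (nr 17))
      (.neg (slopeLt Y (top1 β) (nr 18) (top2 β) (top1 β)))))))

/-- Removes from the stack the vertices that are no longer on the hull. -/
def popVertices (Y β : ℕ) : Prog := .loop (popTest Y β) (.setN 17 (nr 17 - nl 1))

/-- Merges the chains at the addresses in registers `10`, `11` into one at that in `12`. -/
def mergeChains (Y β : ℕ) : Prog := block [
  .setN 13 (nc β (nr 10)), .setN 14 (nc β (nr 11)), .setN 15 (nl 0), .setN 16 (nl 0),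
  .setN 17 (nl 0),
  .loop (.nlt (nr 15 + nr 16) (nr 13 + nr 14)) (block [selectVertex Y β, popVertices Y β,
    .storeN (β + 1) (nr 12 + nr 17) (nr 18), .setN 17 (nr 17 + nl 1)]),
  .storeN β (nr 12) (nr 17)]

/-- The machine cannot divide. Cross multiplication is legitimate because both edges point to the
right. -/
theorem slope_lt_iff {x y : ℕ → ℝ} {a b c d : ℕ} (hab : x a < x b) (hcd : x c < x d) :
    (y b - y a) * (x d - x c) < (y d - y c) * (x b - x a) ↔ slope x y a b < slope x y c d := by
  rw [slope, slope, div_lt_div_iff₀ (by linarith) (by linarith)]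

/-- Invariant of `mergeChains`. -/
structure MergeInv (R : ℕ → ℕ → ℝ) (Y β : ℕ) (M : ℕ → ℕ → ℕ) (AL AR AP lo hi : ℕ)
    (s : State) : Prop where
  rmem : s.rmem = R
  r10 : s.nreg 10 = AL
  r11 : s.nreg 11 = AR
  r12 : s.nreg 12 = AP
  r13 : s.nreg 13 = M β AL
  r14 : s.nreg 14 = M β AR
  ia : s.nreg 15 ≤ M β AL
  ib : s.nreg 16 ≤ M β AR
  k : s.nreg 17 ≤ s.nreg 15 + s.nreg 16
  mem : ∀ c l, (c ≠ β + 1 ∨ l < AP ∨ AP + M β AL + M β AR ≤ l) → s.nmem c l = M c l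
  scan : Scan (R 0) (R Y) (fun r => s.nmem (β + 1) (AP + r)) (s.nreg 17) lo hi
    (Remaining (fun r => M (β + 1) (AL + r)) (fun r => M (β + 1) (AR + r)) (s.nreg 15) (M β AL)
      (s.nreg 16) (M β AR))

/-- The cost is stated with potential `100` per vertex on the stack, so that removals are paid for
by earlier insertions. The last clause is the negation of the loop test, in the form needed by
`Scan.push`. -/
theorem popVertices_spec {R : ℕ → ℕ → ℝ} {Y β lo hi AP : ℕ} {rem : Set ℕ} {s : State}
    (hR : s.rmem = R) (hAP : s.nreg 12 = AP)
    (h : Scan (R 0) (R Y) (fun r => s.nmem (β + 1) (AP + r)) (s.nreg 17) lo hi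
      (insert (s.nreg 18) rem)) :
    WP (popVertices Y β) s fun t s' => t + 100 * s'.nreg 17 ≤ 100 * s.nreg 17 + 100 ∧
      s'.nreg 17 ≤ s.nreg 17 ∧
      Scan (R 0) (R Y) (fun r => s.nmem (β + 1) (AP + r)) (s'.nreg 17) lo hi
        (insert (s.nreg 18) rem) ∧
      (0 < s'.nreg 17 → R 0 (s.nmem (β + 1) (AP + (s'.nreg 17 - 1))) < R 0 (s.nreg 18) ∧
        (1 < s'.nreg 17 →
          slope (R 0) (R Y) (s.nmem (β + 1) (AP + (s'.nreg 17 - 1))) (s.nreg 18) <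
            slope (R 0) (R Y) (s.nmem (β + 1) (AP + (s'.nreg 17 - 2)))
              (s.nmem (β + 1) (AP + (s'.nreg 17 - 1))))) := by
  have htest : ∀ s' : State, s'.rmem = R → s'.nreg 12 = AP → s'.nreg 18 = s.nreg 18 →
      s'.nmem = s.nmem → Scan (R 0) (R Y) (fun r => s.nmem (β + 1) (AP + r)) (s'.nreg 17) lo hi
        (insert (s.nreg 18) rem) → ((popTest Y β).holds s' ↔ 0 < s'.nreg 17 ∧
        (R 0 (s.nmem (β + 1) (AP + (s'.nreg 17 - 1))) < R 0 (s.nreg 18) → 1 < s'.nreg 17 ∧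
        slope (R 0) (R Y) (s.nmem (β + 1) (AP + (s'.nreg 17 - 2)))
          (s.nmem (β + 1) (AP + (s'.nreg 17 - 1))) ≤
        slope (R 0) (R Y) (s.nmem (β + 1) (AP + (s'.nreg 17 - 1))) (s.nreg 18))) := by
    intro s' h₁ h₂ h₃ h₄ hs
    simp only [popTest, Test.holds_conj, Test.holds_neg, Test.holds_nlt, Test.holds_rlt,
      NExp.eval_lit, NExp.eval_reg, NExp.eval_cell, NExp.eval_add, NExp.eval_sub, RExp.eval_cell,
      RExp.eval_sub, RExp.eval_mul, h₁, h₂, h₃, h₄, not_and, not_not, Classical.not_imp]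
    refine and_congr_right fun hk => ?_
    -- The program subtracts after adding the base address. This agrees with the index `k - 1` only
    -- because the stack is known to be nonempty at this point.
    rw [show AP + s'.nreg 17 - 1 = AP + (s'.nreg 17 - 1) by omega]
    refine imp_congr_right fun hx => and_congr_right fun hk' => ?_
    have := hs.inc (s'.nreg 17 - 2) (by omega)
    simp only [show s'.nreg 17 - 2 + 1 = s'.nreg 17 - 1 by omega] at this
    rw [show AP + s'.nreg 17 - 2 = AP + (s'.nreg 17 - 2) by omega, slope_lt_iff hx this, not_lt]
  refine (WP.loop (fun s' => s'.rmem = R ∧ s'.nreg 12 = AP ∧ s'.nreg 18 = s.nreg 18 ∧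
      s'.nmem = s.nmem ∧ s'.nreg 17 ≤ s.nreg 17 ∧
      Scan (R 0) (R Y) (fun r => s.nmem (β + 1) (AP + r)) (s'.nreg 17) lo hi
        (insert (s.nreg 18) rem)) (fun s' => 100 * s'.nreg 17) ?_
      ⟨hR, hAP, rfl, rfl, le_rfl, h⟩).mono ?_
  · rintro s' ⟨h₁, h₂, h₃, h₄, h₅, hs⟩ ht
    obtain ⟨hk, hpop⟩ := (htest s' h₁ h₂ h₃ h₄ hs).1 ht
    simp [h₁, h₂, h₃, h₄, popTest]
    exact ⟨⟨by omega, hs.pop hk hpop⟩, by omega, by omega⟩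
  · rintro t s' ⟨⟨⟨h₁, h₂, h₃, h₄, h₅, hs⟩, ht⟩, hcost⟩
    rw [htest s' h₁ h₂ h₃ h₄ hs] at ht
    simp [popTest] at hcost
    refine ⟨by omega, h₅, hs, fun hk => ?_⟩
    push Not at ht
    obtain ⟨hx, hs'⟩ := ht hk
    exact ⟨hx, hs'⟩

theorem selectVertex_spec {R : ℕ → ℕ → ℝ} {Y β AL AR AP lo hi : ℕ} {M : ℕ → ℕ → ℕ} {s : State}
    (hLm : ∀ k < M β AL, lo ≤ M (β + 1) (AL + k) ∧ M (β + 1) (AL + k) < hi)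
    (hLi : ∀ k, k + 1 < M β AL → R 0 (M (β + 1) (AL + k)) < R 0 (M (β + 1) (AL + (k + 1))))
    (hRm : ∀ k < M β AR, lo ≤ M (β + 1) (AR + k) ∧ M (β + 1) (AR + k) < hi)
    (hRi : ∀ k, k + 1 < M β AR → R 0 (M (β + 1) (AR + k)) < R 0 (M (β + 1) (AR + (k + 1))))
    (hAL : AL + M β AL ≤ AP) (hAR : AR + M β AR ≤ AP)
    (h : MergeInv R Y β M AL AR AP lo hi s)
    (hlt : s.nreg 15 + s.nreg 16 < M β AL + M β AR) :
    WP (selectVertex Y β) s fun t s' => t ≤ 70 ∧ s'.nmem = s.nmem ∧ s'.rmem = s.rmem ∧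
      s'.nreg 10 = AL ∧ s'.nreg 11 = AR ∧ s'.nreg 12 = AP ∧ s'.nreg 13 = M β AL ∧
      s'.nreg 14 = M β AR ∧ s'.nreg 17 = s.nreg 17 ∧
      s'.nreg 15 ≤ M β AL ∧ s'.nreg 16 ≤ M β AR ∧
      s'.nreg 15 + s'.nreg 16 = s.nreg 15 + s.nreg 16 + 1 ∧
      lo ≤ s'.nreg 18 ∧ s'.nreg 18 < hi ∧
      Remaining (fun r => M (β + 1) (AL + r)) (fun r => M (β + 1) (AR + r)) (s.nreg 15) (M β AL)
        (s.nreg 16) (M β AR) = insert (s'.nreg 18)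
        (Remaining (fun r => M (β + 1) (AL + r)) (fun r => M (β + 1) (AR + r)) (s'.nreg 15)
          (M β AL) (s'.nreg 16) (M β AR)) ∧
      ∀ v ∈ Remaining (fun r => M (β + 1) (AL + r)) (fun r => M (β + 1) (AR + r)) (s'.nreg 15)
          (M β AL) (s'.nreg 16) (M β AR), LexLe (R 0) (R Y) (s'.nreg 18) v := by
  obtain ⟨h₁, h₂, h₃, h₄, h₅, h₆, h₇, h₈, h₉, hm, hs⟩ := h
  have ea : s.nreg 15 < M β AL → s.nmem (β + 1) (AL + s.nreg 15) = M (β + 1) (AL + s.nreg 15) :=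
    fun _ => hm _ _ (by omega)
  have eb : s.nreg 16 < M β AR → s.nmem (β + 1) (AR + s.nreg 16) = M (β + 1) (AR + s.nreg 16) :=
    fun _ => hm _ _ (by omega)
  -- The nested negations of the test in `selectVertex` express lexicographic order; in a tie the
  -- left chain goes first.
  have lexle : ∀ a b, (R 0 b < R 0 a → ¬ LexLe (R 0) (R Y) a b) ∧ (LexLe (R 0) (R Y) a b ↔
      ¬ R 0 b < R 0 a ∧ (¬ R 0 a < R 0 b → ¬ R Y b < R Y a)) := fun a b => by
    rw [not_lt, not_lt, not_lt, LexLe]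
    constructor
    · rintro h (h' | h') <;> linarith
    · constructor
      · rintro (h | h)
        · exact ⟨h.le, fun h' => absurd h (not_lt.2 h')⟩
        · exact ⟨h.1.le, fun _ => h.2⟩
      · rintro ⟨h, h'⟩
        rcases h.lt_or_eq with h | h
        · exact .inl h
        · exact .inr ⟨h, h' h.ge⟩
  refine wp_cond.2 ⟨fun ht => ?_, fun ht => ?_⟩
  · have hia : s.nreg 15 < M β AL := by
      have := ht.1
      simpa [h₅] using this
    have hlex : s.nreg 16 < M β AR → LexLe (R 0) (R Y) (M (β + 1) (AL + s.nreg 15))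
        (M (β + 1) (AR + s.nreg 16)) := fun hib => by
      have := ht.2
      simp only [Test.holds_conj, Test.holds_neg, Test.holds_nlt, Test.holds_rlt, RExp.eval_cell,
        NExp.eval_cell, NExp.eval_reg, NExp.eval_add, h₁, h₂, h₃, h₆, ea hia, eb hib, hib,
        true_and, not_not, not_and, Classical.not_imp] at this
      exact (lexle _ _).2.2 this
    have hmem := hLm _ hia
    have hmin := lexLe_remaining (y := R Y) (f := fun r => M (β + 1) (AL + r)) (g := fun r => M (β + 1) (AR + r)) hLi hRi hlex
    simp [h₁, h₂, h₃, h₄, h₅, h₆, ea hia]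
    exact ⟨hia, h₈, by omega, hmem.1, hmem.2, remaining_left hia, hmin⟩
  · have hib : s.nreg 16 < M β AR := by
      by_contra hib
      apply ht
      simp [h₅, h₆, hib]
      omega
    have hlex : s.nreg 15 < M β AL → LexLe (R 0) (R Y) (M (β + 1) (AR + s.nreg 16))
        (M (β + 1) (AL + s.nreg 15)) := fun hia => by
      simp only [Test.holds_conj, Test.holds_neg, Test.holds_nlt, Test.holds_rlt, RExp.eval_cell,
        NExp.eval_cell, NExp.eval_reg, NExp.eval_add, h₁, h₂, h₃, h₅, h₆, ea hia, eb hib, hib,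
        hia, true_and, not_not] at ht
      have hn : ¬ LexLe (R 0) (R Y) (M (β + 1) (AL + s.nreg 15))
          (M (β + 1) (AR + s.nreg 16)) := fun hl => ht (by
        have := (lexle _ _).2.1 hl
        exact ⟨this.1, fun hc => this.2 hc.1 hc.2⟩)
      rcases lt_trichotomy (R 0 (M (β + 1) (AR + s.nreg 16)))
        (R 0 (M (β + 1) (AL + s.nreg 15))) with h | h | h
      · exact .inl h
      · refine .inr ⟨h, le_of_not_ge fun hy => hn (.inr ⟨h.symm, hy⟩)⟩
      · exact absurd (.inl h) hn
    have hmem := hRm _ hib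
    have hmin := lexLe_remaining (y := R Y) (f := fun r => M (β + 1) (AR + r)) (g := fun r => M (β + 1) (AL + r)) hRi hLi hlex
    simp [h₁, h₂, h₃, h₄, h₅, h₆, eb hib]
    refine ⟨h₇, hib, by omega, hmem.1, hmem.2, remaining_right hib, ?_⟩
    rwa [remaining_swap]

/-- The vertices of both chains dominate all points of the two blocks, so scanning only these
vertices gives the hull of the union, and no sorting is necessary. Both inputs lie below the address
`AP` of the output, which is therefore free to grow while they are read. -/
theorem mergeChains_spec {R : ℕ → ℕ → ℝ} {Y β AL AR AP lo hi : ℕ} {s : State}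
    (hmem : s.rmem = R) (h10 : s.nreg 10 = AL) (h11 : s.nreg 11 = AR) (h12 : s.nreg 12 = AP)
    {mid : ℕ} (hlm : lo < mid) (hmh : mid < hi)
    (hL : Chain (R 0) (R Y) (fun r => s.nmem (β + 1) (AL + r)) (s.nmem β AL) lo mid)
    (hR : Chain (R 0) (R Y) (fun r => s.nmem (β + 1) (AR + r)) (s.nmem β AR) mid hi)
    (hAL : AL + s.nmem β AL ≤ AP) (hAR : AR + s.nmem β AR ≤ AP) :
    WP (mergeChains Y β) s fun t s' => t ≤ 1000 * (s.nmem β AL + s.nmem β AR) ∧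
      s'.nmem β AP ≤ s.nmem β AL + s.nmem β AR ∧
      Chain (R 0) (R Y) (fun r => s'.nmem (β + 1) (AP + r)) (s'.nmem β AP) lo hi ∧
      ∀ c l, (c = β → l ≠ AP) →
        (c ≠ β + 1 ∨ l < AP ∨ AP + s.nmem β AL + s.nmem β AR ≤ l) →
        s'.nmem c l = s.nmem c l := by
  set M := s.nmem with hM
  have hLm : ∀ k < M β AL, lo ≤ M (β + 1) (AL + k) ∧ M (β + 1) (AL + k) < hi := fun k hk => by
    have := hL.mem k hk
    omega
  have hRm : ∀ k < M β AR, lo ≤ M (β + 1) (AR + k) ∧ M (β + 1) (AR + k) < hi := fun k hk => by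
    have := hR.mem k hk
    omega
  -- The potential is `400` for each vertex still to be scanned and `100` for each vertex on the
  -- stack: an iteration gains `400`, pays for selection and tests, and leaves `100` with the vertex
  -- it pushes.
  have hbody : ∀ s, MergeInv R Y β M AL AR AP lo hi s →
      (Test.nlt (nr 15 + nr 16) (nr 13 + nr 14)).holds s →
      WP (block [selectVertex Y β, popVertices Y β,
        .storeN (β + 1) (nr 12 + nr 17) (nr 18), .setN 17 (nr 17 + nl 1)]) s
      fun t s' => MergeInv R Y β M AL AR AP lo hi s' ∧
        (Test.nlt (nr 15 + nr 16) (nr 13 + nr 14)).cost + 1 + t +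
          (400 * ((M β AL - s'.nreg 15) + (M β AR - s'.nreg 16)) + 100 * s'.nreg 17) ≤
          400 * ((M β AL - s.nreg 15) + (M β AR - s.nreg 16)) + 100 * s.nreg 17 ∧
        (400 * ((M β AL - s'.nreg 15) + (M β AR - s'.nreg 16)) + 100 * s'.nreg 17) <
          400 * ((M β AL - s.nreg 15) + (M β AR - s.nreg 16)) + 100 * s.nreg 17 := by
    intro s h ht
    have hlt : s.nreg 15 + s.nreg 16 < M β AL + M β AR := by
      simpa [h.r13, h.r14] using ht
    refine wp_block_cons.2 ((selectVertex_spec hLm hL.inc hRm hR.inc hAL hAR h hlt).mono ?_)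
    rintro t₁ s₁ ⟨c₁, m₁, q₁, r10, r11, r12, r13, r14, r17, hia, hib, hsum, hlo, hhi, hrem, hmin⟩
    have hscan := h.scan
    rw [hrem, ← r17, ← m₁] at hscan
    refine wp_block_cons.2 ((popVertices_spec (q₁.trans h.rmem) r12 hscan).and_exec.mono ?_)
    rintro t₂ s₂ ⟨⟨c₂, hk, hscan₂, hpush⟩, he⟩
    have e : ∀ r, r ≠ 17 → s₂.nreg r = s₁.nreg r := fun r hr => he.nreg_eq (c := popVertices Y β) hr
    have em : s₂.nmem = s₁.nmem := funext fun b => he.nmem_eq (c := popVertices Y β) trivial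
    have er : s₂.rmem = s₁.rmem := he.rmem_eq (c := popVertices Y β) trivial
    have hk' := h.k
    simp only [wp_block_cons, wp_storeN, wp_setN, wp_block_nil, NExp.eval_add, NExp.eval_reg,
      NExp.eval_lit, NExp.cost_add, NExp.cost_reg, NExp.cost_lit, Test.cost_nlt]
    refine ⟨⟨?_, ?_, ?_, ?_, ?_, ?_, ?_, ?_, ?_, ?_, ?_⟩, ?_, ?_⟩
    · simp [er, q₁, h.rmem]
    · simp [e, r10]
    · simp [e, r11]
    · simp [e, r12]
    · simp [e, r13]
    · simp [e, r14]
    · simp [e, hia]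
    · simp [e, hib]
    · simp [e]; omega
    · intro c l hcl
      have hne : ¬ (c = β + 1 ∧ l = AP + s₂.nreg 17) := by omega
      have := h.mem c l hcl
      simp only [State.setN_nmem, State.storeN_nmem, em, m₁, e 12 (by decide), r12]
      split_ifs with h₁ h₂
      · exact absurd ⟨h₁, h₂⟩ hne
      · rw [← h₁, this]
      · exact this
    · have : Scan (R 0) (R Y) (fun r => ((s₂.storeN (β + 1) (AP + s₂.nreg 17) (s₁.nreg 18)).nmem
          (β + 1) (AP + r))) (s₂.nreg 17 + 1) lo hi _ :=
        hscan₂.push ⟨hlo, hhi⟩ hmin hpush (fun r hr => by simp [em, hr.ne])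
          (by simp)
      simpa [e, r12] using this
    · simp [e]; omega
    · simp [e]; omega
  have hinit : ∀ s₀ : State, s₀.rmem = R → s₀.nmem = M → s₀.nreg 10 = AL → s₀.nreg 11 = AR →
      s₀.nreg 12 = AP → s₀.nreg 13 = M β AL → s₀.nreg 14 = M β AR → s₀.nreg 15 = 0 →
      s₀.nreg 16 = 0 → s₀.nreg 17 = 0 → MergeInv R Y β M AL AR AP lo hi s₀ := by
    intro s₀ a b c d e f g h i j
    refine ⟨a, c, d, e, f, g, by omega, by omega, by omega, fun _ _ _ => by rw [b], ?_⟩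
    rw [h, i, j]
    refine ⟨by simp, by simp, by simp, fun dx dy σ hdx q hq hq' => ?_, by simp⟩
    rcases lt_or_ge q mid with hqm | hqm
    · obtain ⟨k, hk, hd⟩ := hL.dom dx dy σ hdx q hq hqm
      exact ⟨_, hd, .inr (.inl ⟨k, by omega, hk, rfl⟩)⟩
    · obtain ⟨k, hk, hd⟩ := hR.dom dx dy σ hdx q hqm hq'
      exact ⟨_, hd, .inr (.inr ⟨k, by omega, hk, rfl⟩)⟩
  simp only [mergeChains, wp_block_cons, wp_setN]
  refine (WP.loop _ _ hbody (hinit _ ?_ ?_ ?_ ?_ ?_ ?_ ?_ ?_ ?_ ?_)).mono ?_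
  any_goals simp [hmem, ← hM, h10, h11, h12]
  · rintro t s' h ht hcost
    simp only [h.r12, if_true]
    rw [h.r13, h.r14] at ht
    have := h.ia
    have := h.ib
    have := h.k
    have := hL.pos
    have e₁ : s'.nreg 15 = M β AL := by omega
    have e₂ : s'.nreg 16 = M β AR := by omega
    refine ⟨by omega, by omega, ?_, ?_⟩
    · have hs := h.scan
      rw [e₁, e₂] at hs
      have hr : Remaining (fun r => M (β + 1) (AL + r)) (fun r => M (β + 1) (AR + r)) (M β AL)
          (M β AL) (M β AR) (M β AR) = ∅ := by
        ext v
        simp only [Remaining, Set.mem_ofPred_eq, Set.mem_empty_iff_false, iff_false]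
        rintro (⟨r, h₁, h₂, -⟩ | ⟨r, h₁, h₂, -⟩) <;> omega
      rw [hr] at hs
      exact hs.chain (by omega)
    · intro c l h₁ h₂
      split_ifs with hc hl
      · exact absurd hl (h₁ hc)
      · rw [← hc]; exact h.mem c l h₂
      · exact h.mem c l h₂

/-! ### Merging sorted lists of edges -/

/-- The first `n` steps of the merging of three sorted lists. -/
structure Merging (n : ℕ) (s : ℕ → ℝ) (l : Fin 3 → ℕ) (e : Fin 3 → ℕ → ℝ)
    (c : Fin 3 → ℕ → ℕ) : Prop where
  le : ∀ κ, ∀ r ≤ n, c κ r ≤ l κ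
  zero : ∀ κ, c κ 0 = 0
  mono : ∀ κ, ∀ r < n, c κ r ≤ c κ (r + 1)
  sorted : ∀ r, r + 1 < n → s (r + 1) ≤ s r
  before : ∀ κ, ∀ r < n, ∀ k < c κ (r + 1), s r ≤ e κ k
  after : ∀ κ, ∀ r < n, ∀ k, c κ r ≤ k → k < l κ → e κ k ≤ s r

/-- The largest of the three heads is appended. It was unconsumed at the previous step, so it does
not exceed the previous entry, and hence no entry consumed earlier; being the maximum of the heads,
it bounds everything that is left. -/
theorem Merging.step {n : ℕ} {s s' : ℕ → ℝ} {l : Fin 3 → ℕ} {e : Fin 3 → ℕ → ℝ}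
    {c c' : Fin 3 → ℕ → ℕ} (h : Merging n s l e c)
    (he : ∀ κ k k', k ≤ k' → k' < l κ → e κ k' ≤ e κ k)
    (hs' : ∀ r < n, s' r = s r) (hc' : ∀ κ, ∀ r ≤ n, c' κ r = c κ r) {κ₀ : Fin 3}
    (hlt : c κ₀ n < l κ₀) (hs : s' n = e κ₀ (c κ₀ n))
    (hmax : ∀ κ, c κ n < l κ → e κ (c κ n) ≤ s' n)
    (hc : ∀ κ, c' κ (n + 1) = if κ = κ₀ then c κ n + 1 else c κ n) :
    Merging (n + 1) s' l e c' := by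
  have hlast : ∀ r, r + 1 = n → s' n ≤ s' r := fun r hr => by
    subst hr
    rw [hs, hs' r (by omega)]
    exact h.after κ₀ r (by omega) _ (h.mono κ₀ r (by omega)) hlt
  refine ⟨fun κ r hr => ?_, fun κ => ?_, fun κ r hr => ?_, fun r hr => ?_, fun κ r hr k hk => ?_,
    fun κ r hr k hk hk' => ?_⟩
  · rcases hr.lt_or_eq with hr | rfl
    · rw [hc' κ r (by omega)]; exact h.le κ r (by omega)
    · rw [hc]
      split_ifs with hκ
      · subst hκ; omega
      · exact h.le κ n le_rfl
  · rw [hc' κ 0 (by omega)]; exact h.zero κ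
  · rcases (show r ≤ n by omega).lt_or_eq with hr | rfl
    · rw [hc' κ r hr.le, hc' κ _ hr]; exact h.mono κ r hr
    · rw [hc' κ r le_rfl, hc]; split_ifs <;> omega
  · rcases (show r + 1 ≤ n by omega).lt_or_eq with hr | hr
    · rw [hs' _ hr, hs' r (by omega)]; exact h.sorted r hr
    · have := hlast r hr
      rwa [hr]
  · rcases (show r ≤ n by omega).lt_or_eq with hr | rfl
    · rw [hc' κ _ hr] at hk
      rw [hs' r hr]; exact h.before κ r hr k hk
    · have old : ∀ k < c κ r, s' r ≤ e κ k := fun k hk => by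
        obtain _ | r := r
        · simp [h.zero] at hk
        · refine (hlast r rfl).trans ?_
          rw [hs' r (by omega)]
          exact h.before κ r (by omega) k hk
      rw [hc] at hk
      split_ifs at hk with hκ
      · rcases Nat.lt_succ_iff_lt_or_eq.1 hk with hk | rfl
        · exact old k hk
        · subst hκ; exact hs.le
      · exact old k hk
  · rcases (show r ≤ n by omega).lt_or_eq with hr | rfl
    · rw [hc' κ r hr.le] at hk
      rw [hs' r hr]; exact h.after κ r hr k hk hk'
    · rw [hc' κ r le_rfl] at hk
      exact (he κ _ _ hk hk').trans (hmax κ (by omega))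

/-- First ends of the edges in the three lists. -/
def listU (M : ℕ → ℕ → ℕ) (β AL AR AP : ℕ) : Fin 3 → ℕ → ℕ :=
  ![fun k => M (β + 1) (AP + k), fun k => M (β + 3) (AL + (2 * k + 1)),
    fun k => M (β + 3) (AR + (2 * k + 1))]

/-- Second ends of the edges in the three lists. -/
def listV (M : ℕ → ℕ → ℕ) (β AL AR AP : ℕ) : Fin 3 → ℕ → ℕ :=
  ![fun k => M (β + 1) (AP + (k + 1)), fun k => M (β + 4) (AL + (2 * k + 1)),
    fun k => M (β + 4) (AR + (2 * k + 1))]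

/-- Lengths of the three lists. -/
def listLen (M : ℕ → ℕ → ℕ) (β AL AR AP : ℕ) : Fin 3 → ℕ :=
  ![M β AP - 1, M (β + 2) AL / 2, M (β + 2) AR / 2]

/-- First end of the next edge in a list. -/
def nextU (β : ℕ) : Fin 3 → NExp :=
  ![nc (β + 1) (nr 12 + nr 16), nc (β + 3) (nr 10 + (nr 17 + nr 17 + nl 1)),
    nc (β + 3) (nr 11 + (nr 18 + nr 18 + nl 1))]

/-- Second end of the next edge in a list. -/
def nextV (β : ℕ) : Fin 3 → NExp :=
  ![nc (β + 1) (nr 12 + (nr 16 + nl 1)), nc (β + 4) (nr 10 + (nr 17 + nr 17 + nl 1)),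
    nc (β + 4) (nr 11 + (nr 18 + nr 18 + nl 1))]

/-- Replaces the edge in registers `20`, `21` by the next one from list `κ` if that is steeper. -/
def offerEdge (Y β : ℕ) (κ : Fin 3) : Prog :=
  .cond (.conj (.nlt (nr (16 + κ)) (nr (13 + κ))) (.neg (.conj (.nlt (nl 0) (nr 22))
      (.neg (slopeLt Y (nr 20) (nr 21) (nextU β κ) (nextV β κ))))))
    (block [.setN 20 (nextU β κ), .setN 21 (nextV β κ), .setN 22 (nl (κ + 1))]) .skip

/-- Merges the edges of the chain at the address in register `12` and every second edge from the
lists at the addresses in `10`, `11` into a list at that in `12`. -/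
def mergeLists (Y β : ℕ) : Prog := block [
  .setN 13 (nc β (nr 12) - nl 1), .setN 14 (.half (nc (β + 2) (nr 10))),
  .setN 15 (.half (nc (β + 2) (nr 11))), .setN 16 (nl 0), .setN 17 (nl 0), .setN 18 (nl 0),
  .setN 19 (nl 0),
  .loop (.nlt (nr 19) (nr 13 + nr 14 + nr 15)) (block [
    .storeN (β + 5) (nr 12 + nr 19) (nr 16), .storeN (β + 6) (nr 12 + nr 19) (nr 17),
    .storeN (β + 7) (nr 12 + nr 19) (nr 18),
    .setN 22 (nl 0), offerEdge Y β 0, offerEdge Y β 1, offerEdge Y β 2,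
    .storeN (β + 3) (nr 12 + nr 19) (nr 20), .storeN (β + 4) (nr 12 + nr 19) (nr 21),
    .cond (.nlt (nr 22) (nl 2)) (.setN 16 (nr 16 + nl 1))
      (.cond (.nlt (nr 22) (nl 3)) (.setN 17 (nr 17 + nl 1)) (.setN 18 (nr 18 + nl 1))),
    .setN 19 (nr 19 + nl 1)]),
  .storeN (β + 5) (nr 12 + nr 19) (nr 16), .storeN (β + 6) (nr 12 + nr 19) (nr 17),
  .storeN (β + 7) (nr 12 + nr 19) (nr 18), .storeN (β + 2) (nr 12) (nr 19)]

/-- Registers `20`, `21` hold the steepest of the next edges of the first `K` lists. -/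
def BestEdge (x y : ℕ → ℝ) (l : Fin 3 → ℕ) (U V : Fin 3 → ℕ → ℕ) (c : Fin 3 → ℕ) (K : ℕ)
    (s : State) : Prop :=
  (s.nreg 22 = 0 ∧ ∀ κ : Fin 3, (κ : ℕ) < K → l κ ≤ c κ) ∨
  ∃ κ₀ : Fin 3, (κ₀ : ℕ) < K ∧ s.nreg 22 = κ₀ + 1 ∧ c κ₀ < l κ₀ ∧ s.nreg 20 = U κ₀ (c κ₀) ∧
    s.nreg 21 = V κ₀ (c κ₀) ∧ ∀ κ : Fin 3, (κ : ℕ) < K → c κ < l κ →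
      slope x y (U κ (c κ)) (V κ (c κ)) ≤ slope x y (U κ₀ (c κ₀)) (V κ₀ (c κ₀))

/-- One round of a maximum over three heads, some of which may be missing. Register `22` is `0` as
long as there is no candidate and otherwise one more than the number of the list. -/
theorem offerEdge_spec {R : ℕ → ℕ → ℝ} {Y β : ℕ} {l : Fin 3 → ℕ} {U V : Fin 3 → ℕ → ℕ}
    {c : Fin 3 → ℕ} (hUV : ∀ κ, ∀ k < l κ, R 0 (U κ k) < R 0 (V κ k)) {s : State}
    (hR : s.rmem = R) (κ : Fin 3) (hl : s.nreg (13 + κ) = l κ) (hc : s.nreg (16 + κ) = c κ)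
    (hU : c κ < l κ → (nextU β κ).eval s = U κ (c κ))
    (hV : c κ < l κ → (nextV β κ).eval s = V κ (c κ))
    (h : BestEdge (R 0) (R Y) l U V c κ s) :
    WP (offerEdge Y β κ) s fun t s' => t ≤ 100 ∧ BestEdge (R 0) (R Y) l U V c (κ + 1) s' := by
  have hcU : (nextU β κ).cost ≤ 8 := by fin_cases κ <;> simp [nextU]
  have hcV : (nextV β κ).cost ≤ 8 := by fin_cases κ <;> simp [nextV]
  have hsucc : ∀ κ' : Fin 3, (κ' : ℕ) < κ + 1 → (κ' : ℕ) < κ ∨ κ' = κ := fun κ' h => by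
    rcases Nat.lt_succ_iff_lt_or_eq.1 h with h | h
    exacts [.inl h, .inr (Fin.ext h)]
  have hV' : ∀ v, (nextV β κ).eval (s.setN 20 v) = (nextV β κ).eval s := fun v => by
    fin_cases κ <;> simp [nextV]
  refine wp_cond.2 ⟨fun ht => ?_, fun ht => ?_⟩
  · simp only [Test.holds_conj, Test.holds_neg, Test.holds_nlt, Test.holds_rlt, RExp.eval_cell,
      RExp.eval_sub, RExp.eval_mul, NExp.eval_reg, NExp.eval_lit, hR, hl, hc, not_and,
      not_not] at ht
    obtain ⟨hlt, ht⟩ := ht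
    rw [hU hlt, hV hlt] at ht
    simp only [wp_block_cons, wp_setN, wp_block_nil]
    refine ⟨by simp; omega, .inr ⟨κ, by omega, by simp, hlt, by simp [hU hlt],
      by simp [hV', hV hlt], fun κ' hκ' hlt' => ?_⟩⟩
    rcases hsucc κ' hκ' with hκ' | rfl
    · rcases h with ⟨h0, h⟩ | ⟨κ₀, h₁, h₂, h₃, h₄, h₅, h₆⟩
      · exact absurd hlt' (not_lt.2 (h κ' hκ'))
      · have := ht (by omega)
        rw [h₄, h₅, slope_lt_iff (hUV _ _ h₃) (hUV _ _ hlt)] at this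
        exact (h₆ κ' hκ' hlt').trans this.le
    · exact le_rfl
  · simp only [wp_skip]
    refine ⟨by simp; omega, ?_⟩
    simp only [Test.holds_conj, Test.holds_neg, Test.holds_nlt, Test.holds_rlt, RExp.eval_cell,
      RExp.eval_sub, RExp.eval_mul, NExp.eval_reg, NExp.eval_lit, hR, hl, hc, not_and,
      not_not] at ht
    rcases h with ⟨h0, h⟩ | ⟨κ₀, h₁, h₂, h₃, h₄, h₅, h₆⟩
    · left
      refine ⟨h0, fun κ' hκ' => ?_⟩
      rcases hsucc κ' hκ' with hκ' | rfl
      · exact h κ' hκ'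
      · by_contra hlt
        exact ht (by omega) (fun h' => by omega)
    · right
      refine ⟨κ₀, by omega, h₂, h₃, h₄, h₅, fun κ' hκ' hlt' => ?_⟩
      rcases hsucc κ' hκ' with hκ' | rfl
      · exact h₆ κ' hκ' hlt'
      · have := fun h' => ht hlt' (fun _ => h')
        rw [hU hlt', hV hlt', h₄, h₅, slope_lt_iff (hUV _ _ h₃) (hUV _ _ hlt')] at this
        exact not_lt.1 this

theorem offerEdge_keepsN {Y β r : ℕ} {κ : Fin 3} (h : r < 20 ∨ 22 < r) :
    (offerEdge Y β κ).KeepsN r := by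
  simp [offerEdge, Prog.KeepsN]
  omega

theorem offerEdge_keeps {Y β : ℕ} {κ : Fin 3} :
    (∀ b, (offerEdge Y β κ).KeepsBank b) ∧ (offerEdge Y β κ).KeepsRMem := by
  simp [offerEdge, Prog.KeepsBank, Prog.KeepsRMem]

theorem next_eval {M : ℕ → ℕ → ℕ} {β AL AR AP : ℕ} {s : State}
    (h10 : s.nreg 10 = AL) (h11 : s.nreg 11 = AR) (h12 : s.nreg 12 = AP)
    (hAL : AL + M (β + 2) AL ≤ AP) (hAR : AR + M (β + 2) AR ≤ AP)
    (hmem : ∀ c l, (c < β + 3 ∨ l < AP) → s.nmem c l = M c l) (κ : Fin 3) {k : ℕ}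
    (hc : s.nreg (16 + κ) = k) (hk : k < listLen M β AL AR AP κ) :
    (nextU β κ).eval s = listU M β AL AR AP κ k ∧
      (nextV β κ).eval s = listV M β AL AR AP κ k := by
  fin_cases κ
  · simp at hc
    simp [nextU, nextV, listU, listV, h12, hc, hmem]
  · simp at hc
    simp [listLen] at hk
    simp [nextU, nextV, listU, listV, h10, hc, ← two_mul]
    exact ⟨hmem _ _ (by omega), hmem _ _ (by omega)⟩
  · simp at hc
    simp [listLen] at hk
    simp [nextU, nextV, listU, listV, h11, hc, ← two_mul]
    exact ⟨hmem _ _ (by omega), hmem _ _ (by omega)⟩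

/-- Slopes of the edges in the three lists. -/
noncomputable def listSlope (x y : ℕ → ℝ) (M : ℕ → ℕ → ℕ) (β AL AR AP : ℕ) (κ : Fin 3) (k : ℕ) :
    ℝ :=
  slope x y (listU M β AL AR AP κ k) (listV M β AL AR AP κ k)

/-- Invariant of `mergeLists`. -/
structure ListInv (R : ℕ → ℕ → ℝ) (Y β : ℕ) (M : ℕ → ℕ → ℕ) (AL AR AP n : ℕ) (s : State) :
    Prop where
  rmem : s.rmem = R
  r10 : s.nreg 10 = AL
  r11 : s.nreg 11 = AR
  r12 : s.nreg 12 = AP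
  len : ∀ κ : Fin 3, s.nreg (13 + κ) = listLen M β AL AR AP κ
  sum : s.nreg 19 = s.nreg 16 + s.nreg 17 + s.nreg 18
  mem : ∀ c l, (c < β + 3 ∨ β + 7 < c ∨ l < AP ∨ AP + n < l) → s.nmem c l = M c l
  edge : ∀ k < s.nreg 19, R 0 (s.nmem (β + 3) (AP + k)) < R 0 (s.nmem (β + 4) (AP + k))
  merging : Merging (s.nreg 19) (edgeSlope (R 0) (R Y) s.nmem β AP) (listLen M β AL AR AP)
    (listSlope (R 0) (R Y) M β AL AR AP)
    -- Row `nreg 19` of the counts is not yet in memory; its values are still in the registers `16`,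
    -- `17`, `18`.
    fun κ r => if r < s.nreg 19 then s.nmem (β + 5 + κ) (AP + r) else s.nreg (16 + κ)

/-- The counts are stored before an edge is chosen, so that row `r` tells how much of each list was
consumed by the first `r` entries. -/
theorem mergeLists_body {R : ℕ → ℕ → ℝ} {Y β : ℕ} {M : ℕ → ℕ → ℕ} {AL AR AP n : ℕ} {s : State}
    (hAL : AL + M (β + 2) AL ≤ AP) (hAR : AR + M (β + 2) AR ≤ AP)
    (hn : n = listLen M β AL AR AP 0 + listLen M β AL AR AP 1 + listLen M β AL AR AP 2)
    (hedge : ∀ κ, ∀ k < listLen M β AL AR AP κ,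
      R 0 (listU M β AL AR AP κ k) < R 0 (listV M β AL AR AP κ k))
    (hsort : ∀ κ k k', k ≤ k' → k' < listLen M β AL AR AP κ →
      listSlope (R 0) (R Y) M β AL AR AP κ k' ≤ listSlope (R 0) (R Y) M β AL AR AP κ k)
    (h : ListInv R Y β M AL AR AP n s) (hlt : s.nreg 19 < n) :
    WP (block [
    .storeN (β + 5) (nr 12 + nr 19) (nr 16), .storeN (β + 6) (nr 12 + nr 19) (nr 17),
    .storeN (β + 7) (nr 12 + nr 19) (nr 18),
    .setN 22 (nl 0), offerEdge Y β 0, offerEdge Y β 1, offerEdge Y β 2,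
    .storeN (β + 3) (nr 12 + nr 19) (nr 20), .storeN (β + 4) (nr 12 + nr 19) (nr 21),
    .cond (.nlt (nr 22) (nl 2)) (.setN 16 (nr 16 + nl 1))
      (.cond (.nlt (nr 22) (nl 3)) (.setN 17 (nr 17 + nl 1)) (.setN 18 (nr 18 + nl 1))),
    .setN 19 (nr 19 + nl 1)]) s fun t s' => t ≤ 400 ∧ s'.nreg 19 = s.nreg 19 + 1 ∧
      ListInv R Y β M AL AR AP n s' := by
  obtain ⟨hR, h10, h11, h12, hl, hsum, hm, he, hmg⟩ := h
  simp only [wp_block_cons, wp_storeN, wp_setN]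
  generalize hs₁ : State.setN _ 22 _ = s₁
  have c₁ : ∀ r, r ≠ 22 → s₁.nreg r = s.nreg r := fun r hr => by simp [← hs₁, hr]
  have m₁ : ∀ c l, (c < β + 5 ∨ β + 7 < c ∨ l ≠ AP + s.nreg 19) →
      s₁.nmem c l = s.nmem c l := fun c l hcl => by
    simp only [← hs₁, State.setN_nmem, State.storeN_nmem, NExp.eval_add, NExp.eval_reg,
      State.storeN_nreg, h12]
    split_ifs <;> first | rfl | omega | (subst c; rfl)
  have m₁' : ∀ κ : Fin 3, s₁.nmem (β + 5 + κ) (AP + s.nreg 19) = s.nreg (16 + κ) := fun κ => by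
    fin_cases κ <;> simp [← hs₁, h12]
  have q₁ : s₁.rmem = R := by simp [← hs₁, hR]
  have z₁ : s₁.nreg 22 = 0 := by simp [← hs₁]
  have keep : ∀ (κ : Fin 3) {s s' : State} {t : ℕ}, Exec (offerEdge Y β κ) s t s' →
      (∀ r, (r < 20 ∨ 22 < r) → s'.nreg r = s.nreg r) ∧ s'.nmem = s.nmem ∧ s'.rmem = s.rmem :=
    fun κ _ _ _ h => ⟨fun r hr => h.nreg_eq (offerEdge_keepsN hr),
      funext fun b => h.nmem_eq (offerEdge_keeps.1 b), h.rmem_eq offerEdge_keeps.2⟩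
  have rd : ∀ (κ : Fin 3) (s' : State), (∀ r, (r < 20 ∨ 22 < r) → s'.nreg r = s₁.nreg r) →
      s'.nmem = s₁.nmem → s.nreg (16 + κ) < listLen M β AL AR AP κ →
      (nextU β κ).eval s' = listU M β AL AR AP κ (s.nreg (16 + κ)) ∧
      (nextV β κ).eval s' = listV M β AL AR AP κ (s.nreg (16 + κ)) := by
    intro κ s' hr hm' hk
    have hκ := κ.2
    refine next_eval (by rw [hr, c₁, h10] <;> omega) (by rw [hr, c₁, h11] <;> omega)
      (by rw [hr, c₁, h12] <;> omega) hAL hAR (fun c l hcl => ?_) κ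
      (by rw [hr _ (by omega), c₁ _ (by omega)]) hk
    rw [hm', m₁ c l (by omega), hm c l (by omega)]
  have cr : ∀ κ : Fin 3, (s₁.nreg (13 + κ) = listLen M β AL AR AP κ) ∧
      s₁.nreg (16 + κ) = s.nreg (16 + κ) := fun κ => by
    have hκ := κ.2
    exact ⟨by rw [c₁ _ (by omega), hl], c₁ _ (by omega)⟩
  refine ((offerEdge_spec (l := listLen M β AL AR AP) (U := listU M β AL AR AP)
    (V := listV M β AL AR AP) (c := fun κ => s.nreg (16 + κ)) hedge q₁ 0 (cr 0).1 (cr 0).2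
    (fun hk => (rd 0 s₁ (fun _ _ => rfl) rfl hk).1)
    (fun hk => (rd 0 s₁ (fun _ _ => rfl) rfl hk).2)
    (.inl ⟨z₁, fun κ hκ => absurd hκ (Nat.not_lt_zero _)⟩)).and_exec).mono ?_
  rintro t₂ s₂ ⟨⟨k₂, b₂⟩, x₂⟩
  obtain ⟨e₂, m₂, q₂⟩ := keep 0 x₂
  refine ((offerEdge_spec (l := listLen M β AL AR AP) (U := listU M β AL AR AP)
    (V := listV M β AL AR AP) (c := fun κ => s.nreg (16 + κ)) hedge (q₂.trans q₁) 1
    (by rw [e₂ _ (by simp), (cr 1).1]) (by rw [e₂ _ (by simp), (cr 1).2])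
    (fun hk => (rd 1 s₂ e₂ m₂ hk).1) (fun hk => (rd 1 s₂ e₂ m₂ hk).2) b₂).and_exec).mono ?_
  rintro t₃ s₃ ⟨⟨k₃, b₃⟩, x₃⟩
  obtain ⟨e₃, m₃, q₃⟩ := keep 1 x₃
  replace e₃ : ∀ r, (r < 20 ∨ 22 < r) → s₃.nreg r = s₁.nreg r := fun r hr =>
    (e₃ r hr).trans (e₂ r hr)
  replace m₃ := m₃.trans m₂
  refine ((offerEdge_spec (l := listLen M β AL AR AP) (U := listU M β AL AR AP)
    (V := listV M β AL AR AP) (c := fun κ => s.nreg (16 + κ)) hedge (q₃.trans (q₂.trans q₁)) 2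
    (by rw [e₃ _ (by simp), (cr 2).1]) (by rw [e₃ _ (by simp), (cr 2).2])
    (fun hk => (rd 2 s₃ e₃ m₃ hk).1) (fun hk => (rd 2 s₃ e₃ m₃ hk).2) b₃).and_exec).mono ?_
  rintro t₄ s₄ ⟨⟨k₄, b₄⟩, x₄⟩
  obtain ⟨e₄, m₄, q₄⟩ := keep 2 x₄
  replace e₄ : ∀ r, (r < 20 ∨ 22 < r) → s₄.nreg r = s.nreg r := fun r hr =>
    (e₄ r hr).trans ((e₃ r hr).trans (c₁ r (by omega)))
  replace m₄ := m₄.trans m₃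
  replace q₄ := q₄.trans (q₃.trans (q₂.trans q₁))
  -- If no list offered an edge, all three would be exhausted and `n` entries already written.
  rcases b₄ with ⟨-, hall⟩ | ⟨κ₀, -, w₄, hlt₀, u₄, v₄, hmax⟩
  · have h0 := hall 0 (by decide)
    have h1 := hall 1 (by decide)
    have h2 := hall 2 (by decide)
    simp at h0 h1 h2
    omega
  have hsl : listSlope (R 0) (R Y) M β AL AR AP κ₀ (s.nreg (16 + κ₀)) =
      slope (R 0) (R Y) (s₄.nreg 20) (s₄.nreg 21) := by rw [u₄, v₄, listSlope]
  have hr₄ : s₄.nreg 12 + s₄.nreg 19 = AP + s.nreg 19 := by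
    rw [e₄ _ (by simp), e₄ _ (by simp), h12]
  have fin : ∀ s' : State, s'.rmem = R →
      (∀ r, (r < 16) → s'.nreg r = s.nreg r) → s'.nreg 19 = s.nreg 19 + 1 →
      (∀ κ : Fin 3, s'.nreg (16 + κ) =
        if κ = κ₀ then s.nreg (16 + κ) + 1 else s.nreg (16 + κ)) →
      s'.nmem (β + 3) (AP + s.nreg 19) = s₄.nreg 20 →
      s'.nmem (β + 4) (AP + s.nreg 19) = s₄.nreg 21 →
      (∀ c l, (c < β + 3 ∨ β + 4 < c ∨ l ≠ AP + s.nreg 19) → s'.nmem c l = s₁.nmem c l) →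
      ListInv R Y β M AL AR AP n s' := by
    intro s' a b c d e f g
    have old : ∀ k < s.nreg 19, s'.nmem (β + 3) (AP + k) = s.nmem (β + 3) (AP + k) ∧
        s'.nmem (β + 4) (AP + k) = s.nmem (β + 4) (AP + k) := fun k hk =>
      ⟨by rw [g _ _ (by omega), m₁ _ _ (by omega)], by rw [g _ _ (by omega), m₁ _ _ (by omega)]⟩
    refine ⟨a, by rw [b _ (by simp), h10], by rw [b _ (by simp), h11], by rw [b _ (by simp), h12],
      fun κ => by rw [b _ (by omega), hl], ?_, fun c' l' hcl => ?_, fun k hk => ?_, ?_⟩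
    · have d0 := d 0
      have d1 := d 1
      have d2 := d 2
      simp only [Fin.val_zero, Fin.val_one, Fin.val_two, Nat.add_zero, Nat.reduceAdd] at d0 d1 d2
      rw [c, d0, d1, d2, hsum]
      fin_cases κ₀ <;> simp <;> omega
    · rw [g c' l' (by omega), m₁ c' l' (by omega), hm c' l' hcl]
    · rw [c] at hk
      rcases Nat.lt_succ_iff_lt_or_eq.1 hk with hk | rfl
      · rw [(old k hk).1, (old k hk).2]; exact he k hk
      · rw [e, f, u₄, v₄]; exact hedge _ _ hlt₀
    · have hlast : edgeSlope (R 0) (R Y) s'.nmem β AP (s.nreg 19) =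
          listSlope (R 0) (R Y) M β AL AR AP κ₀ (s.nreg (16 + κ₀)) := by
        rw [edgeSlope, e, f, hsl]
      rw [c]
      refine hmg.step (κ₀ := κ₀) hsort (fun r hr => ?_) (fun κ r hr => ?_) ?_ ?_ (fun κ hκ => ?_)
        (fun κ => ?_)
      · rw [edgeSlope, edgeSlope, (old r hr).1, (old r hr).2]
      · rcases hr.lt_or_eq with hr | rfl
        · rw [if_pos (by omega), if_pos hr, g _ _ (by omega), m₁ _ _ (by omega)]
        · rw [if_pos (by omega), if_neg (by omega), g _ _ (by omega), m₁']
      · simpa using hlt₀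
      · simpa using hlast
      · simp only [lt_irrefl, if_false] at hκ ⊢
        rw [hlast]
        exact hmax κ κ.2 hκ
      · simp only [lt_irrefl, if_false]
        exact d κ
  have fin₃ := (by decide : ∀ κ : Fin 3, κ = 0 ∨ κ = 1 ∨ κ = 2) κ₀
  simp only [hr₄, wp_cond, wp_setN, wp_block_nil, NExp.eval_add, NExp.eval_reg, NExp.eval_lit,
    Test.holds_nlt, State.storeN_nreg, w₄, NExp.cost_add, NExp.cost_reg, NExp.cost_lit,
    Test.cost_nlt, State.setN_nreg]
  have h16 := e₄ 16 (by simp)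
  have h17 := e₄ 17 (by simp)
  have h18 := e₄ 18 (by simp)
  have h19 := e₄ 19 (by simp)
  have hreg : ∀ r, r < 16 → s₄.nreg r = s.nreg r ∧ r ≠ 16 ∧ r ≠ 17 ∧ r ≠ 18 ∧ r ≠ 19 :=
    fun r hr => ⟨e₄ r (by omega), by omega, by omega, by omega, by omega⟩
  refine ⟨fun hw => ⟨by omega, by simp [h19], fin _ ?_ ?_ ?_ ?_ ?_ ?_ ?_⟩, fun hw =>
    ⟨fun hw' => ⟨by omega, by simp [h19], fin _ ?_ ?_ ?_ ?_ ?_ ?_ ?_⟩,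
    fun hw' => ⟨by omega, by simp [h19], fin _ ?_ ?_ ?_ ?_ ?_ ?_ ?_⟩⟩⟩
  all_goals first
    | exact q₄
    | (intro r hr; have := hreg r hr; simp [this])
    | (intro c l hcl
       simp only [State.setN_nmem, State.storeN_nmem, m₄]
       split_ifs <;> first | rfl | omega | (subst c; rfl))
    | (intro κ
       obtain rfl | rfl | rfl := fin₃ <;> simp at hw <;> first
        | (simp at hw'; done)
        | (fin_cases κ <;> simp [h16, h17, h18]))
    | simp [h19]

theorem storeCounts_nmem (s : State) (β AP n : ℕ) :
    let s' := (((s.storeN (β + 5) (AP + n) (s.nreg 16)).storeN (β + 6) (AP + n)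
      (s.nreg 17)).storeN (β + 7) (AP + n) (s.nreg 18)).storeN (β + 2) AP n
    (∀ c l, (c < β + 2 ∨ β + 7 < c ∨ l < AP ∨ AP + n < l) → s'.nmem c l = s.nmem c l) ∧
    s'.nmem (β + 2) AP = n ∧
    (∀ c l, (c = β + 3 ∨ c = β + 4 ∨ (β + 4 < c ∧ l ≠ AP + n)) →
      s'.nmem c l = s.nmem c l) ∧
    ∀ κ : Fin 3, s'.nmem (β + 5 + κ) (AP + n) = s.nreg (16 + κ) := by
  refine ⟨fun c l hcl => ?_, by simp, fun c l hcl => ?_, fun κ => ?_⟩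
  · simp only [State.storeN_nmem]
    split_ifs <;> first | omega | rfl | (subst c; rfl)
  · simp only [State.storeN_nmem]
    split_ifs <;> first | omega | rfl | (subst c; rfl)
  · fin_cases κ <;> simp

/-- `Merged` is read off from the finished merge, and `Merged.isRank` for the lists `0`, `1`, `2`
becomes the table `own` of the node and its links to the two children. After the loop one more row
of counts is stored, for the rank equal to the length. -/
theorem mergeLists_spec {R : ℕ → ℕ → ℝ} {Y β AL AR AP p n lo hi : ℕ} {s : State}
    (hmem : s.rmem = R) (h10 : s.nreg 10 = AL) (h11 : s.nreg 11 = AR) (h12 : s.nreg 12 = AP)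
    (hAL : AL + s.nmem (β + 2) AL ≤ AP) (hAR : AR + s.nmem (β + 2) AR ≤ AP)
    (hAL' : AL < AP) (hAR' : AR < AP)
    (hn : n = s.nmem β AP - 1 + s.nmem (β + 2) AL / 2 + s.nmem (β + 2) AR / 2)
    (hch : Chain (R 0) (R Y) (fun r => s.nmem (β + 1) (AP + r)) (s.nmem β AP) lo hi)
    (hp : s.nmem β AP ≤ p) (hn' : n + 1 ≤ 2 * p) {bL pL bR pR : ℕ}
    (hL : Node (R 0) (R Y) s.nmem β AL bL pL) (hR : Node (R 0) (R Y) s.nmem β AR bR pR)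
    (hhi : hi = lo + p) :
    WP (mergeLists Y β) s fun t s' => t ≤ 500 * (n + 1) ∧
      Node (R 0) (R Y) s'.nmem β AP lo p ∧
      Link (R 0) (R Y) s'.nmem β (β + 6) AP AL ∧ Link (R 0) (R Y) s'.nmem β (β + 7) AP AR ∧
      ∀ c l, (c < β + 2 ∨ β + 7 < c ∨ l < AP ∨ AP + n < l) → s'.nmem c l = s.nmem c l := by
  set M := s.nmem with hM
  have hedge : ∀ κ, ∀ k < listLen M β AL AR AP κ,
      R 0 (listU M β AL AR AP κ k) < R 0 (listV M β AL AR AP κ k) := by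
    intro κ k hk
    fin_cases κ
    · simp [listLen] at hk
      exact hch.inc k (by omega)
    · simp [listLen] at hk
      exact hL.edge _ (by omega)
    · simp [listLen] at hk
      exact hR.edge _ (by omega)
  have hsort : ∀ κ k k', k ≤ k' → k' < listLen M β AL AR AP κ →
      listSlope (R 0) (R Y) M β AL AR AP κ k' ≤ listSlope (R 0) (R Y) M β AL AR AP κ k := by
    intro κ k k' hkk hk
    fin_cases κ
    · simp [listLen] at hk
      rcases hkk.eq_or_lt with rfl | hlt
      · exact le_rfl
      · exact (hch.slope_lt hlt (by omega)).le
    · simp [listLen] at hk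
      exact hL.sorted _ _ (by omega) (by omega)
    · simp [listLen] at hk
      exact hR.sorted _ _ (by omega) (by omega)
  have hn₀ : n = listLen M β AL AR AP 0 + listLen M β AL AR AP 1 + listLen M β AL AR AP 2 := by
    simp [listLen, hn]
  simp only [mergeLists, wp_block_cons, wp_setN]
  refine (WP.loop (ListInv R Y β M AL AR AP n) (fun s => 500 * (n - s.nreg 19))
    (fun s' h ht => ?_) ?_).mono ?_
  · have e0 := h.len 0
    have e1 := h.len 1
    have e2 := h.len 2
    simp at e0 e1 e2
    have hlt : s'.nreg 19 < n := by
      simp [e0, e1, e2] at ht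
      omega
    refine (mergeLists_body hAL hAR hn₀ hedge hsort h hlt).mono ?_
    rintro t s'' ⟨ht, hr, hinv⟩
    refine ⟨hinv, ?_, ?_⟩
    · simp; omega
    · omega
  · refine ⟨?_, ?_, ?_, ?_, fun κ => ?_, ?_, ?_, ?_, ?_⟩
    · simp [hmem]
    · simp [h10]
    · simp [h11]
    · simp [h12]
    · fin_cases κ <;> simp [listLen, ← hM, h10, h11, h12]
    · simp
    · simp [hM]
    · simp
    · refine ⟨fun κ r hr => ?_, fun κ => ?_, ?_, ?_, ?_, ?_⟩
      · fin_cases κ <;> simp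
      · fin_cases κ <;> simp
      · simp
      · simp
      · simp
      · simp
  · rintro t s₁ ⟨⟨h, ht⟩, hcost⟩
    replace hcost : t ≤ 500 * n + 8 := by
      simp at hcost
      omega
    obtain ⟨-, -, -, r12, hl, hsum, hm, he, hmg⟩ := h
    have e0 := hl 0
    have e1 := hl 1
    have e2 := hl 2
    simp at e0 e1 e2
    have l0 := hmg.le 0 _ le_rfl
    have l1 := hmg.le 1 _ le_rfl
    have l2 := hmg.le 2 _ le_rfl
    simp at l0 l1 l2
    simp [e0, e1, e2] at ht
    have hrn : s₁.nreg 19 = n := by omega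
    simp only [wp_storeN, wp_block_nil, NExp.eval_add, NExp.eval_reg, State.storeN_nreg, r12, hrn]
    obtain ⟨mlt, m2, m34, mc⟩ := storeCounts_nmem s₁ β AP n
    generalize State.storeN _ (β + 2) AP n = s₂ at mlt m2 m34 mc ⊢
    have hes : edgeSlope (R 0) (R Y) s₂.nmem β AP = edgeSlope (R 0) (R Y) s₁.nmem β AP := by
      funext k
      rw [edgeSlope, edgeSlope, m34 _ _ (by omega), m34 _ _ (by omega)]
    have hall : ∀ c l, (c < β + 2 ∨ β + 7 < c ∨ l < AP ∨ AP + n < l) →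
        s₂.nmem c l = M c l := fun c l hcl => by
      rw [mlt c l hcl, hm c l (by omega)]
    have hmerged : Merged n (edgeSlope (R 0) (R Y) s₂.nmem β AP) (listLen M β AL AR AP)
        (listSlope (R 0) (R Y) M β AL AR AP) (fun κ r => s₂.nmem (β + 5 + κ) (AP + r)) := by
      have hC : ∀ (κ : Fin 3) r, r ≤ n → s₂.nmem (β + 5 + κ) (AP + r) =
          if r < s₁.nreg 19 then s₁.nmem (β + 5 + κ) (AP + r) else s₁.nreg (16 + κ) := by
        intro κ r hr
        rcases hr.lt_or_eq with hr | rfl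
        · rw [if_pos (by omega), m34 _ _ (by omega)]
        · rw [if_neg (by omega), mc]
      rw [hrn] at hmg
      refine ⟨fun κ r hr => ?_, fun κ => ?_, fun κ => ?_, fun κ r hr k hk => ?_,
        fun κ r hr k hk hk' => ?_⟩
      · rw [hC κ r hr, hrn]; exact hmg.le κ r hr
      · rw [hC κ 0 (by omega), hrn]; exact hmg.zero κ
      · rw [mc]
        fin_cases κ <;> simp <;> omega
      · rw [hes]
        rw [hC κ _ hr, hrn] at hk
        exact hmg.before κ r hr k hk
      · rw [hes]
        rw [hC κ _ hr.le, hrn] at hk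
        exact hmg.after κ r hr k hk hk'
    have hH : ∀ l, s₂.nmem (β + 1) l = M (β + 1) l := fun l => hall _ _ (by omega)
    have h0 : s₂.nmem β AP = M β AP := hall _ _ (by omega)
    refine ⟨by simp; omega, ⟨?_, ?_, ?_, fun k hk => ?_, fun k l hkl hl => ?_,
      fun P hP r hr => ?_⟩, fun P hP r hr => ?_, fun P hP r hr => ?_, hall⟩
    · simp only [hH, h0, ← hhi]
      exact hch
    · rwa [h0]
    · rwa [m2]
    · rw [m2] at hk
      rw [m34 _ _ (by omega), m34 _ _ (by omega)]
      exact he k (by omega)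
    · rw [m2] at hl
      rw [hes]
      induction l, hkl using Nat.le_induction with
      | base => exact le_rfl
      | succ l _ ih => exact (hmg.sorted l (by omega)).trans (ih (by omega))
    · rw [m2] at hr
      have := hmerged.isRank hP hr 0
      simpa [listSlope, listU, listV, listLen, hH, h0] using this
    · rw [m2] at hr
      have := hmerged.isRank hP hr 1
      rw [hall _ AL (by omega)]
      refine ⟨this.1, fun k hk => ?_, fun k hk hk' => ?_⟩
      · have h' := this.2.1 k hk
        have hkl : k < M (β + 2) AL / 2 := lt_of_lt_of_le hk this.1
        beta_reduce
        rw [edgeSlope, hall _ _ (by omega), hall _ _ (by omega)]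
        exact h'
      · have h' := this.2.2 k hk hk'
        beta_reduce
        rw [edgeSlope, hall _ _ (by omega), hall _ _ (by omega)]
        exact h'
    · rw [m2] at hr
      have := hmerged.isRank hP hr 2
      rw [hall _ AR (by omega)]
      refine ⟨this.1, fun k hk => ?_, fun k hk hk' => ?_⟩
      · have h' := this.2.1 k hk
        have hkl : k < M (β + 2) AR / 2 := lt_of_lt_of_le hk this.1
        beta_reduce
        rw [edgeSlope, hall _ _ (by omega), hall _ _ (by omega)]
        exact h'
      · have h' := this.2.2 k hk hk'
        beta_reduce
        rw [edgeSlope, hall _ _ (by omega), hall _ _ (by omega)]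
        exact h'

/-! ### Building the structure -/

theorem Chain.congr {x y : ℕ → ℝ} {H H' : ℕ → ℕ} {len lo hi : ℕ} (h : Chain x y H len lo hi)
    (he : ∀ k < len, H' k = H k) : Chain x y H' len lo hi := by
  refine ⟨h.pos, fun k hk => ?_, fun k hk => ?_, fun k hk => ?_, fun dx dy σ hdx q hq hq' => ?_⟩
  · rw [he k hk]; exact h.mem k hk
  · rw [he k (by omega), he _ hk]; exact h.inc k hk
  · rw [he k (by omega), he _ hk, he (k + 1) (by omega)]; exact h.concave k hk
  · obtain ⟨k, hk, hd⟩ := h.dom dx dy σ hdx q hq hq'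
    exact ⟨k, hk, by rwa [he k hk]⟩

theorem IsRank.congr {C C' : ℕ → Prop} {len r : ℕ} (h : IsRank C len r)
    (he : ∀ k < len, C' k ↔ C k) : IsRank C' len r :=
  ⟨h.1, fun k hk => (he k (hk.trans_le h.1)).2 (h.2.1 k hk),
    fun k hk hk' hc => h.2.2 k hk hk' ((he k hk').1 hc)⟩

/-- A node of `p` points reads only cells below `A + 2 * p`. Later nodes are written above it and so
leave it valid. -/
theorem Node.congr {x y : ℕ → ℝ} {M M' : ℕ → ℕ → ℕ} {β A b p : ℕ} (h : Node x y M β A b p)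
    (hM : ∀ c, β ≤ c → c ≤ β + 7 → ∀ l < A + 2 * p, M' c l = M c l) :
    Node x y M' β A b p := by
  have hlen := h.len
  have hclen := h.chain_len
  have hpos := h.chain.pos
  have e0 : M' β A = M β A := hM _ (by omega) (by omega) _ (by omega)
  have e2 : M' (β + 2) A = M (β + 2) A := hM _ (by omega) (by omega) _ (by omega)
  have es : ∀ k < M (β + 2) A, edgeSlope x y M' β A k = edgeSlope x y M β A k := fun k hk => by
    rw [edgeSlope, edgeSlope, hM _ (by omega) (by omega) _ (by omega),
      hM _ (by omega) (by omega) _ (by omega)]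
  refine ⟨?_, ?_, ?_, fun k hk => ?_, fun k l hkl hl => ?_, fun P hP r hr => ?_⟩
  · rw [e0]
    exact h.chain.congr fun k hk => hM _ (by omega) (by omega) _ (by omega)
  · rwa [e0]
  · rwa [e2]
  · rw [e2] at hk
    rw [hM _ (by omega) (by omega) _ (by omega), hM _ (by omega) (by omega) _ (by omega)]
    exact h.edge k hk
  · rw [e2] at hl
    rw [es k (by omega), es l hl]
    exact h.sorted k l hkl hl
  · rw [e2] at hr
    -- The table is read at `r ≤` length, possibly one past the list; this is where the extra cell
    -- in `Node.len` is needed.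
    have hr' := h.own P hP r (hr.congr fun k hk => by rw [es k hk])
    have hr₁ := hr.1
    rw [e0, hM (β + 5) (by omega) (by omega) _ (by omega)]
    refine hr'.congr fun k hk => ?_
    rw [hM _ (by omega) (by omega) _ (by omega), hM _ (by omega) (by omega) _ (by omega)]

theorem Link.congr {x y : ℕ → ℝ} {M M' : ℕ → ℕ → ℕ} {β c A A' b b' p p' : ℕ}
    (h : Link x y M β c A A') (hc : β ≤ c) (hc' : c ≤ β + 7) (hA : Node x y M β A b p)
    (hA' : Node x y M β A' b' p')
    (hM : ∀ c, β ≤ c → c ≤ β + 7 → ∀ l < A + 2 * p, M' c l = M c l)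
    (hM' : ∀ c, β ≤ c → c ≤ β + 7 → ∀ l < A' + 2 * p', M' c l = M c l) :
    Link x y M' β c A A' := by
  intro P hP r hr
  have hlen := hA.len
  have hlen' := hA'.len
  rw [hM (β + 2) (by omega) (by omega) _ (by omega)] at hr
  have hr₁ := hr.1
  rw [hM' (β + 2) (by omega) (by omega) _ (by omega), hM c hc hc' _ (by omega)]
  refine (h P hP r (hr.congr fun k hk => ?_)).congr fun k hk => ?_
  · rw [edgeSlope, edgeSlope, hM _ (by omega) (by omega) _ (by omega),
      hM _ (by omega) (by omega) _ (by omega)]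
  · rw [edgeSlope, edgeSlope, hM' _ (by omega) (by omega) _ (by omega),
      hM' _ (by omega) (by omega) _ (by omega)]

/-- Builds the node over two nodes. -/
def mergeNodes (Y β : ℕ) : Prog := block [
  .setN 10 (nr 3 + (nr 4 + nr 4)), .setN 11 (nr 3 + ((nr 4 + nr 2) + (nr 4 + nr 2))),
  .setN 12 (nr 3 + nr 1 + (nr 4 + nr 4)), mergeChains Y β, mergeLists Y β]

/-- Builds a leaf. -/
def makeLeaf (β : ℕ) : Prog := block [
  .storeN β (nr 4 + nr 4) (nl 1), .storeN (β + 1) (nr 4 + nr 4) (nr 4),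
  .storeN (β + 2) (nr 4 + nr 4) (nl 0), .storeN (β + 5) (nr 4 + nr 4) (nl 0)]

/-- Builds the structure over the points with abscissas in bank `0` and ordinates in bank `Y`. -/
def buildTree (Y β : ℕ) : Prog := block [
  .setN 4 (nl 0),
  .loop (.nlt (nr 4) (nr 5)) (block [makeLeaf β, .setN 4 (nr 4 + nl 1)]),
  .setN 2 (nl 1), .setN 3 (nl 0),
  .loop (.nlt (nr 2) (nr 5)) (block [.setN 4 (nl 0),
    .loop (.nlt (nr 4) (nr 5)) (block [mergeNodes Y β, .setN 4 (nr 4 + (nr 2 + nr 2))]),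
    .setN 3 (nr 3 + nr 1), .setN 2 (nr 2 + nr 2)])]

/-- Rounds the number of points up to a power of two, stores the ordinates with opposite sign in
bank `2`, and builds the structures for the upper and for the lower hulls. -/
def buildAll : Prog := block [
  .setN 5 (nl 1), .loop (.nlt (nr 5) (nr 0)) (.setN 5 (nr 5 + nr 5)),
  .setN 1 (nr 5 + nr 5), .storeN 16 (nl 0) (nr 1),
  .setN 4 (nl 0),
  .loop (.nlt (nr 4) (nr 5)) (block [.storeR 2 (nr 4) (rl 0 - rc 1 (nr 4)),
    .setN 4 (nr 4 + nl 1)]),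
  buildTree 1 0, buildTree 2 8]

theorem mergeChains_keeps {Y β : ℕ} : (mergeChains Y β).KeepsRMem ∧
    (∀ r, r < 13 → (mergeChains Y β).KeepsN r) ∧
    ∀ c, c < β ∨ β + 7 < c → (mergeChains Y β).KeepsBank c := by
  refine ⟨?_, fun r hr => ?_, fun c hc => ?_⟩
  · simp [mergeChains, popVertices, selectVertex, Prog.KeepsRMem]
  · simp [mergeChains, popVertices, selectVertex, Prog.KeepsN]; omega
  · simp [mergeChains, popVertices, selectVertex, Prog.KeepsBank]; omega

theorem mergeLists_keeps {Y β : ℕ} : (mergeLists Y β).KeepsRMem ∧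
    (∀ r, r < 13 → (mergeLists Y β).KeepsN r) ∧
    ∀ c, c < β ∨ β + 7 < c → (mergeLists Y β).KeepsBank c := by
  refine ⟨?_, fun r hr => ?_, fun c hc => ?_⟩
  · simp [mergeLists, offerEdge, Prog.KeepsRMem]
  · simp [mergeLists, offerEdge, Prog.KeepsN]; omega
  · simp [mergeLists, offerEdge, Prog.KeepsBank]; omega

/-- The hypothesis `hN` amounts to `4 * p ≤ N`: the cells of the right child end before those of the
parent, one row of `N` cells higher, begin. -/
theorem mergeNodes_spec {R : ℕ → ℕ → ℝ} {Y β p b o N : ℕ} {s : State} (hmem : s.rmem = R)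
    (h1 : s.nreg 1 = N) (h2 : s.nreg 2 = p) (h3 : s.nreg 3 = o) (h4 : s.nreg 4 = b)
    (hL : Node (R 0) (R Y) s.nmem β (o + (b + b)) b p)
    (hR : Node (R 0) (R Y) s.nmem β (o + ((b + p) + (b + p))) (b + p) p)
    (hN : (b + p + p) + (b + p + p) ≤ N + (b + b)) :
    WP (mergeNodes Y β) s fun t s' => t ≤ 4100 * p ∧
      Node (R 0) (R Y) s'.nmem β (o + N + (b + b)) b (2 * p) ∧
      Link (R 0) (R Y) s'.nmem β (β + 6) (o + N + (b + b)) (o + (b + b)) ∧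
      Link (R 0) (R Y) s'.nmem β (β + 7) (o + N + (b + b)) (o + ((b + p) + (b + p))) ∧
      ∀ c, ∀ l < o + N + (b + b), s'.nmem c l = s.nmem c l := by
  have l₁ := hL.chain_len
  have l₂ := hR.chain_len
  have l₃ := hL.len
  have l₄ := hR.len
  have l₅ := hL.chain.pos
  have l₆ := hR.chain.pos
  simp only [mergeNodes, wp_block_cons, wp_setN]
  generalize hs₀ : State.setN _ 12 _ = s₀
  have a₀ : s₀.nreg 10 = o + (b + b) := by simp [← hs₀, h3, h4]
  have a₁ : s₀.nreg 11 = o + ((b + p) + (b + p)) := by simp [← hs₀, h2, h3, h4]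
  have a₂ : s₀.nreg 12 = o + N + (b + b) := by simp [← hs₀, h1, h3, h4]
  have e₀ : s.nmem = s₀.nmem := by simp [← hs₀]
  have q₀ : s₀.rmem = R := by simp [← hs₀, hmem]
  clear hs₀
  rw [e₀] at hL hR l₁ l₂ l₃ l₄ l₅ l₆ ⊢
  refine ((mergeChains_spec (lo := b) (mid := b + p) (hi := b + p + p) q₀ a₀ a₁ a₂ (by omega)
    (by omega) hL.chain hR.chain (by omega) (by omega)).and_exec).mono ?_
  rintro t₁ s₁ ⟨⟨c₁, k₁, ch₁, m₁⟩, x₁⟩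
  replace m₁ : ∀ c l, (β + 1 < c ∨ l < o + N + (b + b)) → s₁.nmem c l = s₀.nmem c l :=
    fun c l hcl => m₁ c l (by omega) (by omega)
  have r₁ : ∀ r, r < 13 → s₁.nreg r = _ := fun r hr => x₁.nreg_eq (mergeChains_keeps.2.1 r hr)
  have e₂ : ∀ c, β ≤ c → c ≤ β + 7 → ∀ l < o + N + (b + b), s₁.nmem c l = s₀.nmem c l :=
    fun c _ _ l hl => m₁ c l (by omega)
  have hL' := hL.congr fun c hc hc' l hl => e₂ c hc hc' l (by omega)
  have hR' := hR.congr fun c hc hc' l hl => e₂ c hc hc' l (by omega)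
  have eL : s₁.nmem (β + 2) (o + (b + b)) = s₀.nmem (β + 2) (o + (b + b)) := m₁ _ _ (by omega)
  have eR : s₁.nmem (β + 2) (o + ((b + p) + (b + p))) =
      s₀.nmem (β + 2) (o + ((b + p) + (b + p))) := m₁ _ _ (by omega)
  have hkp := ch₁.pos
  refine (mergeLists_spec (p := 2 * p) (hi := b + p + p) ((x₁.rmem_eq mergeChains_keeps.1).trans q₀)
    ?_ ?_ ?_ ?_ ?_ ?_ ?_ rfl ch₁ ?_ ?_ hL' hR' ?_).mono ?_
  · rw [r₁ _ (by omega), a₀]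
  · rw [r₁ _ (by omega), a₁]
  · rw [r₁ _ (by omega), a₂]
  · rw [eL]; omega
  · rw [eR]; omega
  · omega
  · omega
  · omega
  · rw [eL, eR]; omega
  · omega
  rintro t₂ s₂ ⟨c₂, n₂, link₁, link₂, m₂⟩
  rw [eL, eR] at c₂
  refine wp_block_nil.2 ⟨?_, n₂, link₁, link₂, fun c l hl => ?_⟩
  · simp; omega
  · rw [m₂ c l (by omega), m₁ c l (by omega)]

/-! ### Layout of the nodes in rows of memory, and the order of construction -/

theorem add_le_of_dvd {d b N : ℕ} (hN : d ∣ N) (hb : d ∣ b) (h : b < N) : b + d ≤ N := by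
  obtain ⟨u, rfl⟩ := hN
  obtain ⟨v, rfl⟩ := hb
  have := Nat.lt_of_mul_lt_mul_left h
  calc d * v + d = d * (v + 1) := by ring
    _ ≤ d * u := Nat.mul_le_mul_left d this

/-- Level `t` owns the row of `2 * 2 ^ K` cells from `t * (2 * 2 ^ K)`, in which a block takes two
cells per point. Divisibility keeps the last block inside its row. -/
theorem node_end_le {K t t' b : ℕ} (ht : t' ≤ t) (htK : t ≤ K) (hb : 2 ^ t' ∣ b)
    (hbK : b < 2 ^ K) :
    t' * (2 * 2 ^ K) + (b + b) + 2 * 2 ^ t' ≤ (t + 1) * (2 * 2 ^ K) := by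
  have h₁ := add_le_of_dvd (pow_dvd_pow 2 (ht.trans htK)) hb hbK
  have h₂ := Nat.mul_le_mul_right (2 * 2 ^ K) (Nat.succ_le_succ ht)
  have h₃ : (t' + 1) * (2 * 2 ^ K) = t' * (2 * 2 ^ K) + 2 * 2 ^ K := by ring
  change (t' + 1) * _ ≤ (t + 1) * _ at h₂
  omega

/-- The structure is complete up to level `t`, and on level `t + 1` up to `b₀`. -/
structure Partial (x y : ℕ → ℝ) (M : ℕ → ℕ → ℕ) (β K t b₀ : ℕ) : Prop where
  node : ∀ t' b, (t' ≤ t ∨ t' = t + 1 ∧ b < b₀) → t' ≤ K → 2 ^ t' ∣ b → b < 2 ^ K →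
    Node x y M β (t' * (2 * 2 ^ K) + (b + b)) b (2 ^ t')
  link : ∀ t' b, (t' < t ∨ t' = t ∧ b < b₀) → t' < K → 2 ^ (t' + 1) ∣ b → b < 2 ^ K →
    Link x y M β (β + 6) ((t' + 1) * (2 * 2 ^ K) + (b + b)) (t' * (2 * 2 ^ K) + (b + b)) ∧
    Link x y M β (β + 7) ((t' + 1) * (2 * 2 ^ K) + (b + b))
      (t' * (2 * 2 ^ K) + ((b + 2 ^ t') + (b + 2 ^ t')))

theorem right_child {t K b : ℕ} (ht : t < K) (hb : 2 ^ (t + 1) ∣ b) (hbK : b < 2 ^ K) :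
    2 ^ t ∣ b + 2 ^ t ∧ b + 2 ^ t < 2 ^ K ∧ b + 2 * 2 ^ t ≤ 2 ^ K := by
  have h₁ := add_le_of_dvd (pow_dvd_pow 2 (Nat.succ_le_of_lt ht)) hb hbK
  have h₂ : 2 ^ (t + 1) = 2 * 2 ^ t := by ring
  have h₃ : 0 < 2 ^ t := by positivity
  exact ⟨(dvd_trans ⟨2, by ring⟩ hb).add dvd_rfl, by omega, by omega⟩

theorem left_child {t b : ℕ} (hb : 2 ^ (t + 1) ∣ b) : 2 ^ t ∣ b := dvd_trans ⟨2, by ring⟩ hb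

/-- The construction goes through the addresses in increasing order, so all earlier nodes end at or
before the new one and survive by `Node.congr` and `Link.congr`. -/
theorem Partial.step {x y : ℕ → ℝ} {M M' : ℕ → ℕ → ℕ} {β K t b : ℕ} (h : Partial x y M β K t b)
    (ht : t < K) (hb : 2 ^ (t + 1) ∣ b) (hbK : b < 2 ^ K)
    (hn : Node x y M' β (t * (2 * 2 ^ K) + 2 * 2 ^ K + (b + b)) b (2 * 2 ^ t))
    (hl : Link x y M' β (β + 6) (t * (2 * 2 ^ K) + 2 * 2 ^ K + (b + b))
      (t * (2 * 2 ^ K) + (b + b)))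
    (hr : Link x y M' β (β + 7) (t * (2 * 2 ^ K) + 2 * 2 ^ K + (b + b))
      (t * (2 * 2 ^ K) + ((b + 2 ^ t) + (b + 2 ^ t))))
    (hM : ∀ c, ∀ l < t * (2 * 2 ^ K) + 2 * 2 ^ K + (b + b), M' c l = M c l) :
    Partial x y M' β K t (b + 2 * 2 ^ t) := by
  have eA : t * (2 * 2 ^ K) + 2 * 2 ^ K = (t + 1) * (2 * 2 ^ K) := by ring
  have ep : 2 * 2 ^ t = 2 ^ (t + 1) := by ring
  rw [eA] at hn hl hr hM
  rw [ep] at hn ⊢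
  have hend : ∀ t' b', (t' ≤ t ∨ t' = t + 1 ∧ b' < b) → 2 ^ t' ∣ b' → b' < 2 ^ K →
      t' * (2 * 2 ^ K) + (b' + b') + 2 * 2 ^ t' ≤ (t + 1) * (2 * 2 ^ K) + (b + b) := by
    rintro t' b' (h' | ⟨rfl, h'⟩) hd hK
    · exact (node_end_le h' ht.le hd hK).trans (by omega)
    · have := add_le_of_dvd hb hd h'
      omega
  -- The starts are multiples of `2 ^ (t + 1)`, so advancing by this amount adds exactly one block.
  have hlast : ∀ b', b' < b + 2 ^ (t + 1) → 2 ^ (t + 1) ∣ b' → b' < b ∨ b' = b := by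
    intro b' hlt hd
    by_contra hne
    push Not at hne
    have := add_le_of_dvd hd hb (by omega)
    omega
  have hMM : ∀ t' b', (t' ≤ t ∨ t' = t + 1 ∧ b' < b) → 2 ^ t' ∣ b' → b' < 2 ^ K →
      ∀ c, β ≤ c → c ≤ β + 7 → ∀ l < t' * (2 * 2 ^ K) + (b' + b') + 2 * 2 ^ t',
        M' c l = M c l :=
    fun t' b' hc hd hK c _ _ l hl => hM c l (hl.trans_le (hend t' b' hc hd hK))
  refine ⟨fun t' b' hc hK hd hb' => ?_, fun t' b' hc hK hd hb' => ?_⟩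
  · by_cases hold : t' ≤ t ∨ t' = t + 1 ∧ b' < b
    · exact (h.node t' b' hold hK hd hb').congr (hMM t' b' hold hd hb')
    · obtain ⟨rfl, hlt⟩ : t' = t + 1 ∧ b' < b + 2 ^ (t + 1) := by omega
      obtain rfl := (hlast b' hlt hd).resolve_left fun h' => hold (.inr ⟨rfl, h'⟩)
      exact hn
  · by_cases hold : t' < t ∨ t' = t ∧ b' < b
    · obtain ⟨d₁, d₂, -⟩ := right_child hK hd hb'
      have c₁ : t' + 1 ≤ t ∨ t' + 1 = t + 1 ∧ b' < b := by omega
      have c₂ : t' ≤ t ∨ t' = t + 1 ∧ b' < b := by omega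
      have c₃ : t' ≤ t ∨ t' = t + 1 ∧ b' + 2 ^ t' < b := by omega
      have := h.link t' b' hold hK hd hb'
      exact ⟨this.1.congr (by omega) (by omega) (h.node _ _ c₁ hK hd hb')
          (h.node _ _ c₂ hK.le (left_child hd) hb') (hMM _ _ c₁ hd hb')
          (hMM _ _ c₂ (left_child hd) hb'),
        this.2.congr (by omega) (by omega) (h.node _ _ c₁ hK hd hb')
          (h.node _ _ c₃ hK.le d₁ d₂) (hMM _ _ c₁ hd hb') (hMM _ _ c₃ d₁ d₂)⟩
    · obtain ⟨rfl, hlt⟩ : t' = t ∧ b' < b + 2 ^ (t + 1) := by omega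
      obtain rfl := (hlast b' hlt hd).resolve_left fun h' => hold (.inr ⟨rfl, h'⟩)
      exact ⟨hl, hr⟩

theorem Partial.next {x y : ℕ → ℝ} {M : ℕ → ℕ → ℕ} {β K t b : ℕ} (h : Partial x y M β K t b)
    (hb : 2 ^ K ≤ b) : Partial x y M β K (t + 1) 0 :=
  ⟨fun t' b' hc hK hd hb' => h.node t' b' (by omega) hK hd hb', fun t' b' hc hK hd hb' =>
    h.link t' b' (by omega) hK hd hb'⟩

theorem Partial.structure {x y : ℕ → ℝ} {M : ℕ → ℕ → ℕ} {β K : ℕ} (h : Partial x y M β K K 0) :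
    Structure x y M β K :=
  ⟨fun t ht b => h.node t b (.inl ht) ht, fun t ht b => h.link t b (.inl ht) ht⟩

theorem mergeNodes_keeps {Y β : ℕ} : (mergeNodes Y β).KeepsRMem ∧
    (∀ r, r < 10 → (mergeNodes Y β).KeepsN r) ∧
    ∀ c, c < β ∨ β + 7 < c → (mergeNodes Y β).KeepsBank c := by
  refine ⟨?_, fun r hr => ?_, fun c hc => ?_⟩
  · simp [mergeNodes, Prog.KeepsRMem, mergeLists_keeps, mergeChains_keeps]
  · simp [mergeNodes, Prog.KeepsN, mergeLists_keeps.2.1 r (by omega),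
      mergeChains_keeps.2.1 r (by omega)]
    omega
  · simp [mergeNodes, Prog.KeepsBank, mergeLists_keeps.2.2 c hc, mergeChains_keeps.2.2 c hc]

theorem buildTree_keeps {Y β : ℕ} : (buildTree Y β).KeepsRMem ∧
    (∀ r, r < 2 ∨ r = 5 → (buildTree Y β).KeepsN r) ∧
    ∀ c, c < β ∨ β + 7 < c → (buildTree Y β).KeepsBank c := by
  refine ⟨?_, fun r hr => ?_, fun c hc => ?_⟩
  · simp [buildTree, makeLeaf, Prog.KeepsRMem, mergeNodes_keeps]
  · simp [buildTree, makeLeaf, Prog.KeepsN, mergeNodes_keeps.2.1 r (by omega)]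
    omega
  · simp [buildTree, makeLeaf, Prog.KeepsBank, mergeNodes_keeps.2.2 c hc]
    omega

theorem node_leaf {x y : ℕ → ℝ} {M : ℕ → ℕ → ℕ} {β b K : ℕ} (h₀ : M β (b + b) = 1)
    (h₁ : M (β + 1) (b + b) = b) (h₂ : M (β + 2) (b + b) = 0) (h₅ : M (β + 5) (b + b) = 0) :
    Node x y M β (0 * (2 * 2 ^ K) + (b + b)) b (2 ^ 0) := by
  rw [zero_mul, zero_add, pow_zero]
  refine ⟨⟨by omega, fun k hk => ?_, by omega, by omega, fun dx dy σ hdx q hq hq' => ?_⟩,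
    h₀.le, by omega, by omega, by omega, fun P hP r hr => ?_⟩
  · obtain rfl : k = 0 := by omega
    simp [h₁]
  · obtain rfl : q = b := by omega
    exact ⟨0, by omega, by simpa [h₁] using Dom.refl _⟩
  · obtain rfl : r = 0 := by have := hr.1; omega
    simp [h₀, h₅, IsRank]

theorem makeLeaves_spec {R : ℕ → ℕ → ℝ} {Y β K : ℕ} {s : State}
    (h5 : s.nreg 5 = 2 ^ K) (h4 : s.nreg 4 = 0) :
    WP (.loop (.nlt (nr 4) (nr 5)) (block [makeLeaf β, .setN 4 (nr 4 + nl 1)])) s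
      fun t s' => t ≤ 50 * 2 ^ K + 10 ∧ Partial (R 0) (R Y) s'.nmem β K 0 0 := by
  refine (WP.loop (fun s' => s'.nreg 5 = 2 ^ K ∧ s'.nreg 4 ≤ 2 ^ K ∧ ∀ b < s'.nreg 4,
    s'.nmem β (b + b) = 1 ∧ s'.nmem (β + 1) (b + b) = b ∧ s'.nmem (β + 2) (b + b) = 0 ∧
      s'.nmem (β + 5) (b + b) = 0) (fun s' => 50 * (2 ^ K - s'.nreg 4)) ?_ ?_).mono ?_
  · rintro s' ⟨e5, e4, hb⟩ ht
    simp [e5] at ht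
    simp [makeLeaf, e5]
    refine ⟨⟨by omega, fun b hlt => ?_⟩, by omega, by omega⟩
    by_cases hbb : b = s'.nreg 4
    · subst hbb; simp
    · have h2 : b + b ≠ s'.nreg 4 + s'.nreg 4 := by omega
      simpa [h2] using hb b (by omega)
  · simp [h5, h4]
  · rintro t s' ⟨⟨⟨e5, e4, hb⟩, ht⟩, hcost⟩
    simp [e5] at ht
    refine ⟨by simp [h4] at hcost; omega, fun t' b hc hK hd hb' => ?_, fun t' b hc => by omega⟩
    obtain rfl : t' = 0 := by omega
    obtain ⟨h₀, h₁, h₂, h₅⟩ := hb b (by omega)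
    exact node_leaf h₀ h₁ h₂ h₅

theorem buildLevel_spec {R : ℕ → ℕ → ℝ} {Y β K t : ℕ} {s : State} (hmem : s.rmem = R)
    (htK : t < K) (h1 : s.nreg 1 = 2 * 2 ^ K) (h2 : s.nreg 2 = 2 ^ t)
    (h3 : s.nreg 3 = t * (2 * 2 ^ K)) (h4 : s.nreg 4 = 0) (h5 : s.nreg 5 = 2 ^ K)
    (hp : Partial (R 0) (R Y) s.nmem β K t 0) :
    WP (.loop (.nlt (nr 4) (nr 5)) (block [mergeNodes Y β, .setN 4 (nr 4 + (nr 2 + nr 2))])) s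
      fun τ s' => τ ≤ 2100 * 2 ^ K + 10 ∧ Partial (R 0) (R Y) s'.nmem β K (t + 1) 0 ∧
        s'.rmem = R := by
  have hpt : 0 < 2 ^ t := by positivity
  refine (WP.loop (fun s' => s'.rmem = R ∧ s'.nreg 1 = 2 * 2 ^ K ∧ s'.nreg 2 = 2 ^ t ∧
    s'.nreg 3 = t * (2 * 2 ^ K) ∧ s'.nreg 5 = 2 ^ K ∧ s'.nreg 4 ≤ 2 ^ K ∧
    2 ^ (t + 1) ∣ s'.nreg 4 ∧ Partial (R 0) (R Y) s'.nmem β K t (s'.nreg 4))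
    (fun s' => 2100 * (2 ^ K - s'.nreg 4)) ?_ ⟨hmem, h1, h2, h3, h5, by omega, by simp [h4],
      by rwa [h4]⟩).mono ?_
  · rintro s' ⟨q, e1, e2, e3, e5, e4, hd, hP⟩ ht
    simp [e5] at ht
    have hrc := right_child htK hd ht
    refine wp_block_cons.2 ((mergeNodes_spec q e1 e2 e3 rfl
      (hP.node t _ (.inl le_rfl) htK.le (left_child hd) ht)
      (hP.node t _ (.inl le_rfl) htK.le hrc.1 hrc.2.1) (by omega)).and_exec.mono ?_)
    rintro t₁ s₁ ⟨⟨c₁, n₁, l₁, l₂, m₁⟩, x₁⟩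
    have r₁ : ∀ r, r < 10 → s₁.nreg r = s'.nreg r := fun r hr =>
      x₁.nreg_eq (mergeNodes_keeps.2.1 r hr)
    have hstep := hP.step htK hd ht n₁ l₁ l₂ m₁
    rw [two_mul] at hstep
    have hd' : 2 ^ (t + 1) ∣ s'.nreg 4 + (2 ^ t + 2 ^ t) := by
      rw [← two_mul, ← pow_succ']
      exact hd.add dvd_rfl
    simp [r₁, e1, e2, e3, e5]
    refine ⟨⟨(x₁.rmem_eq mergeNodes_keeps.1).trans q, by omega, hd', hstep⟩, by omega, by omega⟩
  · rintro τ s' ⟨⟨⟨q, e1, e2, e3, e5, e4, hd, hP⟩, ht⟩, hcost⟩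
    simp [e5] at ht
    exact ⟨by simp [h4] at hcost; omega, hP.next ht, q⟩

theorem buildTree_spec {R : ℕ → ℕ → ℝ} {Y β K : ℕ} {s : State} (hmem : s.rmem = R)
    (h1 : s.nreg 1 = 2 * 2 ^ K) (h5 : s.nreg 5 = 2 ^ K) :
    WP (buildTree Y β) s fun t s' => t ≤ 2200 * (2 ^ K * (K + 1)) ∧
      Structure (R 0) (R Y) s'.nmem β K := by
  have hK : 1 ≤ 2 ^ K := Nat.one_le_two_pow
  simp only [buildTree, wp_block_cons, wp_setN]
  refine (((makeLeaves_spec (R := R) (Y := Y) (K := K) (β := β) ?_ ?_).and_exec).mono ?_)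
  · simp [h5]
  · simp
  rintro t₁ s₁ ⟨⟨c₁, p₁⟩, x₁⟩
  have q₁ : s₁.rmem = R := (x₁.rmem_eq (by simp [makeLeaf, Prog.KeepsRMem])).trans hmem
  have e₁ : s₁.nreg 1 = 2 * 2 ^ K :=
    (x₁.nreg_eq (by simp [makeLeaf, Prog.KeepsN])).trans (by simp [h1])
  have e₅ : s₁.nreg 5 = 2 ^ K :=
    (x₁.nreg_eq (by simp [makeLeaf, Prog.KeepsN])).trans (by simp [h5])
  refine (WP.loop (fun s' => ∃ t ≤ K, s'.rmem = R ∧ s'.nreg 1 = 2 * 2 ^ K ∧ s'.nreg 2 = 2 ^ t ∧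
    s'.nreg 3 = t * (2 * 2 ^ K) ∧ s'.nreg 5 = 2 ^ K ∧ Partial (R 0) (R Y) s'.nmem β K t 0)
    -- One linear payment for each level that is left; the current level is recovered as the
    -- logarithm of the block length in register `2`.
    (fun s' => 2150 * (2 ^ K * (K - Nat.log 2 (s'.nreg 2)))) ?_
    ⟨0, by omega, by simp [q₁], by simp [e₁], by simp, by simp, by simp [e₅], by simpa⟩).mono ?_
  · rintro s' ⟨t, htK, q, e1, e2, e3, e5, hP⟩ ht
    simp only [Test.holds_nlt, NExp.eval_reg, e2, e5] at ht
    have htK := (Nat.pow_lt_pow_iff_right (by norm_num)).1 ht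
    simp only [wp_block_cons, wp_setN]
    refine ((buildLevel_spec (R := R) (Y := Y) (K := K) (t := t) (β := β)
      (s := s'.setN 4 ((nl 0).eval s')) ?_ htK ?_ ?_ ?_ ?_ ?_
      hP).and_exec).mono ?_
    · simp [q]
    · simp [e1]
    · simp [e2]
    · simp [e3]
    · simp
    · simp [e5]
    rintro t₂ s₂ ⟨⟨c₂, p₂, q₂⟩, x₂⟩
    have r₂ : ∀ r, r < 4 ∨ r = 5 → s₂.nreg r = s'.nreg r := fun r hr =>
      (x₂.nreg_eq (by simp [Prog.KeepsN, mergeNodes_keeps.2.1 r (by omega)]; omega)).trans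
        (by simp; omega)
    have hlog : 2 ^ K * (K - t) = 2 ^ K * (K - (t + 1)) + 2 ^ K := by
      rw [← Nat.mul_succ]; congr 1; omega
    have e2' : 2 ^ t + 2 ^ t = 2 ^ (t + 1) := by ring
    simp only [wp_block_nil, NExp.eval_add, NExp.eval_reg, State.setN_nreg, State.setN_rmem,
      State.setN_nmem, r₂ 1 (by simp), r₂ 2 (by simp), r₂ 3 (by simp), r₂ 5 (by simp)]
    refine ⟨⟨t + 1, by omega, q₂, by simp [e1], by simp [e2, e2'], ?_, by simp [e5], p₂⟩, ?_, ?_⟩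
    · simp [e1, e3]; ring
    · simp [e2, e2', Nat.log_pow]; omega
    · simp [e2, e2', Nat.log_pow]; omega
  · rintro τ s' ⟨⟨⟨t, htK, q, e1, e2, e3, e5, hP⟩, ht⟩, hcost⟩
    simp only [Test.holds_nlt, NExp.eval_reg, e2, e5, not_lt] at ht
    obtain rfl : t = K :=
      le_antisymm htK ((Nat.pow_le_pow_iff_right (by norm_num)).1 ht)
    refine wp_block_nil.2 ⟨?_, hP.structure⟩
    simp [e2, Nat.log_pow] at hcost
    simp [mul_add]
    omega

/-- The memory contains the points and the structures for the upper and for the lower hulls. -/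
def Good {n : ℕ} (p : Fin n → ℝ × ℝ) (M : ℕ → ℕ → ℕ) (R : ℕ → ℕ → ℝ) : Prop :=
  ∃ K, n ≤ 2 ^ K ∧ M 16 0 = 2 * 2 ^ K ∧ (∀ k (h : k < n), R 0 k = (p ⟨k, h⟩).1) ∧
    (∀ k (h : k < n), R 1 k = (p ⟨k, h⟩).2) ∧ (∀ k < n, R 2 k = - R 1 k) ∧
    Structure (R 0) (R 1) M 0 K ∧ Structure (R 0) (R 2) M 8 K

theorem Structure.congr {x y : ℕ → ℝ} {M M' : ℕ → ℕ → ℕ} {β K : ℕ} (h : Structure x y M β K)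
    (hM : ∀ c, β ≤ c → c ≤ β + 7 → M' c = M c) : Structure x y M' β K := by
  have hM' : ∀ c, β ≤ c → c ≤ β + 7 → ∀ A p : ℕ, ∀ l < A + 2 * p, M' c l = M c l :=
    fun c h h' _ _ l _ => by rw [hM c h h']
  refine ⟨fun t ht b hd hb => (h.node t ht b hd hb).congr fun c h h' => hM' c h h' _ _,
    fun t ht b hd hb => ?_⟩
  obtain ⟨d₁, d₂, -⟩ := right_child ht hd hb
  exact ⟨(h.link t ht b hd hb).1.congr (by omega) (by omega) (h.node _ ht b hd hb)
      (h.node t ht.le b (left_child hd) hb) (fun c h h' => hM' c h h' _ _)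
      (fun c h h' => hM' c h h' _ _),
    (h.link t ht b hd hb).2.congr (by omega) (by omega) (h.node _ ht b hd hb)
      (h.node t ht.le _ d₁ d₂) (fun c h h' => hM' c h h' _ _) (fun c h h' => hM' c h h' _ _)⟩

/-- A linear estimate of the doubling loop is enough here. What matters is `2 ^ K < 2 * n`, which
keeps the padded tree within a constant factor. -/
theorem roundUp_spec {n : ℕ} (hn : 0 < n) {s : State} (h0 : s.nreg 0 = n) (h5 : s.nreg 5 = 1) :
    WP (.loop (.nlt (nr 5) (nr 0)) (.setN 5 (nr 5 + nr 5))) s fun t s' => t ≤ 20 * n ∧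
      ∃ K, s'.nreg 5 = 2 ^ K ∧ n ≤ 2 ^ K ∧ 2 ^ K < 2 * n ∧ K ≤ Nat.log 2 n + 1 := by
  refine (WP.loop (fun s' => s'.nreg 0 = n ∧ ∃ K, s'.nreg 5 = 2 ^ K ∧ 2 ^ K < 2 * n)
    (fun s' => 10 * (n - s'.nreg 5)) ?_ ⟨h0, 0, by simpa using h5, by omega⟩).mono ?_
  · rintro s' ⟨e0, K, e5, hK⟩ ht
    simp [e0] at ht
    have hpos : 0 < s'.nreg 5 := by rw [e5]; positivity
    simp [e0]
    exact ⟨⟨K + 1, by rw [e5]; ring, by rw [pow_succ]; omega⟩, by omega, by omega⟩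
  · rintro t s' ⟨⟨⟨e0, K, e5, hK⟩, ht⟩, hcost⟩
    simp [e0] at ht
    refine ⟨by simp [h5] at hcost; omega, K, e5, by omega, hK, ?_⟩
    obtain _ | K := K
    · omega
    · refine Nat.succ_le_succ (Nat.le_log_of_pow_le (by norm_num) ?_)
      rw [pow_succ] at hK
      omega

theorem negate_spec {N : ℕ} {s : State} (h5 : s.nreg 5 = N) (h4 : s.nreg 4 = 0) :
    WP (.loop (.nlt (nr 4) (nr 5)) (block [.storeR 2 (nr 4) (rl 0 - rc 1 (nr 4)),
      .setN 4 (nr 4 + nl 1)])) s fun t s' => t ≤ 20 * N + 10 ∧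
      s'.rmem 0 = s.rmem 0 ∧ s'.rmem 1 = s.rmem 1 ∧ ∀ k < N, s'.rmem 2 k = - s.rmem 1 k := by
  refine (WP.loop (fun s' => s'.nreg 5 = N ∧ s'.nreg 4 ≤ N ∧ s'.rmem 0 = s.rmem 0 ∧
    s'.rmem 1 = s.rmem 1 ∧ ∀ k < s'.nreg 4, s'.rmem 2 k = - s.rmem 1 k)
    (fun s' => 20 * (N - s'.nreg 4)) ?_ ⟨h5, by omega, rfl, rfl, by omega⟩).mono ?_
  · rintro s' ⟨e5, e4, q₀, q₁, q₂⟩ ht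
    simp [e5] at ht
    have hz : (State.storeR s' 2 (s'.nreg 4) (-(s.rmem 1 (s'.nreg 4)))).rmem 0 = s'.rmem 0 :=
      funext fun k => by simp
    have ho : (State.storeR s' 2 (s'.nreg 4) (-(s.rmem 1 (s'.nreg 4)))).rmem 1 = s'.rmem 1 :=
      funext fun k => by simp
    simp [e5, q₀, q₁, hz, ho]
    refine ⟨⟨by omega, fun k hk => ?_⟩, by omega, by omega⟩
    by_cases hkk : k = s'.nreg 4
    · simp [hkk]
    · simpa [hkk] using q₂ k (by omega)
  · rintro t s' ⟨⟨⟨e5, e4, q₀, q₁, q₂⟩, ht⟩, hcost⟩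
    simp [e5] at ht
    exact ⟨by simp [h4] at hcost; omega, q₀, q₁, fun k hk => q₂ k (by omega)⟩

/-- The cells beyond `n` act as additional points. They need no specification, since no window
contains them and blocks that stick out of the window are never visited. -/
theorem buildAll_spec {n : ℕ} (p : Fin n → ℝ × ℝ) (hn : 0 < n) :
    WP buildAll (State.input p) fun t s' => t ≤ 20000 * (n * (1 + Nat.log 2 n)) ∧
      Good p s'.nmem s'.rmem := by
  simp only [buildAll, wp_block_cons, wp_setN, wp_storeN]
  refine (roundUp_spec (n := n) (s := (State.input p).setN 5 ((nl 1).eval (State.input p))) hn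
    (by simp [State.input]) (by simp)).and_exec.mono ?_
  rintro t₁ s₁ ⟨⟨c₁, K, e₅, hnK, hKn, hK⟩, x₁⟩
  have q₁ : s₁.rmem = (State.input p).rmem := x₁.rmem_eq trivial
  generalize hs₂ : State.setN _ 4 _ = s₂
  have f₁ : s₂.nreg 1 = 2 * 2 ^ K := by simp [← hs₂, e₅]; ring
  have f₅ : s₂.nreg 5 = 2 ^ K := by simp [← hs₂, e₅]
  have g₂ : s₂.nmem 16 0 = 2 * 2 ^ K := by simp [← hs₂, e₅]; ring
  refine (negate_spec (N := 2 ^ K) f₅ (by simp [← hs₂])).and_exec.mono ?_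
  rintro t₃ s₃ ⟨⟨c₃, q₀', q₁', q₂'⟩, x₃⟩
  have q₂ : s₂.rmem = (State.input p).rmem := by simp [← hs₂, q₁]
  rw [q₂] at q₀' q₁' q₂'
  have f₁' : s₃.nreg 1 = 2 * 2 ^ K := (x₃.nreg_eq (by simp [Prog.KeepsN])).trans f₁
  have f₅' : s₃.nreg 5 = 2 ^ K := (x₃.nreg_eq (by simp [Prog.KeepsN])).trans f₅
  have g₃ : s₃.nmem 16 = s₂.nmem 16 := x₃.nmem_eq (by simp [Prog.KeepsBank])
  refine (buildTree_spec (Y := 1) (β := 0) (K := K) rfl f₁' f₅').and_exec.mono ?_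
  rintro t₄ s₄ ⟨⟨c₄, st₄⟩, x₄⟩
  have q₄ : s₄.rmem = s₃.rmem := x₄.rmem_eq buildTree_keeps.1
  have g₄ : s₄.nmem 16 = s₃.nmem 16 := x₄.nmem_eq (buildTree_keeps.2.2 _ (by omega))
  refine (buildTree_spec (Y := 2) (β := 8) (K := K) q₄
    ((x₄.nreg_eq (buildTree_keeps.2.1 _ (by omega))).trans f₁')
    ((x₄.nreg_eq (buildTree_keeps.2.1 _ (by omega))).trans f₅')).and_exec.mono ?_
  rintro t₅ s₅ ⟨⟨c₅, st₅⟩, x₅⟩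
  have q₅ : s₅.rmem = s₃.rmem := (x₅.rmem_eq buildTree_keeps.1).trans q₄
  have g₅ : s₅.nmem 16 = s₄.nmem 16 := x₅.nmem_eq (buildTree_keeps.2.2 _ (by omega))
  refine wp_block_nil.2 ⟨?_, K, hnK, ?_, fun k hk => ?_, fun k hk => ?_, fun k hk => ?_, ?_, ?_⟩
  · have hb : 2 ^ K * (K + 1) ≤ 4 * (n * (1 + Nat.log 2 n)) := by
      calc 2 ^ K * (K + 1) ≤ (2 * n) * (2 * (1 + Nat.log 2 n)) :=
            Nat.mul_le_mul hKn.le (by omega)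
        _ = 4 * (n * (1 + Nat.log 2 n)) := by ring
    have hn' : n ≤ n * (1 + Nat.log 2 n) := Nat.le_mul_of_pos_right _ (by omega)
    simp
    omega
  · rw [g₅, g₄, g₃, g₂]
  · rw [q₅, q₀']; simp [State.input, hk]
  · rw [q₅, q₁']; simp [State.input, hk]
  · rw [q₅, q₁', q₂' k (by omega)]
  · rw [q₅]
    exact st₄.congr fun c hc hc' => x₅.nmem_eq (buildTree_keeps.2.2 _ (by omega))
  · rw [q₅]; exact st₅

/-! ### Descending through the structure -/

/-- Address of the current node. -/
abbrev nodeAddr (ρ : ℕ) : NExp := nr (ρ + 22) + (nr (ρ + 20) + nr (ρ + 20))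

/-- Loads an edge and asks for its position relative to the wanted direction. -/
def ask (ρ : ℕ) (cmp : Prog) (eU eV : NExp) : Prog :=
  block [.setN (ρ + 25) eU, .setN (ρ + 26) eV, cmp]

/-- Locates the wanted direction in the list of the current node. -/
def locate (ρ β : ℕ) (cmp : Prog) : Prog := block [
  .setN (ρ + 23) (nl 0), .setN (ρ + 24) (nr (ρ + 21)),
  .loop (.nlt (nl 0) (nr (ρ + 24))) (block [
    .cond (.neg (.nlt (nc (β + 2) (nodeAddr ρ)) (nr (ρ + 23) + nr (ρ + 24))))
      (block [ask ρ cmp (nc (β + 3) (nodeAddr ρ + (nr (ρ + 23) + nr (ρ + 24) - nl 1)))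
          (nc (β + 4) (nodeAddr ρ + (nr (ρ + 23) + nr (ρ + 24) - nl 1))),
        .cond (.nlt (nl 0) (nr (ρ + 27))) (.setN (ρ + 23) (nr (ρ + 23) + nr (ρ + 24))) .skip])
      .skip,
    .setN (ρ + 24) (.half (nr (ρ + 24)))])]

/-- Visits the extreme vertices of a child that lies in the window. -/
def visitPiece (ρ β δ : ℕ) (visit : Prog) : Prog :=
  .cond (.conj (.neg (.nlt (nr (ρ + 31)) (nr 0)))
      (.neg (.nlt (nr 1 + nl 1) (nr (ρ + 31) + nr (ρ + 21)))))
    (block [.setN (ρ + 28) (nc (β + 1) (nr (ρ + 32) + nc (β + 5) (nr (ρ + 32) + nr (ρ + δ)))),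
      visit,
      .setN (ρ + 28)
        (nc (β + 1) (nr (ρ + 32) + (nc (β + 5) (nr (ρ + 32) + nr (ρ + δ)) - nl 1))),
      visit]) .skip

/-- Locates the wanted direction in the list of the child with start `e`, and visits the extreme
vertices of the child if it lies in the window. -/
def childStep (ρ β c δ : ℕ) (e : NExp) (cmp visit : Prog) : Prog := block [
  .setN (ρ + 31) e, .setN (ρ + 32) (nr (ρ + 22) - nr 2 + (nr (ρ + 31) + nr (ρ + 31))),
  .setN (ρ + δ) (nc c (nodeAddr ρ + nr (ρ + 23)) + nc c (nodeAddr ρ + nr (ρ + 23))),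
  .cond (.nlt (nr (ρ + δ)) (nc (β + 2) (nr (ρ + 32))))
    (block [ask ρ cmp (nc (β + 3) (nr (ρ + 32) + nr (ρ + δ)))
        (nc (β + 4) (nr (ρ + 32) + nr (ρ + δ))),
      .cond (.nlt (nl 0) (nr (ρ + 27))) (.setN (ρ + δ) (nr (ρ + δ) + nl 1)) .skip]) .skip,
  visitPiece ρ β δ visit]

/-- Walks from the node with start in register `st` down to the leaf in register `g`. -/
def walk (ρ β g st : ℕ) (cmp visit : Prog) : Prog := block [
  .setN (ρ + 20) (nr st), .setN (ρ + 21) (nr 3), .setN (ρ + 22) (nr 6), locate ρ β cmp,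
  .loop (.nlt (nl 1) (nr (ρ + 21))) (block [
    .setN (ρ + 21) (.half (nr (ρ + 21))),
    childStep ρ β (β + 6) 29 (nr (ρ + 20)) cmp visit,
    childStep ρ β (β + 7) 30 (nr (ρ + 20) + nr (ρ + 21)) cmp visit,
    .cond (.nlt (nr g) (nr (ρ + 20) + nr (ρ + 21))) (.setN (ρ + 23) (nr (ρ + 29)))
      (block [.setN (ρ + 23) (nr (ρ + 30)), .setN (ρ + 20) (nr (ρ + 20) + nr (ρ + 21))]),
    .setN (ρ + 22) (nr (ρ + 22) - nr 2)])]

/-- Visits a set of points of the window that contains the extreme points in the wanted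
direction. -/
def descend (ρ β : ℕ) (cmp visit : Prog) : Prog := block [
  .setN (ρ + 28) (nr 0), visit, .setN (ρ + 28) (nr 1), visit,
  walk ρ β 0 4 cmp visit, walk ρ β 1 5 cmp visit]

/-- The registers of `descend` that `cmp` and `visit` must leave alone agree. -/
def Same (ρ : ℕ) (s s' : State) : Prop :=
  ∀ k, 20 ≤ k → k < 33 → k ≠ 25 → k ≠ 26 → k ≠ 27 → s'.nreg (ρ + k) = s.nreg (ρ + k)

theorem Same.trans {ρ : ℕ} {s s' s'' : State} (h : Same ρ s s') (h' : Same ρ s' s'') :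
    Same ρ s s'' := fun k h₁ h₂ h₃ h₄ h₅ => (h' k h₁ h₂ h₃ h₄ h₅).trans (h k h₁ h₂ h₃ h₄ h₅)

/-- The window and the position of the highest nodes, in the registers. -/
structure Window (M : ℕ → ℕ → ℕ) (K i j h : ℕ) (s : State) : Prop where
  nmem : s.nmem = M
  r0 : s.nreg 0 = i
  r1 : s.nreg 1 = j
  r2 : s.nreg 2 = 2 * 2 ^ K
  r3 : s.nreg 3 = 2 ^ h
  r4 : s.nreg 4 = i / 2 ^ h * 2 ^ h
  r5 : s.nreg 5 = j / 2 ^ h * 2 ^ h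
  r6 : s.nreg 6 = h * (2 * 2 ^ K)

/-- What `descend` needs: `cmp` compares the slope of an edge with the direction `(dx, dy)`, and
`visit` processes a vertex; `J V` holds when the vertices in `V` have been processed. -/
structure Visitor (x y : ℕ → ℝ) (M : ℕ → ℕ → ℕ) (K i j h : ℕ) (dx dy : ℝ) (ρ : ℕ)
    (cmp visit : Prog) (J : Set ℕ → State → Prop) (Tc Tv : ℕ) : Prop where
  dx_nonneg : 0 ≤ dx
  ne_zero : 0 < dx ∨ dy ≠ 0
  set : ∀ V s k v, 20 ≤ k → k < 33 → J V s → J V (s.setN (ρ + k) v)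
  window : ∀ V s, J V s → Window M K i j h s
  cmp : ∀ V s, J V s → x (s.nreg (ρ + 25)) < x (s.nreg (ρ + 26)) → WP cmp s fun t s' =>
    t ≤ Tc ∧ J V s' ∧ Same ρ s s' ∧ (0 < s'.nreg (ρ + 27) ↔
      dy ≤ dx * slope x y (s.nreg (ρ + 25)) (s.nreg (ρ + 26)))
  visit : ∀ V s, J V s → i ≤ s.nreg (ρ + 28) → s.nreg (ρ + 28) ≤ j → WP visit s fun t s' =>
    t ≤ Tv ∧ J (insert (s.nreg (ρ + 28)) V) s' ∧ Same ρ s s'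

section
variable {x y : ℕ → ℝ} {M : ℕ → ℕ → ℕ} {β K i j h ρ Tc Tv : ℕ} {dx dy : ℝ} {cmp visit : Prog}
  {J : Set ℕ → State → Prop}

theorem Visitor.ask (hv : Visitor x y M K i j h dx dy ρ cmp visit J Tc Tv) {V : Set ℕ}
    {s : State} (hJ : J V s) {eU eV : NExp}
    (hV : ∀ v, eV.eval (s.setN (ρ + 25) v) = eV.eval s)
    (hx : x (eU.eval s) < x (eV.eval s)) :
    WP (ask ρ cmp eU eV) s fun t s' => t ≤ Tc + eU.cost + eV.cost + 3 ∧ J V s' ∧ Same ρ s s' ∧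
      (0 < s'.nreg (ρ + 27) ↔ dy ≤ dx * slope x y (eU.eval s) (eV.eval s)) := by
  simp only [WindowHull.ask, wp_block_cons, wp_setN, hV]
  generalize hs₁ : State.setN _ (ρ + 26) _ = s₁
  have hu : s₁.nreg (ρ + 25) = eU.eval s := by simp [← hs₁]
  have hw : s₁.nreg (ρ + 26) = eV.eval s := by simp [← hs₁]
  have hJ₁ : J V s₁ := by
    rw [← hs₁]
    exact hv.set _ _ 26 _ (by omega) (by omega) (hv.set _ _ 25 _ (by omega) (by omega) hJ)
  have hsame : Same ρ s s₁ := fun k h₁ h₂ h₃ h₄ h₅ => by simp [← hs₁, h₃, h₄]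
  have := hv.cmp V s₁ hJ₁ (by rwa [hu, hw])
  rw [hu, hw] at this
  refine this.mono fun t s' ⟨c, a, b, d⟩ => wp_block_nil.2 ⟨by omega, a, hsame.trans b, d⟩

theorem Node.exists_rank {A b p : ℕ} (hn : Node x y M β A b p) (hdx : 0 ≤ dx) :
    ∃ r, IsRank (fun k => dy ≤ dx * edgeSlope x y M β A k) (M (β + 2) A) r :=
  exists_isRank fun k l hkl hl h =>
    h.trans (mul_le_mul_of_nonneg_left (hn.sorted k l hkl hl) hdx)

/-- Binary search by halving powers of two, with one comparison for each power. It is the only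
search whose number of comparisons grows with the block, and it is made once on each way down. -/
theorem Visitor.locate (hv : Visitor x y M K i j h dx dy ρ cmp visit J Tc Tv) {V : Set ℕ}
    {s : State} (hJ : J V s) {A b t : ℕ} (hp : s.nreg (ρ + 21) = 2 ^ t)
    (hA : s.nreg (ρ + 22) + (s.nreg (ρ + 20) + s.nreg (ρ + 20)) = A)
    (hn : Node x y M β A b (2 ^ t)) :
    WP (locate ρ β cmp) s fun τ s' => τ ≤ (Tc + 60) * (t + 2) ∧ J V s' ∧
      s'.nreg (ρ + 20) = s.nreg (ρ + 20) ∧ s'.nreg (ρ + 21) = s.nreg (ρ + 21) ∧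
      s'.nreg (ρ + 22) = s.nreg (ρ + 22) ∧
      IsRank (fun k => dy ≤ dx * edgeSlope x y M β A k) (M (β + 2) A) (s'.nreg (ρ + 23)) := by
  obtain ⟨r, hr⟩ := hn.exists_rank (dy := dy) hv.dx_nonneg
  have hlen := hn.len
  have hrl := hr.1
  simp only [WindowHull.locate, wp_block_cons, wp_setN]
  refine (WP.loop (fun s' => J V s' ∧ s'.nreg (ρ + 20) = s.nreg (ρ + 20) ∧
    s'.nreg (ρ + 21) = s.nreg (ρ + 21) ∧ s'.nreg (ρ + 22) = s.nreg (ρ + 22) ∧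
    s'.nreg (ρ + 23) ≤ r ∧
    -- The rank lies in an interval of length twice the step above the current lower bound; when the
    -- step has been halved away, the bound is the rank. At the start this holds because the list is
    -- shorter than `2 * 2 ^ t` by `Node.len`.
    ((s'.nreg (ρ + 24) = 0 ∧ r = s'.nreg (ρ + 23)) ∨
      ∃ m, s'.nreg (ρ + 24) = 2 ^ m ∧ r < s'.nreg (ρ + 23) + 2 * 2 ^ m))
    (fun s' => (Tc + 60) * Nat.size (s'.nreg (ρ + 24))) ?_ ?_).mono ?_
  · rintro s' ⟨hJ', e0, e1, e2, hle, hm⟩ ht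
    simp at ht
    obtain ⟨m, hm, hrm⟩ := hm.resolve_left (by omega)
    have hA' : s'.nreg (ρ + 22) + (s'.nreg (ρ + 20) + s'.nreg (ρ + 20)) = A := by
      rw [e0, e2, hA]
    have hM := (hv.window _ _ hJ').nmem
    have hpos : 0 < 2 ^ m := by positivity
    have hsize : ∀ r', r' ≤ r → r < r' + 2 ^ m →
        (2 ^ m / 2 = 0 ∧ r = r' ∨ ∃ m', 2 ^ m / 2 = 2 ^ m' ∧ r < r' + 2 * 2 ^ m') ∧
        Nat.size (2 ^ m / 2) + 1 = Nat.size (2 ^ m) := by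
      intro r' h₁ h₂
      obtain _ | m := m
      · refine ⟨.inl ⟨by norm_num, by simp at h₂; omega⟩, by simp⟩
      · have e : 2 ^ (m + 1) / 2 = 2 ^ m := by rw [pow_succ]; omega
        rw [e, Nat.size_pow, Nat.size_pow]
        exact ⟨.inr ⟨m, rfl, by rw [pow_succ] at h₂; omega⟩, rfl⟩
    simp only [wp_block_cons, wp_cond, wp_skip, wp_setN, wp_block_nil, Test.holds_neg,
      Test.holds_nlt, NExp.eval_cell, NExp.eval_reg, NExp.eval_add, NExp.eval_lit, hA', hM, hm]
    refine ⟨fun hlt => ?_, fun hge => ?_⟩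
    · have hlt' : s'.nreg (ρ + 23) + 2 ^ m - 1 < M (β + 2) A := by omega
      refine (hv.ask hJ' ?_ ?_).mono ?_
      · intro v; simp
      · simpa [hA', hM, hm] using hn.edge _ hlt'
      rintro τ s'' ⟨c, hJ'', hs, hflag⟩
      have hiff := hr.iff hlt'
      simp only [NExp.eval_cell, NExp.eval_reg, NExp.eval_add, NExp.eval_sub, NExp.eval_lit, hA',
        hM, hm] at hflag
      rw [show slope x y _ _ = edgeSlope x y M β A (s'.nreg (ρ + 23) + 2 ^ m - 1) from rfl,
        hiff] at hflag
      have k0 := hs 20 (by omega) (by omega) (by omega) (by omega) (by omega)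
      have k1 := hs 21 (by omega) (by omega) (by omega) (by omega) (by omega)
      have k2 := hs 22 (by omega) (by omega) (by omega) (by omega) (by omega)
      have k3 := hs 23 (by omega) (by omega) (by omega) (by omega) (by omega)
      have k4 := hs 24 (by omega) (by omega) (by omega) (by omega) (by omega)
      simp at c
      refine ⟨fun hf => ?_, fun hf => ?_⟩
      · obtain ⟨z₁, z₂⟩ := hsize (s'.nreg (ρ + 23) + 2 ^ m) (by omega) (by omega)
        rw [← z₂, mul_add]
        refine ⟨⟨hv.set _ _ 24 _ (by omega) (by omega) (hv.set _ _ 23 _ (by omega) (by omega) hJ''),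
          ?_, ?_, ?_, ?_, ?_⟩, ?_, ?_⟩
        · simp [k0, e0]
        · simp [k1, e1]
        · simp [k2, e2]
        · simp [k3, k4, hm]; omega
        · simpa [k3, k4, hm] using z₁
        · simp [k4, hm]; omega
        · simp [k4, hm]
      · obtain ⟨z₁, z₂⟩ := hsize (s'.nreg (ρ + 23)) (by omega) (by omega)
        rw [← z₂, mul_add]
        refine ⟨⟨hv.set _ _ 24 _ (by omega) (by omega) hJ'',
          ?_, ?_, ?_, ?_, ?_⟩, ?_, ?_⟩
        · simp [k0, e0]
        · simp [k1, e1]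
        · simp [k2, e2]
        · simp [k3]; omega
        · simpa [k3, k4, hm] using z₁
        · simp [k4, hm]; omega
        · simp [k4, hm]
    · obtain ⟨z₁, z₂⟩ := hsize (s'.nreg (ρ + 23)) (by omega) (by omega)
      rw [← z₂, mul_add]
      refine ⟨⟨hv.set _ _ 24 _ (by omega) (by omega) hJ',
        ?_, ?_, ?_, ?_, ?_⟩, ?_, ?_⟩
      · simp [e0]
      · simp [e1]
      · simp [e2]
      · simp; omega
      · simpa [hm] using z₁
      · simp [hm]; omega
      · simp [hm]
  · refine ⟨hv.set _ _ 24 _ (by omega) (by omega) (hv.set _ _ 23 _ (by omega) (by omega) hJ),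
      ?_, ?_, ?_, ?_, .inr ⟨t, ?_, ?_⟩⟩
    · simp
    · simp
    · simp
    · simp
    · simp [hp]
    · simp; omega
  · rintro τ s' ⟨⟨⟨hJ', e0, e1, e2, hle, hm⟩, ht⟩, hcost⟩
    simp at ht
    simp [hp, Nat.size_pow, ht] at hcost
    have hr' : r = s'.nreg (ρ + 23) := by
      rcases hm with ⟨-, h⟩ | ⟨m, hm, -⟩
      · exact h
      · rw [ht] at hm
        have : 0 < 2 ^ m := by positivity
        omega
    refine wp_block_nil.2 ⟨?_, hJ', e0, e1, e2, by rwa [← hr']⟩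
    have : (Tc + 60) * (t + 2) = (Tc + 60) * (t + 1) + (Tc + 60) := by ring
    simp
    omega

/-- Every point of the block is dominated by a visited vertex. -/
def Covered (x y : ℕ → ℝ) (dx dy : ℝ) (V : Set ℕ) (b q : ℕ) : Prop :=
  ∀ σ z, b ≤ z → z < b + q → ∃ v ∈ V, Dom x y dx dy σ z v

theorem Covered.mono {V V' : Set ℕ} {b q : ℕ} (hc : Covered x y dx dy V b q) (hV : V ⊆ V') :
    Covered x y dx dy V' b q := fun σ z h₁ h₂ => by
  obtain ⟨v, hv, hd⟩ := hc σ z h₁ h₂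
  exact ⟨v, hV hv, hd⟩

/-- The table `own` converts the rank in the list into the turn of the chain. By `Chain.dom_turn`
the two vertices at the turn then dominate the whole block, for every `σ`, so no further comparison
is needed. -/
theorem Visitor.visitPiece (hv : Visitor x y M K i j h dx dy ρ cmp visit J Tc Tv) {V : Set ℕ}
    {s : State} (hJ : J V s) {A b q δ r : ℕ} (hδ : δ = 29 ∨ δ = 30)
    (hA : s.nreg (ρ + 32) = A) (hr : s.nreg (ρ + δ) = r)
    (hn : Node x y M β A b q) (hi : i ≤ b) (hj : b + q ≤ j + 1)
    (hrank : IsRank (fun k => dy ≤ dx * edgeSlope x y M β A k) (M (β + 2) A) r) :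
    WP (block [.setN (ρ + 28) (nc (β + 1) (nr (ρ + 32) + nc (β + 5) (nr (ρ + 32) + nr (ρ + δ)))),
      visit,
      .setN (ρ + 28)
        (nc (β + 1) (nr (ρ + 32) + (nc (β + 5) (nr (ρ + 32) + nr (ρ + δ)) - nl 1))),
      visit]) s fun τ s' => τ ≤ 2 * Tv + 30 ∧ ∃ V', V ⊆ V' ∧ J V' s' ∧
        (∀ k, 20 ≤ k → k < 33 → k ≠ 25 → k ≠ 26 → k ≠ 27 → k ≠ 28 →
          s'.nreg (ρ + k) = s.nreg (ρ + k)) ∧ Covered x y dx dy V' b q := by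
  have hown := hn.own (fun e => dy ≤ dx * e)
    (fun a b hab h => h.trans (mul_le_mul_of_nonneg_left hab hv.dx_nonneg)) r hrank
  have hpos := hn.chain.pos
  have hol := hown.1
  have hm₁ := hn.chain.mem (M (β + 5) (A + r)) (by omega)
  have hm₂ := hn.chain.mem (M (β + 5) (A + r) - 1) (by omega)
  have hM := (hv.window _ _ hJ).nmem
  simp only [wp_block_cons, wp_setN, NExp.eval_cell, NExp.eval_reg, NExp.eval_add, hA, hr, hM]
  have hJ₁ := hv.set _ _ 28 (M (β + 1) (A + M (β + 5) (A + r))) (by omega) (by omega) hJ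
  refine (hv.visit _ _ hJ₁ (by simp; omega) (by simp; omega)).mono ?_
  rintro τ₁ s₁ ⟨c₁, J₁, hs₁⟩
  have hs₁' : ∀ k, 20 ≤ k → k < 33 → k ≠ 25 → k ≠ 26 → k ≠ 27 → k ≠ 28 →
      s₁.nreg (ρ + k) = s.nreg (ρ + k) := fun k h₁ h₂ h₃ h₄ h₅ h₆ =>
    (hs₁ k h₁ h₂ h₃ h₄ h₅).trans (by simp [h₆])
  have hM₁ := (hv.window _ _ J₁).nmem
  simp only [NExp.eval_sub, NExp.eval_cell, NExp.eval_add, NExp.eval_reg, NExp.eval_lit,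
    hs₁' 32 (by omega) (by omega) (by omega) (by omega) (by omega) (by omega), hA, hM₁,
    hs₁' δ (by omega) (by omega) (by omega) (by omega) (by omega) (by omega), hr]
  have hJ₂ := hv.set _ _ 28 (M (β + 1) (A + (M (β + 5) (A + r) - 1))) (by omega) (by omega) J₁
  refine (hv.visit _ _ hJ₂ (by simp; omega) (by simp; omega)).mono ?_
  rintro τ₂ s₂ ⟨c₂, J₂, hs₂⟩
  refine wp_block_nil.2 ⟨by simp; omega, _, ?_, J₂, fun k h₁ h₂ h₃ h₄ h₅ h₆ => ?_,
    fun σ z hz hz' => ?_⟩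
  · exact (Set.subset_insert _ _).trans (Set.subset_insert _ _)
  · rw [hs₂ k h₁ h₂ h₃ h₄ h₅, ← hs₁' k h₁ h₂ h₃ h₄ h₅ h₆]
    simp [h₆]
  · simp only [State.setN_nreg, if_true]
    rcases hn.chain.dom_turn hv.dx_nonneg hv.ne_zero hown σ z hz hz' with hd | hd
    · exact ⟨_, Set.mem_insert_of_mem _ (Set.mem_insert _ _), hd⟩
    · exact ⟨_, Set.mem_insert _ _, hd⟩

/-- One step of the cascade: the link gives the rank among the entries with odd index, and a single
comparison with entry `2 * a` completes it. The rank is computed also for children outside the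
window, as the way down may continue there. -/
theorem Visitor.childStep (hv : Visitor x y M K i j h dx dy ρ cmp visit J Tc Tv) {V : Set ℕ}
    {s : State} (hJ : J V s) {A A' b b' c δ t : ℕ} {e : NExp} (hδ : δ = 29 ∨ δ = 30)
    (he : e.cost ≤ 3) (heval : e.eval s = b') (hp : s.nreg (ρ + 21) = 2 ^ t)
    (hb : s.nreg (ρ + 20) = b) (ho : s.nreg (ρ + 22) = (t + 1) * (2 * 2 ^ K))
    (hA : A = (t + 1) * (2 * 2 ^ K) + (b + b)) (hA' : A' = t * (2 * 2 ^ K) + (b' + b'))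
    (hr : IsRank (fun k => dy ≤ dx * edgeSlope x y M β A k) (M (β + 2) A) (s.nreg (ρ + 23)))
    (hn : Node x y M β A' b' (2 ^ t)) (hl : Link x y M β c A A') :
    WP (childStep ρ β c δ e cmp visit) s fun τ s' => τ ≤ Tc + 2 * Tv + 150 ∧
      ∃ V', V ⊆ V' ∧ J V' s' ∧
        (∀ k, 20 ≤ k → k < 31 → k ≠ 25 → k ≠ 26 → k ≠ 27 → k ≠ 28 → k ≠ δ →
          s'.nreg (ρ + k) = s.nreg (ρ + k)) ∧
        IsRank (fun k => dy ≤ dx * edgeSlope x y M β A' k) (M (β + 2) A') (s'.nreg (ρ + δ)) ∧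
        (i ≤ b' → b' + 2 ^ t ≤ j + 1 → Covered x y dx dy V' b' (2 ^ t)) := by
  have hmono : ∀ a b : ℝ, a ≤ b → dy ≤ dx * a → dy ≤ dx * b := fun a b hab h =>
    h.trans (mul_le_mul_of_nonneg_left hab hv.dx_nonneg)
  have hodd := (hl _ hmono _ hr).of_odd (C := fun k => dy ≤ dx * edgeSlope x y M β A' k)
    fun k l hkl hl h => hmono _ _ (hn.sorted k l hkl hl) h
  set a := M c (A + s.nreg (ρ + 23)) with ha
  have hw := hv.window _ _ hJ
  have ho' : (t + 1) * (2 * 2 ^ K) - 2 * 2 ^ K = t * (2 * 2 ^ K) := by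
    rw [add_mul, one_mul, Nat.add_sub_cancel]
  have h₀ : (2 : ℕ) ≠ ρ + 31 := by omega
  simp only [WindowHull.childStep, wp_block_cons, wp_setN, heval]
  generalize hs₁ : State.setN _ (ρ + δ) _ = s₁
  have hJ₁ : J V s₁ := by
    rw [← hs₁]
    exact hv.set _ _ δ _ (by omega) (by omega) (hv.set _ _ 32 _ (by omega) (by omega)
      (hv.set _ _ 31 _ (by omega) (by omega) hJ))
  have e₁ : ∀ k, 20 ≤ k → k < 31 → k ≠ δ → s₁.nreg (ρ + k) = s.nreg (ρ + k) :=
    fun k h₁ h₂ h₃ => by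
      rw [← hs₁]
      simp only [State.setN_nreg]
      rw [if_neg (by omega), if_neg (by omega), if_neg (by omega)]
  have e31 : s₁.nreg (ρ + 31) = b' := by
    rw [← hs₁]
    simp only [State.setN_nreg, if_true]
    rw [if_neg (by omega), if_neg (by omega)]
  have e32 : s₁.nreg (ρ + 32) = A' := by
    rw [← hs₁, hA', State.setN_nreg, if_neg (by omega)]
    simp [ho, hw.r2, ho']
  have eδ : s₁.nreg (ρ + δ) = 2 * a := by
    rw [← hs₁, State.setN_nreg, if_pos rfl]
    simp [ho, hb, hw.nmem, ha, hA, two_mul]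
  clear hs₁
  have hw₁ := hv.window _ _ hJ₁
  simp only [wp_cond, wp_skip, wp_block_cons, wp_block_nil, wp_setN, Test.holds_nlt,
    NExp.eval_reg, NExp.eval_cell, NExp.eval_add, NExp.eval_lit, e32, eδ, hw₁.nmem]
  have key : ∀ τ s₂, τ ≤ Tc + 60 → J V s₂ → (∀ k, 20 ≤ k → k < 33 → k ≠ 25 → k ≠ 26 → k ≠ 27 →
      k ≠ δ → s₂.nreg (ρ + k) = s₁.nreg (ρ + k)) →
      IsRank (fun k => dy ≤ dx * edgeSlope x y M β A' k) (M (β + 2) A') (s₂.nreg (ρ + δ)) →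
      WP (WindowHull.visitPiece ρ β δ visit) s₂ fun τ' s' => τ + τ' ≤ Tc + 2 * Tv + 105 ∧
      ∃ V', V ⊆ V' ∧ J V' s' ∧
        (∀ k, 20 ≤ k → k < 31 → k ≠ 25 → k ≠ 26 → k ≠ 27 → k ≠ 28 → k ≠ δ →
          s'.nreg (ρ + k) = s.nreg (ρ + k)) ∧
        IsRank (fun k => dy ≤ dx * edgeSlope x y M β A' k) (M (β + 2) A') (s'.nreg (ρ + δ)) ∧
        (i ≤ b' → b' + 2 ^ t ≤ j + 1 → Covered x y dx dy V' b' (2 ^ t)) := by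
    intro τ s₂ hτ hJ₂ hs₂ hrank
    have hw₂ := hv.window _ _ hJ₂
    have e31' : s₂.nreg (ρ + 31) = b' := by
      rw [hs₂ 31 (by omega) (by omega) (by omega) (by omega) (by omega) (by omega), e31]
    have e21' : s₂.nreg (ρ + 21) = 2 ^ t := by
      rw [hs₂ 21 (by omega) (by omega) (by omega) (by omega) (by omega) (by omega),
        e₁ 21 (by omega) (by omega) (by omega), hp]
    simp only [WindowHull.visitPiece, wp_cond, wp_skip, Test.holds_conj, Test.holds_neg, Test.holds_nlt,
      NExp.eval_reg, NExp.eval_add, NExp.eval_lit, e31', e21', hw₂.r0, hw₂.r1]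
    refine ⟨fun ⟨hi, hj⟩ => ?_, fun hn => ⟨by simp; omega, V, subset_rfl, hJ₂, ?_, hrank,
      fun hi hj => absurd ⟨not_lt.2 hi, not_lt.2 hj⟩ hn⟩⟩
    · refine (hv.visitPiece hJ₂ hδ (by rw [hs₂ 32 (by omega) (by omega) (by omega) (by omega)
        (by omega) (by omega), e32]) rfl hn (by omega) (by omega) hrank).mono ?_
      rintro τ₃ s₃ ⟨c₃, V', hV, hJ₃, hs₃, hcov⟩
      refine ⟨by simp; omega, V', hV, hJ₃, fun k h₁ h₂ h₃ h₄ h₅ h₆ h₇ => ?_, ?_, fun _ _ => hcov⟩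
      · rw [hs₃ k h₁ (by omega) h₃ h₄ h₅ h₆, hs₂ k h₁ (by omega) h₃ h₄ h₅ h₇, e₁ k h₁ h₂ h₇]
      · rwa [hs₃ δ (by omega) (by omega) (by omega) (by omega) (by omega) (by omega)]
    · intro k h₁ h₂ h₃ h₄ h₅ h₆ h₇
      rw [hs₂ k h₁ (by omega) h₃ h₄ h₅ h₇, e₁ k h₁ h₂ h₇]
  refine ⟨fun hlt => ?_, fun hge => ?_⟩
  · refine (hv.ask hJ₁ (fun v => ?_) ?_).mono ?_
    · simp only [NExp.eval_cell, NExp.eval_add, NExp.eval_reg, State.setN_nreg, State.setN_nmem]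
      rw [if_neg (by omega), if_neg (by omega)]
    · simpa [e32, eδ, hw₁.nmem] using hn.edge _ hlt
    rintro τ s₂ ⟨c₂, hJ₂, hs₂, hflag⟩
    have hδ₂ : s₂.nreg (ρ + δ) = 2 * a := by
      rw [hs₂ δ (by omega) (by omega) (by omega) (by omega) (by omega), eδ]
    simp only [NExp.eval_cell, NExp.eval_reg, NExp.eval_add, e32, eδ, hw₁.nmem] at hflag
    simp only [NExp.cost_cell, NExp.cost_add, NExp.cost_reg] at c₂
    refine ⟨fun hf => ?_, fun hf => ?_⟩
    · refine (key (τ + 13) _ (by omega) (hv.set _ _ δ _ (by omega) (by omega) hJ₂)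
        (fun k h₁ h₂ h₃ h₄ h₅ h₆ => ?_) ?_).mono ?_
      · rw [State.setN_nreg, if_neg (by omega), hs₂ k h₁ h₂ h₃ h₄ h₅]
      · rw [State.setN_nreg, if_pos rfl, hδ₂]
        exact hodd.1 hlt (hflag.1 hf)
      · rintro τ' s' ⟨c', hrest⟩
        exact ⟨by simp; omega, hrest⟩
    · refine (key (τ + 13) _ (by omega) hJ₂ (fun k h₁ h₂ h₃ h₄ h₅ h₆ => hs₂ k h₁ h₂ h₃ h₄ h₅)
        ?_).mono ?_
      · rw [hδ₂]
        exact hodd.2 fun _ hc => hf (hflag.2 hc)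
      · rintro τ' s' ⟨c', hrest⟩
        exact ⟨by simp; omega, hrest⟩
  · refine (key 13 _ (by omega) hJ₁ (fun _ _ _ _ _ _ _ => rfl) ?_).mono ?_
    · rw [eδ]
      exact hodd.2 fun hc => absurd hc hge
    · rintro τ' s' ⟨c', hrest⟩
      exact ⟨by simp; omega, hrest⟩

end

/-! ### Descent along the two ways to the ends of the window -/

section
variable {x y : ℕ → ℝ} {M : ℕ → ℕ → ℕ} {β K i j h ρ Tc Tv : ℕ} {dx dy : ℝ} {cmp visit : Prog}
  {J : Set ℕ → State → Prop}

/-- The block of `g` on level `t` is the left or the right half of its block on level `t + 1`,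
according to the test that `walk` makes. -/
theorem block_start_succ (g t : ℕ) :
    g / 2 ^ t * 2 ^ t = if g < g / 2 ^ (t + 1) * 2 ^ (t + 1) + 2 ^ t
      then g / 2 ^ (t + 1) * 2 ^ (t + 1) else g / 2 ^ (t + 1) * 2 ^ (t + 1) + 2 ^ t := by
  have h₁ : g / 2 ^ (t + 1) = g / 2 ^ t / 2 := by rw [Nat.div_div_eq_div_mul, pow_succ]
  have h₂ := Nat.div_add_mod' g (2 ^ t)
  have h₃ := Nat.mod_lt g (show 0 < 2 ^ t by positivity)
  rw [h₁]
  generalize hq : g / 2 ^ t = q at *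
  obtain ⟨u, rfl | rfl⟩ := Nat.even_or_odd' q
  · have e : 2 * u / 2 * 2 ^ (t + 1) = 2 * u * 2 ^ t := by
      rw [Nat.mul_div_cancel_left _ two_pos, pow_succ]; ring
    rw [e, if_pos (by omega)]
  · have e : (2 * u + 1) / 2 * 2 ^ (t + 1) + 2 ^ t = (2 * u + 1) * 2 ^ t := by
      rw [show (2 * u + 1) / 2 = u by omega, pow_succ]; ring
    rw [e, if_neg (by omega)]

/-- Both children of the nodes above level `t` on the path to the leaf `g`, as far as they lie in
the window, are covered. -/
def PathCovered (x y : ℕ → ℝ) (i j h : ℕ) (dx dy : ℝ) (g t : ℕ) (V : Set ℕ) : Prop :=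
  ∀ t', t ≤ t' → t' < h → ∀ b', b' = g / 2 ^ (t' + 1) * 2 ^ (t' + 1) ∨
    b' = g / 2 ^ (t' + 1) * 2 ^ (t' + 1) + 2 ^ t' → i ≤ b' → b' + 2 ^ t' ≤ j + 1 →
    Covered x y dx dy V b' (2 ^ t')

theorem Visitor.walk (hv : Visitor x y M K i j h dx dy ρ cmp visit J Tc Tv)
    (hS : Structure x y M β K) (hh : h ≤ K) {V : Set ℕ} {s : State} (hJ : J V s) {g gr st : ℕ}
    (hgK : g < 2 ^ K) (hg : ∀ s, Window M K i j h s → s.nreg gr = g)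
    (hst : ∀ s, Window M K i j h s → s.nreg st = g / 2 ^ h * 2 ^ h) :
    WP (walk ρ β gr st cmp visit) s fun τ s' => τ ≤ (3 * Tc + 4 * Tv + 500) * (h + 2) ∧
      ∃ V', V ⊆ V' ∧ J V' s' ∧ PathCovered x y i j h dx dy g 0 V' := by
  have hw := hv.window _ _ hJ
  have hbK : ∀ t, g / 2 ^ t * 2 ^ t < 2 ^ K := fun t =>
    (Nat.div_mul_le_self g (2 ^ t)).trans_lt hgK
  simp only [WindowHull.walk, wp_block_cons, wp_setN]
  generalize hs₁ : State.setN _ (ρ + 22) _ = s₁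
  have hJ₁ : J V s₁ := by
    rw [← hs₁]
    exact hv.set _ _ 22 _ (by omega) (by omega) (hv.set _ _ 21 _ (by omega) (by omega)
      (hv.set _ _ 20 _ (by omega) (by omega) hJ))
  have e20 : s₁.nreg (ρ + 20) = g / 2 ^ h * 2 ^ h := by simp [← hs₁, hst s hw]
  have e21 : s₁.nreg (ρ + 21) = 2 ^ h := by
    rw [← hs₁, State.setN_nreg, if_neg (by omega), State.setN_nreg, if_pos rfl, NExp.eval_reg,
      State.setN_nreg, if_neg (by omega), hw.r3]
  have e22 : s₁.nreg (ρ + 22) = h * (2 * 2 ^ K) := by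
    rw [← hs₁, State.setN_nreg, if_pos rfl, NExp.eval_reg, State.setN_nreg, if_neg (by omega),
      State.setN_nreg, if_neg (by omega), hw.r6]
  clear hs₁
  refine (hv.locate hJ₁ e21 rfl
    (by rw [e22, e20]; exact hS.node h hh _ (Nat.dvd_mul_left _ _) (hbK h))).mono ?_
  rintro τ₂ s₂ ⟨c₂, hJ₂, f20, f21, f22, hr₂⟩
  rw [e22, e20] at hr₂
  rw [e20] at f20
  rw [e21] at f21
  rw [e22] at f22
  refine (WP.loop (fun s' => ∃ t ≤ h, ∃ V', V ⊆ V' ∧ J V' s' ∧ s'.nreg (ρ + 21) = 2 ^ t ∧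
    s'.nreg (ρ + 22) = t * (2 * 2 ^ K) ∧ s'.nreg (ρ + 20) = g / 2 ^ t * 2 ^ t ∧
    IsRank (fun k => dy ≤ dx * edgeSlope x y M β
        (t * (2 * 2 ^ K) + (g / 2 ^ t * 2 ^ t + g / 2 ^ t * 2 ^ t)) k)
      (M (β + 2) (t * (2 * 2 ^ K) + (g / 2 ^ t * 2 ^ t + g / 2 ^ t * 2 ^ t)))
      (s'.nreg (ρ + 23)) ∧ PathCovered x y i j h dx dy g t V')
    -- Each level makes one comparison and at most two visits for each of the two children.
    (fun s' => (2 * Tc + 4 * Tv + 400) * Nat.size (s'.nreg (ρ + 21))) ?_ ?_).mono ?_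
  · rintro s ⟨t, hth, V₁, hV₁, hJ, e21, e22, e20, hr, hcov⟩ ht
    simp [e21] at ht
    obtain _ | t := t
    · simp at ht
    have hdvd : 2 ^ (t + 1) ∣ g / 2 ^ (t + 1) * 2 ^ (t + 1) := Nat.dvd_mul_left _ _
    obtain ⟨hl₁, hl₂⟩ := hS.link t (by omega) _ hdvd (hbK _)
    have hn₁ := hS.node t (by omega) _ (left_child hdvd) (hbK _)
    obtain ⟨d₂, lt₂, -⟩ := right_child (t := t) (by omega) hdvd (hbK _)
    have hn₂ := hS.node t (by omega) _ d₂ lt₂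
    have hstart := block_start_succ g t
    generalize hb : g / 2 ^ (t + 1) * 2 ^ (t + 1) = b at *
    have hpow : 2 ^ (t + 1) / 2 = 2 ^ t := by rw [pow_succ]; omega
    simp only [wp_block_cons, wp_setN, wp_cond, wp_block_nil, NExp.eval_half, NExp.eval_reg, e21,
      hpow]
    have hJ₁ := hv.set _ _ 21 (2 ^ t) (by omega) (by omega) hJ
    refine (hv.childStep (A := (t + 1) * (2 * 2 ^ K) + (b + b)) hJ₁ (.inl rfl) (by simp) rfl
      (by simp) (b := b) (by simp [e20]) (by simp [e22]) rfl rfl (by simpa using hr)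
      (by simpa [e20] using hn₁) (by simpa [e20] using hl₁)).mono ?_
    rintro τ₃ s₃ ⟨c₃, V₃, hV₃, hJ₃, h₃, hr₃, hcov₃⟩
    simp only [NExp.eval_reg, State.setN_nreg] at hr₃ hcov₃
    rw [if_neg (by omega), e20] at hr₃ hcov₃
    have h20 : s₃.nreg (ρ + 20) = b := by
      rw [h₃ 20 (by omega) (by omega) (by omega) (by omega) (by omega) (by omega) (by omega)]
      simp [e20]
    have h21 : s₃.nreg (ρ + 21) = 2 ^ t := by
      rw [h₃ 21 (by omega) (by omega) (by omega) (by omega) (by omega) (by omega) (by omega)]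
      simp
    have h22 : s₃.nreg (ρ + 22) = (t + 1) * (2 * 2 ^ K) := by
      rw [h₃ 22 (by omega) (by omega) (by omega) (by omega) (by omega) (by omega) (by omega)]
      simp [e22]
    have h23 : s₃.nreg (ρ + 23) = s.nreg (ρ + 23) := by
      rw [h₃ 23 (by omega) (by omega) (by omega) (by omega) (by omega) (by omega) (by omega)]
      simp
    refine (hv.childStep (A := (t + 1) * (2 * 2 ^ K) + (b + b)) hJ₃ (.inr rfl) (by simp) rfl
      h21 h20 h22 rfl rfl (by rwa [h23])
      (by simpa [h20, h21] using hn₂) (by simpa [h20, h21] using hl₂)).mono ?_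
    rintro τ₄ s₄ ⟨c₄, V₄, hV₄, hJ₄, h₄, hr₄, hcov₄⟩
    simp only [NExp.eval_reg, NExp.eval_add, h20, h21] at hr₄ hcov₄
    have g20 : s₄.nreg (ρ + 20) = b := by
      rw [h₄ 20 (by omega) (by omega) (by omega) (by omega) (by omega) (by omega) (by omega), h20]
    have g21 : s₄.nreg (ρ + 21) = 2 ^ t := by
      rw [h₄ 21 (by omega) (by omega) (by omega) (by omega) (by omega) (by omega) (by omega), h21]
    have g22 : s₄.nreg (ρ + 22) = (t + 1) * (2 * 2 ^ K) := by
      rw [h₄ 22 (by omega) (by omega) (by omega) (by omega) (by omega) (by omega) (by omega), h22]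
    have g29 : s₄.nreg (ρ + 29) = s₃.nreg (ρ + 29) :=
      h₄ 29 (by omega) (by omega) (by omega) (by omega) (by omega) (by omega) (by omega)
    have hw₄ := hv.window _ _ hJ₄
    have ho : (t + 1) * (2 * 2 ^ K) - 2 * 2 ^ K = t * (2 * 2 ^ K) := by
      rw [add_mul, one_mul, Nat.add_sub_cancel]
    have hsize : ∀ c, c ≤ 2 * Tc + 4 * Tv + 400 →
        c + (2 * Tc + 4 * Tv + 400) * Nat.size (2 ^ t) ≤
          (2 * Tc + 4 * Tv + 400) * Nat.size (2 ^ (t + 1)) := fun c hc => by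
      rw [Nat.size_pow, Nat.size_pow, mul_add _ (t + 1)]; omega
    have hsize' : (2 * Tc + 4 * Tv + 400) * Nat.size (2 ^ t) <
        (2 * Tc + 4 * Tv + 400) * Nat.size (2 ^ (t + 1)) := by
      have := hsize 1 (by omega); omega
    have hpath : PathCovered x y i j h dx dy g t V₄ := by
      intro t' ht' hth' b' hb' hi hj
      rcases ht'.eq_or_lt with rfl | hlt
      · rw [hb] at hb'
        rcases hb' with rfl | rfl
        · exact (hcov₃ hi hj).mono hV₄
        · exact hcov₄ hi hj
      · exact (hcov t' hlt hth' b' hb' hi hj).mono (hV₃.trans hV₄)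
    simp only [Test.holds_nlt, NExp.eval_reg, NExp.eval_add, hg _ hw₄, g20, g21]
    refine ⟨fun hlt => ?_, fun hge => ?_⟩
    · rw [if_pos hlt] at hstart
      refine ⟨⟨t, by omega, V₄, hV₁.trans (hV₃.trans hV₄), hv.set _ _ 22 _ (by omega) (by omega)
        (hv.set _ _ 23 _ (by omega) (by omega) hJ₄), ?_, ?_, ?_, ?_, hpath⟩, ?_, ?_⟩
      · simp [g21]
      · simp [g22, (hv.window _ _ hJ₄).r2, ho]
      · simp [g20, hstart]
      · rw [hstart]
        simpa [g29] using hr₃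
      · simp only [State.setN_nreg]
        rw [if_neg (by omega), if_neg (by omega), g21]
        refine hsize _ ?_
        simp; omega
      · simpa [g21, e21] using hsize'
    · rw [if_neg hge] at hstart
      refine ⟨⟨t, by omega, V₄, hV₁.trans (hV₃.trans hV₄), hv.set _ _ 22 _ (by omega) (by omega)
        (hv.set _ _ 20 _ (by omega) (by omega) (hv.set _ _ 23 _ (by omega) (by omega) hJ₄)),
          ?_, ?_, ?_, ?_, hpath⟩, ?_, ?_⟩
      · simp [g21]
      · simp [g22, (hv.window _ _ hJ₄).r2, ho]
      · simp [g20, g21, hstart]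
      · rw [hstart]
        simpa using hr₄
      · simp only [State.setN_nreg]
        rw [if_neg (by omega), if_neg (by omega), if_neg (by omega), g21]
        refine hsize _ ?_
        simp; omega
      · simpa [g21, e21] using hsize'
  · exact ⟨h, le_rfl, V, subset_rfl, hJ₂, f21, f22, f20, hr₂, fun t' h₁ h₂ => by omega⟩
  · rintro τ₃ s₃ ⟨⟨⟨t, ht, V₃, hV₃, hJ₃, e21, -, -, -, hcov⟩, hp⟩, hcost⟩
    simp [e21] at hp
    obtain rfl : t = 0 := by
      by_contra h0
      have := Nat.one_lt_two_pow h0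
      omega
    rw [f21, Nat.size_pow] at hcost
    refine wp_block_nil.2 ⟨?_, V₃, hV₃, hJ₃, hcov⟩
    simp at hcost ⊢
    have h₁ : (3 * Tc + 4 * Tv + 500) * (h + 2) = (Tc + 60) * (h + 2) +
      (2 * Tc + 4 * Tv + 400) * (h + 1) + (2 * Tc + 4 * Tv + 400) + 40 * (h + 2) := by ring
    omega

/-- Take the lowest level on which `z` shares its block with `i` or with `j`. On level `0`, `z` is
an end of the window. Otherwise the block of `z` one level below lies strictly between those of `i`
and `j`, hence in the window, and its parent is on one of the two ways. -/
theorem covered_of_paths {V : Set ℕ} (hij : i ≤ j) (hw : j + 1 ≤ i + 2 ^ h) (hi : i ∈ V)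
    (hj : j ∈ V) (hpi : PathCovered x y i j h dx dy i 0 V)
    (hpj : PathCovered x y i j h dx dy j 0 V) (σ : ℝ) {z : ℕ} (hiz : i ≤ z) (hzj : z ≤ j) :
    ∃ v ∈ V, Dom x y dx dy σ z v := by
  have hexh : z / 2 ^ h = i / 2 ^ h ∨ z / 2 ^ h = j / 2 ^ h := by
    have h₁ : i / 2 ^ h ≤ z / 2 ^ h := Nat.div_le_div_right hiz
    have h₂ : z / 2 ^ h ≤ j / 2 ^ h := Nat.div_le_div_right hzj
    -- As the window has at most `2 ^ h` points, the blocks of `i` and `j` on level `h` are equal or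
    -- adjacent, so the lowest common level exists and is at most `h`.
    have h₃ : j / 2 ^ h ≤ (i + 2 ^ h) / 2 ^ h := Nat.div_le_div_right (by omega)
    rw [Nat.add_div_right _ (by positivity)] at h₃
    omega
  have hex : ∃ t, z / 2 ^ t = i / 2 ^ t ∨ z / 2 ^ t = j / 2 ^ t := ⟨h, hexh⟩
  classical
  rcases ht : Nat.find hex with _ | t
  · have := Nat.find_spec hex
    simp only [ht, pow_zero, Nat.div_one] at this
    rcases this with rfl | rfl
    · exact ⟨z, hi, .refl z⟩
    · exact ⟨z, hj, .refl z⟩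
  · have hspec := Nat.find_spec hex
    rw [ht] at hspec
    have hmin := Nat.find_min hex (m := t) (by omega)
    have hth : t < h := by
      have : Nat.find hex ≤ h := Nat.find_min' hex hexh
      omega
    push Not at hmin
    have h₁ : i / 2 ^ t < z / 2 ^ t :=
      lt_of_le_of_ne (Nat.div_le_div_right hiz) (Ne.symm hmin.1)
    have h₂ : z / 2 ^ t < j / 2 ^ t := lt_of_le_of_ne (Nat.div_le_div_right hzj) hmin.2
    have hpos : 0 < 2 ^ t := by positivity
    have hiz' : i ≤ z / 2 ^ t * 2 ^ t := ((Nat.div_lt_iff_lt_mul hpos).1 h₁).le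
    have hzj' : z / 2 ^ t * 2 ^ t + 2 ^ t ≤ j + 1 := by
      calc z / 2 ^ t * 2 ^ t + 2 ^ t = (z / 2 ^ t + 1) * 2 ^ t := by ring
        _ ≤ j / 2 ^ t * 2 ^ t := Nat.mul_le_mul_right _ h₂
        _ ≤ j := Nat.div_mul_le_self _ _
        _ ≤ j + 1 := by omega
    have hz := block_start_succ z t
    have hz₁ := Nat.div_add_mod' z (2 ^ t)
    have hz₂ := Nat.mod_lt z hpos
    have hchild : z / 2 ^ t * 2 ^ t = z / 2 ^ (t + 1) * 2 ^ (t + 1) ∨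
        z / 2 ^ t * 2 ^ t = z / 2 ^ (t + 1) * 2 ^ (t + 1) + 2 ^ t := by
      split_ifs at hz
      exacts [.inl hz, .inr hz]
    rcases hspec with e | e
    · rw [e] at hchild
      exact hpi t (by omega) hth _ hchild hiz' hzj' σ z (by omega) (by omega)
    · rw [e] at hchild
      exact hpj t (by omega) hth _ hchild hiz' hzj' σ z (by omega) (by omega)

theorem Visitor.descend (hv : Visitor x y M K i j h dx dy ρ cmp visit J Tc Tv)
    (hS : Structure x y M β K) (hh : h ≤ K) (hij : i ≤ j) (hj : j < 2 ^ K)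
    (hw : j + 1 ≤ i + 2 ^ h) {V : Set ℕ} {s : State} (hJ : J V s) :
    WP (descend ρ β cmp visit) s fun τ s' => τ ≤ 10 * (Tc + Tv + 110) * (h + 2) ∧
      ∃ V', V ⊆ V' ∧ J V' s' ∧ ∀ σ z, i ≤ z → z ≤ j → ∃ v ∈ V', Dom x y dx dy σ z v := by
  have hw₀ := hv.window _ _ hJ
  simp only [WindowHull.descend, wp_block_cons, wp_setN, NExp.eval_reg, hw₀.r0]
  refine (hv.visit _ _ (hv.set _ _ 28 i (by omega) (by omega) hJ) (by simp)
    (by simpa using hij)).mono ?_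
  rintro τ₁ s₁ ⟨c₁, hJ₁, -⟩
  have hw₁ := hv.window _ _ hJ₁
  simp only [State.setN_nreg, if_true, hw₁.r1] at hJ₁ ⊢
  refine (hv.visit _ _ (hv.set _ _ 28 j (by omega) (by omega) hJ₁) (by simpa using hij)
    (by simp)).mono ?_
  rintro τ₂ s₂ ⟨c₂, hJ₂, -⟩
  simp only [State.setN_nreg, if_true] at hJ₂
  refine (hv.walk hS hh hJ₂ (hij.trans_lt hj) (fun s h => h.r0) (fun s h => h.r4)).mono ?_
  rintro τ₃ s₃ ⟨c₃, V₃, hV₃, hJ₃, hp₃⟩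
  refine (hv.walk hS hh hJ₃ hj (fun s h => h.r1) (fun s h => h.r5)).mono ?_
  rintro τ₄ s₄ ⟨c₄, V₄, hV₄, hJ₄, hp₄⟩
  refine wp_block_nil.2 ⟨?_, V₄, fun v hv => hV₄ (hV₃ (.inr (.inr hv))), hJ₄,
    fun σ z hiz hzj => covered_of_paths hij hw (hV₄ (hV₃ (.inr (.inl rfl))))
      (hV₄ (hV₃ (.inl rfl))) (fun t' a b b' c d e => (hp₃ t' a b b' c d e).mono hV₄) hp₄ σ hiz hzj⟩
  have h₁ : 10 * (Tc + Tv + 110) * (h + 2) = 2 * ((3 * Tc + 4 * Tv + 500) * (h + 2)) +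
    4 * Tc * (h + 2) + 2 * Tv * h + 4 * Tv + 100 * (h + 2) := by ring
  simp
  omega

end

/-! ### Extreme points in a known direction -/

/-- The functional of the direction in the real registers `2` and `3`, at the point in `r`. -/
def valExp (Y r : ℕ) : RExp := rr 2 * rc Y (nr r) - rr 3 * rc 0 (nr r)

/-- Compares the slope of an edge with the direction. -/
def directionCmp (Y : ℕ) : Prog :=
  .cond (.rlt (valExp Y 26) (valExp Y 25)) (.setN 27 (nl 0)) (.setN 27 (nl 1))

/-- Replaces the point in `t` by the point in `28` if this is better, where a tie is decided by
comparing the abscissas of the points in `a` and `b`. -/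
def improve (Y t a b : ℕ) : Prog :=
  .cond (.rlt (valExp Y t) (valExp Y 28)) (.setN t (nr 28))
    (.cond (.conj (.neg (.rlt (valExp Y 28) (valExp Y t))) (.rlt (rc 0 (nr a)) (rc 0 (nr b))))
      (.setN t (nr 28)) .skip)

/-- Finds the leftmost and the rightmost extreme point in the direction. -/
def extreme (Y β : ℕ) : Prog := block [
  .setN 40 (nr 0), .setN 41 (nr 0),
  descend 0 β (directionCmp Y) (block [improve Y 40 28 40, improve Y 41 41 28])]

/-- `v` is an optimal point of the window. -/
def Opt (x y : ℕ → ℝ) (i j : ℕ) (dx dy σ : ℝ) (v : ℕ) : Prop :=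
  (i ≤ v ∧ v ≤ j) ∧ ∀ z, i ≤ z → z ≤ j → Dom x y dx dy σ z v

theorem Window.congr {M : ℕ → ℕ → ℕ} {K i j h : ℕ} {s s' : State} (hw : Window M K i j h s)
    (hm : s'.nmem = s.nmem) (hr : ∀ k < 7, s'.nreg k = s.nreg k) : Window M K i j h s' :=
  ⟨hm.trans hw.nmem, (hr 0 (by omega)).trans hw.r0, (hr 1 (by omega)).trans hw.r1,
    (hr 2 (by omega)).trans hw.r2, (hr 3 (by omega)).trans hw.r3, (hr 4 (by omega)).trans hw.r4,
    (hr 5 (by omega)).trans hw.r5, (hr 6 (by omega)).trans hw.r6⟩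

theorem extreme_keeps {Y β : ℕ} : (extreme Y β).KeepsRMem ∧ (∀ b, (extreme Y β).KeepsBank b) ∧
    (∀ r, (extreme Y β).KeepsR r) ∧
    ∀ r, r < 20 ∨ 33 ≤ r → r ≠ 40 → r ≠ 41 → (extreme Y β).KeepsN r := by
  refine ⟨?_, fun b => ?_, fun r => ?_, fun r h₁ h₂ h₃ => ?_⟩
  · simp [extreme, descend, walk, childStep, visitPiece, locate, ask, directionCmp, improve,
      Prog.KeepsRMem]
  · simp [extreme, descend, walk, childStep, visitPiece, locate, ask, directionCmp, improve,
      Prog.KeepsBank]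
  · simp [extreme, descend, walk, childStep, visitPiece, locate, ask, directionCmp, improve,
      Prog.KeepsR]
  · simp [extreme, descend, walk, childStep, visitPiece, locate, ask, directionCmp, improve,
      Prog.KeepsN]
    omega

/-- State of the search for extreme points. -/
structure Extreme (R : ℕ → ℕ → ℝ) (Y : ℕ) (M : ℕ → ℕ → ℕ) (K i j h : ℕ) (dx dy : ℝ)
    (V : Set ℕ) (s : State) : Prop where
  window : Window M K i j h s
  rmem : s.rmem = R
  rdx : s.rreg 2 = dx
  rdy : s.rreg 3 = dy
  left : (i ≤ s.nreg 40 ∧ s.nreg 40 ≤ j) ∧ ∀ v ∈ V, Dom (R 0) (R Y) dx dy (-1) v (s.nreg 40)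
  right : (i ≤ s.nreg 41 ∧ s.nreg 41 ≤ j) ∧ ∀ v ∈ V, Dom (R 0) (R Y) dx dy 1 v (s.nreg 41)

section
variable {R : ℕ → ℕ → ℝ} {Y β : ℕ} {M : ℕ → ℕ → ℕ} {K i j h : ℕ} {dx dy : ℝ} {V : Set ℕ}

theorem improve_spec {s : State} {t a b : ℕ} {σ : ℝ} (hR : s.rmem = R) (h2 : s.rreg 2 = dx)
    (h3 : s.rreg 3 = dy) {u v : ℕ} (hu : s.nreg t = u) (hv : s.nreg 28 = v)
    (hσ : R 0 (s.nreg a) < R 0 (s.nreg b) ↔ σ * R 0 u < σ * R 0 v) :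
    WP (improve Y t a b) s fun τ s' => τ ≤ 60 ∧ ∃ w, s' = s.setN t w ∧ (w = u ∨ w = v) ∧
      Dom (R 0) (R Y) dx dy σ u w ∧ Dom (R 0) (R Y) dx dy σ v w := by
  have e : ∀ r, (valExp Y r).eval s = val (R 0) (R Y) dx dy (s.nreg r) := fun r => by
    simp [valExp, val, hR, h2, h3]
  simp only [improve, wp_cond, wp_setN, wp_skip, Test.holds_rlt, Test.holds_conj, Test.holds_neg,
    e, hu, hv, RExp.eval_cell, NExp.eval_reg, hR, hσ]
  refine ⟨fun hlt => ?_, fun hge => ⟨fun ⟨hle, hlt⟩ => ?_, fun hn => ?_⟩⟩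
  · exact ⟨by simp [valExp], v, rfl, .inr rfl, .inl hlt, .refl v⟩
  · exact ⟨by simp [valExp], v, rfl, .inr rfl, .inr ⟨le_antisymm (not_lt.1 hle) (not_lt.1 hge),
      hlt.le⟩, .refl v⟩
  · refine ⟨by simp [valExp], u, ?_, .inl rfl, .refl u, ?_⟩
    · cases s
      simp [State.setN, ← hu]
    · by_cases hlt : val (R 0) (R Y) dx dy v < val (R 0) (R Y) dx dy u
      · exact .inl hlt
      · exact .inr ⟨le_antisymm (not_lt.1 hge) (not_lt.1 hlt), not_lt.1 fun h => hn ⟨hlt, h⟩⟩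

/-- The instance with a known direction: comparisons evaluate `val`, and a visit updates the
leftmost and the rightmost optimum found so far. -/
theorem extreme_visitor (hdx : 0 ≤ dx) (hd : 0 < dx ∨ dy ≠ 0) :
    Visitor (R 0) (R Y) M K i j h dx dy 0 (directionCmp Y)
      (block [improve Y 40 28 40, improve Y 41 41 28]) (Extreme R Y M K i j h dx dy) 30 125 where
  dx_nonneg := hdx
  ne_zero := hd
  set := by
    intro V s k v hk hk' hJ
    refine ⟨hJ.window.congr rfl fun k hk => ?_, hJ.rmem, hJ.rdx, hJ.rdy, ?_, ?_⟩
    · rw [State.setN_nreg, if_neg (by omega)]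
    · rw [State.setN_nreg, if_neg (by omega)]; exact hJ.left
    · rw [State.setN_nreg, if_neg (by omega)]; exact hJ.right
  window := fun _ _ hJ => hJ.window
  cmp := by
    intro V s hJ hx
    have e : ∀ r, (valExp Y r).eval s = val (R 0) (R Y) dx dy (s.nreg r) := fun r => by
      simp [valExp, val, hJ.rmem, hJ.rdx, hJ.rdy]
    have key : ∀ v, Extreme R Y M K i j h dx dy V (s.setN 27 v) ∧ Same 0 s (s.setN 27 v) := by
      refine fun v => ⟨⟨hJ.window.congr rfl fun k hk => ?_, hJ.rmem, hJ.rdx, hJ.rdy, ?_, ?_⟩, ?_⟩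
      · rw [State.setN_nreg, if_neg (by omega)]
      · rw [State.setN_nreg, if_neg (by omega)]; exact hJ.left
      · rw [State.setN_nreg, if_neg (by omega)]; exact hJ.right
      · intro k _ _ _ _ _
        rw [State.setN_nreg, if_neg (by omega)]
    rw [← val_le_iff hx]
    simp only [directionCmp, wp_cond, wp_setN, Test.holds_rlt, e]
    simp only [Nat.zero_add]
    refine ⟨fun hlt => ⟨by simp [valExp], (key _).1, (key _).2, by simpa using hlt⟩,
      fun hge => ⟨by simp [valExp], (key _).1, (key _).2, by simpa using hge⟩⟩
  visit := by
    intro V s hJ hi hj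
    simp only [wp_block_cons, wp_block_nil]
    simp only [Nat.zero_add] at hi hj ⊢
    refine (improve_spec (σ := -1) hJ.rmem hJ.rdx hJ.rdy rfl rfl (by simp)).mono ?_
    rintro τ₁ _ ⟨c₁, w, rfl, hw, d₁, d₂⟩
    refine (improve_spec (σ := 1) (s := s.setN 40 w) hJ.rmem hJ.rdx hJ.rdy rfl rfl
      (by simp)).mono ?_
    simp only [State.setN_nreg]
    rintro τ₂ _ ⟨c₂, w', rfl, hw', d₁', d₂'⟩
    simp only [show (41 : ℕ) ≠ 40 by omega, show (28 : ℕ) ≠ 40 by omega, if_false] at hw' d₁' d₂'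
    refine ⟨by omega, ⟨hJ.window.congr rfl fun k hk => ?_, hJ.rmem, hJ.rdx, hJ.rdy, ?_, ?_⟩, ?_⟩
    · simp only [State.setN_nreg]
      rw [if_neg (by omega), if_neg (by omega)]
    · simp only [State.setN_nreg, show (40 : ℕ) ≠ 41 by omega, if_false, if_true]
      refine ⟨?_, ?_⟩
      · rcases hw with rfl | rfl
        exacts [hJ.left.1, ⟨hi, hj⟩]
      · rintro v (rfl | hv)
        · exact d₂
        · exact (hJ.left.2 v hv).trans d₁
    · simp only [State.setN_nreg, if_true]
      refine ⟨?_, ?_⟩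
      · rcases hw' with rfl | rfl
        exacts [hJ.right.1, ⟨hi, hj⟩]
      · rintro v (rfl | hv)
        · exact d₂'
        · exact (hJ.right.2 v hv).trans d₁'
    · intro k _ _ _ _ _
      simp only [State.setN_nreg]
      rw [if_neg (by omega), if_neg (by omega)]

theorem extreme_spec {s : State} (hS : Structure (R 0) (R Y) M β K) (hh : h ≤ K) (hij : i ≤ j)
    (hj : j < 2 ^ K) (hw : j + 1 ≤ i + 2 ^ h) (hwin : Window M K i j h s) (hR : s.rmem = R)
    (h2 : s.rreg 2 = dx) (h3 : s.rreg 3 = dy) (hdx : 0 ≤ dx) (hd : 0 < dx ∨ dy ≠ 0) :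
    WP (extreme Y β) s fun τ s' => τ ≤ 3000 * (h + 2) ∧
      Opt (R 0) (R Y) i j dx dy (-1) (s'.nreg 40) ∧ Opt (R 0) (R Y) i j dx dy 1 (s'.nreg 41) := by
  simp only [extreme, wp_block_cons, wp_setN]
  have hJ : Extreme R Y M K i j h dx dy ∅ ((s.setN 40 ((nr 0).eval s)).setN 41
      ((nr 0).eval (s.setN 40 ((nr 0).eval s)))) := by
    refine ⟨hwin.congr rfl fun k hk => ?_, hR, h2, h3, ⟨?_, by simp⟩, ⟨?_, by simp⟩⟩
    · simp only [State.setN_nreg]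
      rw [if_neg (by omega), if_neg (by omega)]
    · simp [hwin.r0, hij]
    · simp [hwin.r0, hij]
  refine ((extreme_visitor hdx hd).descend hS hh hij hj hw hJ).mono ?_
  rintro τ s' ⟨c, V', -, hJ, hcov⟩
  refine wp_block_nil.2 ⟨by simp; omega, ⟨hJ.left.1, fun z hz hz' => ?_⟩,
    ⟨hJ.right.1, fun z hz hz' => ?_⟩⟩
  · obtain ⟨v, hv, hd⟩ := hcov (-1) z hz hz'
    exact hd.trans (hJ.left.2 v hv)
  · obtain ⟨v, hv, hd⟩ := hcov 1 z hz hz'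
    exact hd.trans (hJ.right.2 v hv)

end

/-! ### The edge over a vertical cut -/

/-- The edge with left end `A` and right end `B` crosses the cut between the points in `L` and the
other points, and no point of the window is above it. -/
structure Crossing (x y : ℕ → ℝ) (i j : ℕ) (L : ℕ → Prop) (A B : ℕ) : Prop where
  anti : ∀ a b, x a ≤ x b → L b → L a
  memA : i ≤ A ∧ A ≤ j
  memB : i ≤ B ∧ B ≤ j
  left : L A
  right : ¬ L B
  below : ∀ z, i ≤ z → z ≤ j → val x y (x B - x A) (y B - y A) z ≤
    val x y (x B - x A) (y B - y A) A

section
variable {x y : ℕ → ℝ} {i j : ℕ} {L : ℕ → Prop} {A B : ℕ} {dx dy : ℝ}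

/-- A minimax choice: for each point `a` of `L` take the steepest segment to a point `f a` outside
`L`, then choose `A` so that this slope is least. Only the existence of `A` and `B` is used; the
program never computes this minimum. -/
theorem exists_crossing (anti : ∀ a b, x a ≤ x b → L b → L a)
    (hl : ∃ a, (i ≤ a ∧ a ≤ j) ∧ L a) (hr : ∃ b, (i ≤ b ∧ b ≤ j) ∧ ¬ L b) :
    ∃ A B, Crossing x y i j L A B := by
  classical
  have hlt : ∀ a b, L a → ¬ L b → x a < x b := fun a b ha hb =>
    not_le.1 fun h => hb (anti _ _ h ha)
  obtain ⟨b₀, hb₀, hb₀'⟩ := hr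
  obtain ⟨a₀, ha₀, ha₀'⟩ := hl
  have hmax : ∀ a, ∃ b, ((i ≤ b ∧ b ≤ j) ∧ ¬ L b) ∧
      ∀ z, i ≤ z → z ≤ j → ¬ L z → slope x y a z ≤ slope x y a b := fun a => by
    obtain ⟨b, hb, hmax⟩ := Finset.exists_max_image ((Finset.Icc i j).filter fun b => ¬ L b)
      (slope x y a) ⟨b₀, by simp [hb₀, hb₀']⟩
    simp only [Finset.mem_filter, Finset.mem_Icc] at hb hmax
    exact ⟨b, hb, fun z h₁ h₂ h₃ => hmax z ⟨⟨h₁, h₂⟩, h₃⟩⟩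
  choose f hf hmax using hmax
  obtain ⟨A, hA, hmin⟩ := Finset.exists_min_image ((Finset.Icc i j).filter L)
    (fun a => slope x y a (f a)) ⟨a₀, by simp [ha₀, ha₀']⟩
  simp only [Finset.mem_filter, Finset.mem_Icc] at hA hmin
  refine ⟨A, f A, anti, hA.1, (hf A).1, hA.2, (hf A).2, fun z hz hz' => ?_⟩
  have hAB := hlt A (f A) hA.2 (hf A).2
  have line : ∀ u v, x u < x v → y v - y u = slope x y u v * (x v - x u) := fun u v h =>
    (div_mul_cancel₀ _ (by linarith)).symm
  have right : ∀ z, i ≤ z → z ≤ j → ¬ L z → y z - y A ≤ slope x y A (f A) * (x z - x A) :=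
    fun z h₁ h₂ h₃ => by
      rw [line A z (hlt A z hA.2 h₃)]
      exact mul_le_mul_of_nonneg_right (hmax A z h₁ h₂ h₃) (by linarith [hlt A z hA.2 h₃])
  have below : y z - y A ≤ slope x y A (f A) * (x z - x A) := by
    -- For `z` in `L`, the segment from `z` to `f z` is at least as steep as the chosen one, while
    -- its right end is not above the line; so `z` is not above the line either.
    by_cases hLz : L z
    · have h₁ := right (f z) (hf z).1.1 (hf z).1.2 (hf z).2
      have h₂ := line z (f z) (hlt z _ hLz (hf z).2)
      have h₃ := mul_le_mul_of_nonneg_right (hmin z ⟨⟨hz, hz'⟩, hLz⟩)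
        (show 0 ≤ x (f z) - x z by linarith [hlt z _ hLz (hf z).2])
      nlinarith
    · exact right z hz hz' hLz
  have h₁ := line _ _ hAB
  have h₂ := mul_le_mul_of_nonneg_right below (show 0 ≤ x (f A) - x A by linarith)
  simp only [val]
  rw [h₁]
  nlinarith

theorem Crossing.lt (h : Crossing x y i j L A B) {a b : ℕ} (ha : L a) (hb : ¬ L b) : x a < x b :=
  not_le.1 fun h' => hb (h.anti _ _ h' ha)

theorem Crossing.val_eq (_ : Crossing x y i j L A B) :
    val x y (x B - x A) (y B - y A) B = val x y (x B - x A) (y B - y A) A := by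
  simp only [val]; ring

/-- This decides comparisons with a slope that is not known. If `T` is in `L`, the segment from `T`
to `B` is at least as steep as the edge, because `T` is below it, and at most as steep as the
direction, because `T` is optimal. If `T` is not in `L`, then `A` is strictly worse than `T`, the
tie being excluded by taking `T` leftmost, and so the edge is steeper than the direction. -/
theorem Crossing.left_iff (h : Crossing x y i j L A B) (hdx : 0 < dx) {T : ℕ}
    (hT : Opt x y i j dx dy (-1) T) : L T ↔ (y B - y A) * dx ≤ (x B - x A) * dy := by
  have hAB := h.lt h.left h.right
  have hb := h.below T hT.1.1 hT.1.2
  have he := h.val_eq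
  constructor
  · intro hL
    have hTB := h.lt hL h.right
    have h₁ := (hT.2 B h.memB.1 h.memB.2).val_le
    simp only [val] at *
    have h₂ := mul_le_mul_of_nonneg_left h₁ (show 0 ≤ x B - x A by linarith)
    have h₃ := mul_le_mul_of_nonneg_left hb hdx.le
    have h₄ : (y B - y A) * dx * (x B - x T) ≤ (x B - x A) * dy * (x B - x T) := by nlinarith
    exact le_of_mul_le_mul_right h₄ (by linarith)
  · intro hle
    by_contra hL
    have hAT := h.lt h.left hL
    rcases hT.2 A h.memA.1 h.memA.2 with h₁ | ⟨-, h₁⟩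
    · simp only [val] at *
      have h₂ := mul_lt_mul_of_pos_left h₁ (show 0 < x B - x A by linarith)
      have h₃ := mul_le_mul_of_nonneg_left hb hdx.le
      have h₄ := mul_le_mul_of_nonneg_right hle (show 0 ≤ x T - x A by linarith)
      nlinarith
    · linarith

/-- The mirror image, with the rightmost optimum. For the direction of the edge itself both lemmas
apply and show that the two optima lie on different sides of the cut. -/
theorem Crossing.not_left (h : Crossing x y i j L A B) (hdx : 0 < dx) {T : ℕ}
    (hT : Opt x y i j dx dy 1 T) (hle : (x B - x A) * dy ≤ (y B - y A) * dx) : ¬ L T := by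
  intro hL
  have hAB := h.lt h.left h.right
  have hb := h.below T hT.1.1 hT.1.2
  have hTB := h.lt hL h.right
  rcases hT.2 B h.memB.1 h.memB.2 with h₁ | ⟨-, h₁⟩
  · simp only [val] at *
    have h₂ := mul_lt_mul_of_pos_left h₁ (show 0 < x B - x A by linarith)
    have h₃ := mul_le_mul_of_nonneg_left hb hdx.le
    have h₄ := mul_le_mul_of_nonneg_right hle (show 0 ≤ x B - x T by linarith)
    nlinarith
  · linarith

end

/-- Decides whether the slope of an edge is at least that of the edge over the cut. -/
def bridgeCmp (Y β : ℕ) (cut : ℕ → Test) : Prog := block [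
  .setR 2 (rc 0 (nr 56) - rc 0 (nr 55)), .setR 3 (rc Y (nr 56) - rc Y (nr 55)), extreme Y β,
  .cond (cut 40) (.setN 57 (nl 1)) (.setN 57 (nl 0))]

/-- Replaces the point in `t` by the point in `58` if this is higher in the direction of the edge
over the cut. -/
def bridgeImprove (Y β : ℕ) (cut : ℕ → Test) (t : ℕ) : Prog :=
  .cond (.rlt (rc 0 (nr 58)) (rc 0 (nr t)))
    (block [.setN 55 (nr 58), .setN 56 (nr t), bridgeCmp Y β cut,
      .cond (.nlt (nl 0) (nr 57)) .skip (.setN t (nr 58))])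
    (.cond (.rlt (rc 0 (nr t)) (rc 0 (nr 58)))
      (block [.setN 55 (nr t), .setN 56 (nr 58), bridgeCmp Y β cut,
        .cond (.nlt (nl 0) (nr 57)) (.setN t (nr 58)) .skip])
      (.cond (.rlt (rc Y (nr t)) (rc Y (nr 58))) (.setN t (nr 58)) .skip))

/-- One best point is kept on each side of the cut, because the edge must be recovered from two
points of its line. -/
def bridgeVisit (Y β : ℕ) (cut : ℕ → Test) : Prog :=
  .cond (cut 58) (bridgeImprove Y β cut 70) (bridgeImprove Y β cut 71)

/-- Finds the edge over the cut; the registers `72` and `73` hold points on both sides. -/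
def bridge (Y β : ℕ) (cut : ℕ → Test) : Prog := block [
  .setN 70 (nr 72), .setN 71 (nr 73), descend 30 β (bridgeCmp Y β cut) (bridgeVisit Y β cut),
  .setR 2 (rc 0 (nr 71) - rc 0 (nr 70)), .setR 3 (rc Y (nr 71) - rc Y (nr 70)), extreme Y β]

theorem bridgeCmp_keeps {Y β : ℕ} {cut : ℕ → Test} : (bridgeCmp Y β cut).KeepsRMem ∧
    (∀ b, (bridgeCmp Y β cut).KeepsBank b) ∧
    (∀ r < 2, (bridgeCmp Y β cut).KeepsR r) ∧
    ∀ r, r < 20 ∨ 33 ≤ r → r ≠ 40 → r ≠ 41 → r ≠ 57 → (bridgeCmp Y β cut).KeepsN r := by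
  obtain ⟨k₁, k₂, k₃, k₄⟩ := extreme_keeps (Y := Y) (β := β)
  refine ⟨?_, fun b => ?_, fun r h => ?_, fun r h₁ h₂ h₃ h₄ => ?_⟩
  · simp [bridgeCmp, Prog.KeepsRMem, k₁]
  · simp [bridgeCmp, Prog.KeepsBank, k₂]
  · simp [bridgeCmp, Prog.KeepsR, k₃]; omega
  · simp [bridgeCmp, Prog.KeepsN, k₄ r h₁ h₂ h₃]; omega

theorem bridgeImprove_keeps {Y β : ℕ} {cut : ℕ → Test} {t : ℕ} :
    (bridgeImprove Y β cut t).KeepsRMem ∧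
    (∀ b, (bridgeImprove Y β cut t).KeepsBank b) ∧
    (∀ r < 2, (bridgeImprove Y β cut t).KeepsR r) ∧
    ∀ r, r < 20 ∨ 33 ≤ r → r ≠ 40 → r ≠ 41 → r ≠ 55 → r ≠ 56 → r ≠ 57 → r ≠ t →
      (bridgeImprove Y β cut t).KeepsN r := by
  obtain ⟨k₁, k₂, k₃, k₄⟩ := bridgeCmp_keeps (Y := Y) (β := β) (cut := cut)
  refine ⟨?_, fun b => ?_, fun r h => ?_, fun r h₁ h₂ h₃ h₄ h₅ h₆ h₇ => ?_⟩
  · simp [bridgeImprove, Prog.KeepsRMem, k₁]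
  · simp [bridgeImprove, Prog.KeepsBank, k₂]
  · simp [bridgeImprove, Prog.KeepsR, k₃ r h]
  · simp [bridgeImprove, Prog.KeepsN, k₄ r h₁ h₂ h₃ h₆]; omega

theorem bridge_keeps {Y β : ℕ} {cut : ℕ → Test} : (bridge Y β cut).KeepsRMem ∧
    (∀ b, (bridge Y β cut).KeepsBank b) ∧
    (∀ r < 2, (bridge Y β cut).KeepsR r) ∧
    ∀ r, r < 20 ∨ 72 ≤ r → (bridge Y β cut).KeepsN r := by
  obtain ⟨k₁, k₂, k₃, k₄⟩ := extreme_keeps (Y := Y) (β := β)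
  obtain ⟨l₁, l₂, l₃, l₄⟩ := bridgeCmp_keeps (Y := Y) (β := β) (cut := cut)
  have m := fun t => bridgeImprove_keeps (Y := Y) (β := β) (cut := cut) (t := t)
  refine ⟨?_, fun b => ?_, fun r h => ?_, fun r h => ?_⟩
  · simp [bridge, bridgeVisit, descend, walk, childStep, visitPiece, locate, ask, Prog.KeepsRMem,
      k₁, l₁, (m _).1]
  · simp [bridge, bridgeVisit, descend, walk, childStep, visitPiece, locate, ask, Prog.KeepsBank,
      k₂, l₂, (m _).2.1]
  · simp [bridge, bridgeVisit, descend, walk, childStep, visitPiece, locate, ask, Prog.KeepsR,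
      k₃, l₃ r h, (m _).2.2.1 r h]; omega
  · simp [bridge, bridgeVisit, descend, walk, childStep, visitPiece, locate, ask, Prog.KeepsN,
      k₄ r (by omega) (by omega) (by omega), l₄ r (by omega) (by omega) (by omega) (by omega),
      (m 70).2.2.2 r (by omega) (by omega) (by omega) (by omega) (by omega) (by omega) (by omega),
      (m 71).2.2.2 r (by omega) (by omega) (by omega) (by omega) (by omega) (by omega) (by omega)]
    omega

/-- The conditions under which the registers and the memory describe a window. -/
structure Setting (R : ℕ → ℕ → ℝ) (M : ℕ → ℕ → ℕ) (K i j h : ℕ) (x₀ : ℝ) (s : State) : Prop where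
  window : Window M K i j h s
  rmem : s.rmem = R
  x0 : s.rreg 0 = x₀

theorem Setting.congr {R : ℕ → ℕ → ℝ} {M : ℕ → ℕ → ℕ} {K i j h : ℕ} {x₀ : ℝ} {s s' : State}
    (hs : Setting R M K i j h x₀ s) (h₁ : s'.nmem = s.nmem) (h₂ : ∀ k < 7, s'.nreg k = s.nreg k)
    (h₃ : s'.rmem = s.rmem) (h₄ : s'.rreg 0 = s.rreg 0) : Setting R M K i j h x₀ s' :=
  ⟨hs.window.congr h₁ h₂, h₃.trans hs.rmem, h₄.trans hs.x0⟩

theorem Setting.exec {R : ℕ → ℕ → ℝ} {M : ℕ → ℕ → ℕ} {K i j h : ℕ} {x₀ : ℝ} {s s' : State}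
    {c : Prog} {t : ℕ} (hs : Setting R M K i j h x₀ s) (he : Exec c s t s')
    (h₁ : ∀ b, c.KeepsBank b) (h₂ : ∀ k < 7, c.KeepsN k) (h₃ : c.KeepsRMem) (h₄ : c.KeepsR 0) :
    Setting R M K i j h x₀ s' :=
  hs.congr (funext fun b => he.nmem_eq (h₁ b)) (fun k hk => he.nreg_eq (h₂ k hk))
    (he.rmem_eq h₃) (he.rreg_eq h₄)

/-! ### Parametric search for the edge over a cut -/

section
variable {R : ℕ → ℕ → ℝ} {Y β : ℕ} {M : ℕ → ℕ → ℕ} {K i j h : ℕ} {x₀ : ℝ} {L : ℕ → Prop}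
  {A B : ℕ} {cut : ℕ → Test}

/-- What is known about the window and about the cut. -/
structure BridgeData (R : ℕ → ℕ → ℝ) (Y β : ℕ) (M : ℕ → ℕ → ℕ) (K i j h : ℕ) (x₀ : ℝ)
    (L : ℕ → Prop) (A B : ℕ) (cut : ℕ → Test) : Prop where
  str : Structure (R 0) (R Y) M β K
  hK : h ≤ K
  ij : i ≤ j
  jK : j < 2 ^ K
  width : j + 1 ≤ i + 2 ^ h
  crossing : Crossing (R 0) (R Y) i j L A B
  cut_iff : ∀ r s, s.rmem = R → s.rreg 0 = x₀ → ((cut r).holds s ↔ L (s.nreg r))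
  cost : ∀ r, (cut r).cost ≤ 10

/-- The points `A` and `B` occur in the specification only. The program runs `extreme` in the
direction of the queried edge and applies `Crossing.left_iff`. -/
theorem bridgeCmp_spec (hD : BridgeData R Y β M K i j h x₀ L A B cut) {s : State}
    (hs : Setting R M K i j h x₀ s) (hx : R 0 (s.nreg 55) < R 0 (s.nreg 56)) :
    WP (bridgeCmp Y β cut) s fun τ s' => τ ≤ 3000 * (h + 2) + 40 ∧
      (0 < s'.nreg 57 ↔ R Y B - R Y A ≤ (R 0 B - R 0 A) *
        slope (R 0) (R Y) (s.nreg 55) (s.nreg 56)) := by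
  simp only [bridgeCmp, wp_block_cons, wp_setR]
  generalize hs₁ : State.setR _ 3 _ = s₁
  have hw₁ : Setting R M K i j h x₀ s₁ := by
    refine hs.congr ?_ (fun _ _ => ?_) ?_ ?_ <;> simp [← hs₁]
  have hdx : 0 < R 0 (s.nreg 56) - R 0 (s.nreg 55) := by linarith
  refine (extreme_spec hD.str hD.hK hD.ij hD.jK hD.width hw₁.window hw₁.rmem
    (dx := R 0 (s.nreg 56) - R 0 (s.nreg 55)) (dy := R Y (s.nreg 56) - R Y (s.nreg 55))
    (by simp [← hs₁, hs.rmem]) (by simp [← hs₁, hs.rmem]) hdx.le (.inl hdx)).and_exec.mono ?_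
  rintro τ₂ s₂ ⟨⟨c₂, hT, -⟩, x₂⟩
  obtain ⟨k₁, k₂, k₃, k₄⟩ := extreme_keeps (Y := Y) (β := β)
  have hw₂ := hw₁.exec x₂ k₂ (fun k hk => k₄ k (by omega) (by omega) (by omega)) k₁ (k₃ 0)
  have hc := hD.cost 40
  have hiff : L (s₂.nreg 40) ↔ R Y B - R Y A ≤ (R 0 B - R 0 A) *
      slope (R 0) (R Y) (s.nreg 55) (s.nreg 56) := by
    rw [hD.crossing.left_iff hdx hT, slope, ← mul_div_assoc, le_div_iff₀ hdx]
  simp only [wp_cond, wp_setN, wp_block_nil, hD.cut_iff 40 s₂ hw₂.rmem hw₂.x0, hiff]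
  exact ⟨fun h => ⟨by simp; omega, by simpa using h⟩, fun h => ⟨by simp; omega, by simpa using h⟩⟩

/-- Which of two points is higher in the unknown direction is again the question how steep the
segment between them is. Points of equal abscissa are compared by ordinate, as `dx > 0`. -/
theorem bridgeImprove_spec (hD : BridgeData R Y β M K i j h x₀ L A B cut) {s : State} {t : ℕ}
    (ht : 70 ≤ t) (hs : Setting R M K i j h x₀ s) {u v : ℕ} (hu : s.nreg t = u)
    (hv : s.nreg 58 = v) :
    WP (bridgeImprove Y β cut t) s fun τ s' => τ ≤ 3000 * (h + 2) + 80 ∧ ∃ w, s'.nreg t = w ∧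
      (w = u ∨ w = v) ∧
      val (R 0) (R Y) (R 0 B - R 0 A) (R Y B - R Y A) u ≤
        val (R 0) (R Y) (R 0 B - R 0 A) (R Y B - R Y A) w ∧
      val (R 0) (R Y) (R 0 B - R 0 A) (R Y B - R Y A) v ≤
        val (R 0) (R Y) (R 0 B - R 0 A) (R Y B - R Y A) w := by
  obtain ⟨k₁, k₂, k₃, k₄⟩ := bridgeCmp_keeps (Y := Y) (β := β) (cut := cut)
  have hAB := hD.crossing.lt hD.crossing.left hD.crossing.right
  have ht58 : t ≠ 58 := by omega
  have ask : ∀ a b, R 0 a < R 0 b → WP (bridgeCmp Y β cut) ((s.setN 55 a).setN 56 b)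
      fun τ s' => τ ≤ 3000 * (h + 2) + 40 ∧ s'.nreg t = u ∧ s'.nreg 58 = v ∧
        (0 < s'.nreg 57 ↔ val (R 0) (R Y) (R 0 B - R 0 A) (R Y B - R Y A) a ≤
          val (R 0) (R Y) (R 0 B - R 0 A) (R Y B - R Y A) b) := by
    intro a b hab
    have hs' : Setting R M K i j h x₀ ((s.setN 55 a).setN 56 b) := by
      refine hs.congr rfl (fun k hk => ?_) rfl rfl
      simp only [State.setN_nreg]
      rw [if_neg (by omega), if_neg (by omega)]
    refine (bridgeCmp_spec hD hs' (by simpa using hab)).and_exec.mono ?_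
    rintro τ s' ⟨⟨c, hiff⟩, x'⟩
    have e := fun r h₁ h₂ h₃ h₄ => x'.nreg_eq (k₄ r h₁ h₂ h₃ h₄)
    refine ⟨c, ?_, ?_, ?_⟩
    · rw [e t (by omega) (by omega) (by omega) (by omega)]
      simp only [State.setN_nreg]
      rw [if_neg (by omega), if_neg (by omega), hu]
    · rw [e 58 (by omega) (by omega) (by omega) (by omega)]
      simp [hv]
    · rw [hiff, val_le_iff hab]
      simp
  simp only [bridgeImprove, wp_cond, wp_block_cons, wp_block_nil, wp_setN, wp_skip,
    Test.holds_rlt, RExp.eval_cell, NExp.eval_reg, hs.rmem, hu, hv, State.setN_nreg]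
  rw [if_neg (show t ≠ 55 by omega), if_neg (show (58 : ℕ) ≠ 55 by omega)]
  refine ⟨fun hlt => ?_, fun hge => ⟨fun hlt => ?_, fun hge' => ?_⟩⟩
  · refine (ask _ _ hlt).mono ?_
    rintro τ s' ⟨c, e₁, e₂, hiff⟩
    simp only [Test.holds_nlt, NExp.eval_lit, NExp.eval_reg, hiff, e₁, e₂]
    refine ⟨fun hle => ⟨?_, u, rfl, .inl rfl, le_rfl, hle⟩,
      fun hle => ⟨?_, v, by simp, .inr rfl, (not_le.1 hle).le, le_rfl⟩⟩
    · simp; omega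
    · simp; omega
  · refine (ask _ _ hlt).mono ?_
    rintro τ s' ⟨c, e₁, e₂, hiff⟩
    simp only [Test.holds_nlt, NExp.eval_lit, NExp.eval_reg, hiff, e₁, e₂]
    refine ⟨fun hle => ⟨?_, v, by simp, .inr rfl, hle, le_rfl⟩,
      fun hle => ⟨?_, u, rfl, .inl rfl, le_rfl, (not_le.1 hle).le⟩⟩
    · simp; omega
    · simp; omega
  · have hxe : R 0 u = R 0 v := le_antisymm (not_lt.1 hge) (not_lt.1 hge')
    have hval : ∀ a b, R 0 a = R 0 b → R Y a ≤ R Y b →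
        val (R 0) (R Y) (R 0 B - R 0 A) (R Y B - R Y A) a ≤
          val (R 0) (R Y) (R 0 B - R 0 A) (R Y B - R Y A) b := fun a b h₁ h₂ =>
      (dom_of_same_abscissa (σ := 0) (by linarith) h₁ h₂).val_le
    refine ⟨fun hlt => ⟨by simp, v, by simp, .inr rfl, hval _ _ hxe hlt.le, le_rfl⟩,
      fun hle => ⟨by simp, u, rfl, .inl rfl, le_rfl, hval _ _ hxe.symm (not_lt.1 hle)⟩⟩

/-- State of the search for the edge over the cut. -/
structure BridgeState (R : ℕ → ℕ → ℝ) (Y : ℕ) (M : ℕ → ℕ → ℕ) (K i j h : ℕ) (x₀ : ℝ)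
    (L : ℕ → Prop) (dx dy : ℝ) (V : Set ℕ) (s : State) : Prop where
  setting : Setting R M K i j h x₀ s
  mem : ∀ v ∈ V, i ≤ v ∧ v ≤ j
  left : (i ≤ s.nreg 70 ∧ s.nreg 70 ≤ j) ∧ L (s.nreg 70) ∧
    ∀ v ∈ V, L v → val (R 0) (R Y) dx dy v ≤ val (R 0) (R Y) dx dy (s.nreg 70)
  right : (i ≤ s.nreg 71 ∧ s.nreg 71 ≤ j) ∧ ¬ L (s.nreg 71) ∧
    ∀ v ∈ V, ¬ L v → val (R 0) (R Y) dx dy v ≤ val (R 0) (R Y) dx dy (s.nreg 71)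

/-- The outer descent works with offset `30` and the `extreme` nested in its comparisons with offset
`0`, so their registers are disjoint. One comparison or visit costs `O(h)`, whence the square in the
final bound. -/
theorem bridge_visitor (hD : BridgeData R Y β M K i j h x₀ L A B cut) :
    Visitor (R 0) (R Y) M K i j h (R 0 B - R 0 A) (R Y B - R Y A) 30 (bridgeCmp Y β cut)
      (bridgeVisit Y β cut) (BridgeState R Y M K i j h x₀ L (R 0 B - R 0 A) (R Y B - R Y A))
      (3000 * (h + 2) + 40) (3000 * (h + 2) + 100) where
  dx_nonneg := by linarith [hD.crossing.lt hD.crossing.left hD.crossing.right]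
  ne_zero := .inl (by linarith [hD.crossing.lt hD.crossing.left hD.crossing.right])
  set := by
    intro V s k v hk hk' hJ
    refine ⟨hJ.setting.congr rfl (fun k hk => ?_) rfl rfl, hJ.mem, ?_, ?_⟩
    · rw [State.setN_nreg, if_neg (by omega)]
    · rw [State.setN_nreg, if_neg (by omega)]; exact hJ.left
    · rw [State.setN_nreg, if_neg (by omega)]; exact hJ.right
  window := fun _ _ hJ => hJ.setting.window
  cmp := by
    intro V s hJ hx
    obtain ⟨k₁, k₂, k₃, k₄⟩ := bridgeCmp_keeps (Y := Y) (β := β) (cut := cut)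
    refine (bridgeCmp_spec hD hJ.setting hx).and_exec.mono ?_
    rintro τ s' ⟨⟨c, hiff⟩, x'⟩
    have e := fun r h₁ h₂ h₃ h₄ => x'.nreg_eq (k₄ r h₁ h₂ h₃ h₄)
    refine ⟨c, ⟨hJ.setting.exec x' k₂ (fun k hk => k₄ k (by omega) (by omega) (by omega)
      (by omega)) k₁ (k₃ 0 (by omega)), hJ.mem, ?_, ?_⟩, fun k h₁ h₂ h₃ h₄ h₅ => ?_, hiff⟩
    · rw [e 70 (by omega) (by omega) (by omega) (by omega)]; exact hJ.left
    · rw [e 71 (by omega) (by omega) (by omega) (by omega)]; exact hJ.right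
    · exact e _ (by omega) (by omega) (by omega) (by omega)
  visit := by
    intro V s hJ hi hj
    have hc := hD.cost 58
    have k := fun t => bridgeImprove_keeps (Y := Y) (β := β) (cut := cut) (t := t)
    simp only [bridgeVisit, wp_cond, hD.cut_iff 58 s hJ.setting.rmem hJ.setting.x0]
    refine ⟨fun hL => ?_, fun hL => ?_⟩
    · refine (bridgeImprove_spec (t := 70) hD (by omega) hJ.setting rfl rfl).and_exec.mono ?_
      rintro τ s' ⟨⟨c, w, hw, hor, h₁, h₂⟩, x'⟩
      have e := fun r h₁ h₂ h₃ h₄ h₅ h₆ h₇ => x'.nreg_eq ((k 70).2.2.2 r h₁ h₂ h₃ h₄ h₅ h₆ h₇)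
      refine ⟨by omega, ⟨hJ.setting.exec x' (k 70).2.1 (fun k' hk => (k 70).2.2.2 k' (by omega)
        (by omega) (by omega) (by omega) (by omega) (by omega) (by omega)) (k 70).1
        ((k 70).2.2.1 0 (by omega)), Set.forall_mem_insert.2 ⟨⟨hi, hj⟩, hJ.mem⟩, ?_, ?_⟩, fun k h₁ h₂ h₃ h₄ h₅ => ?_⟩
      · rw [hw]
        refine ⟨?_, ?_, ?_⟩
        · rcases hor with rfl | rfl
          exacts [hJ.left.1, ⟨hi, hj⟩]
        · rcases hor with rfl | rfl
          exacts [hJ.left.2.1, hL]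
        · rintro v (rfl | hv) hv'
          · exact h₂
          · exact (hJ.left.2.2 v hv hv').trans h₁
      · rw [e 71 (by omega) (by omega) (by omega) (by omega) (by omega) (by omega) (by omega)]
        refine ⟨hJ.right.1, hJ.right.2.1, ?_⟩
        rintro v (rfl | hv) hv'
        · exact absurd hL hv'
        · exact hJ.right.2.2 v hv hv'
      · exact e _ (by omega) (by omega) (by omega) (by omega) (by omega) (by omega) (by omega)
    · refine (bridgeImprove_spec (t := 71) hD (by omega) hJ.setting rfl rfl).and_exec.mono ?_
      rintro τ s' ⟨⟨c, w, hw, hor, h₁, h₂⟩, x'⟩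
      have e := fun r h₁ h₂ h₃ h₄ h₅ h₆ h₇ => x'.nreg_eq ((k 71).2.2.2 r h₁ h₂ h₃ h₄ h₅ h₆ h₇)
      refine ⟨by omega, ⟨hJ.setting.exec x' (k 71).2.1 (fun k' hk => (k 71).2.2.2 k' (by omega)
        (by omega) (by omega) (by omega) (by omega) (by omega) (by omega)) (k 71).1
        ((k 71).2.2.1 0 (by omega)), Set.forall_mem_insert.2 ⟨⟨hi, hj⟩, hJ.mem⟩, ?_, ?_⟩, fun k h₁ h₂ h₃ h₄ h₅ => ?_⟩
      · rw [e 70 (by omega) (by omega) (by omega) (by omega) (by omega) (by omega) (by omega)]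
        refine ⟨hJ.left.1, hJ.left.2.1, ?_⟩
        rintro v (rfl | hv) hv'
        · exact absurd hv' hL
        · exact hJ.left.2.2 v hv hv'
      · rw [hw]
        refine ⟨?_, ?_, ?_⟩
        · rcases hor with rfl | rfl
          exacts [hJ.right.1, ⟨hi, hj⟩]
        · rcases hor with rfl | rfl
          exacts [hJ.right.2.1, hL]
        · rintro v (rfl | hv) hv'
          · exact h₂
          · exact (hJ.right.2.2 v hv hv').trans h₁
      · exact e _ (by omega) (by omega) (by omega) (by omega) (by omega) (by omega) (by omega)

theorem bridge_spec (hD : BridgeData R Y β M K i j h x₀ L A B cut) {s : State}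
    (hs : Setting R M K i j h x₀ s) (h72 : i ≤ s.nreg 72 ∧ s.nreg 72 ≤ j) (hL : L (s.nreg 72))
    (h73 : i ≤ s.nreg 73 ∧ s.nreg 73 ≤ j) (hL' : ¬ L (s.nreg 73)) :
    WP (bridge Y β cut) s fun τ s' => τ ≤ 70000 * (h + 2) ^ 2 ∧ ∃ dx dy, 0 < dx ∧
      Opt (R 0) (R Y) i j dx dy (-1) (s'.nreg 40) ∧ Opt (R 0) (R Y) i j dx dy 1 (s'.nreg 41) ∧
      L (s'.nreg 40) ∧ ¬ L (s'.nreg 41) := by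
  have hC := hD.crossing
  have hAB := hC.lt hC.left hC.right
  simp only [bridge, wp_block_cons, wp_setN]
  have hJ : BridgeState R Y M K i j h x₀ L (R 0 B - R 0 A) (R Y B - R Y A) ∅
      ((s.setN 70 ((nr 72).eval s)).setN 71 ((nr 73).eval (s.setN 70 ((nr 72).eval s)))) := by
    refine ⟨hs.congr rfl (fun k hk => ?_) rfl rfl, by simp, ?_, ?_⟩
    · simp only [State.setN_nreg]
      rw [if_neg (by omega), if_neg (by omega)]
    · simpa using ⟨h72, hL⟩
    · simpa using ⟨h73, hL'⟩
  refine ((bridge_visitor hD).descend hD.str hD.hK hD.ij hD.jK hD.width hJ).mono ?_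
  rintro τ₁ s₁ ⟨c₁, V, -, hJ₁, hcov⟩
  -- Some visited `v` dominates `A` with ties going to the left. If `v` is not in `L`, it would have
  -- to lie above the edge, or tie with `A` without being to its right; both are impossible. For `B`
  -- the same is done with ties going to the right.
  have hleft : val (R 0) (R Y) (R 0 B - R 0 A) (R Y B - R Y A) A ≤
      val (R 0) (R Y) (R 0 B - R 0 A) (R Y B - R Y A) (s₁.nreg 70) := by
    obtain ⟨v, hv, hd⟩ := hcov (-1) A hC.memA.1 hC.memA.2
    by_cases hLv : L v
    · exact hd.val_le.trans (hJ₁.left.2.2 v hv hLv)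
    · rcases hd with hd | ⟨-, hd⟩
      · exact absurd (hC.below v (hJ₁.mem v hv).1 (hJ₁.mem v hv).2) (not_le.2 hd)
      · exact absurd (hC.anti v A (by linarith) hC.left) hLv
  have hright : val (R 0) (R Y) (R 0 B - R 0 A) (R Y B - R Y A) B ≤
      val (R 0) (R Y) (R 0 B - R 0 A) (R Y B - R Y A) (s₁.nreg 71) := by
    obtain ⟨v, hv, hd⟩ := hcov 1 B hC.memB.1 hC.memB.2
    by_cases hLv : L v
    · rcases hd with hd | ⟨-, hd⟩
      · exact absurd (hC.below v (hJ₁.mem v hv).1 (hJ₁.mem v hv).2)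
          (not_le.2 (hC.val_eq ▸ hd))
      · exact absurd (hC.anti B v (by linarith) hLv) hC.right
    · exact hd.val_le.trans (hJ₁.right.2.2 v hv hLv)
  have h01 := hC.lt hJ₁.left.2.1 hJ₁.right.2.1
  have hb₀ := hC.below _ hJ₁.left.1.1 hJ₁.left.1.2
  have hb₁ := hC.below _ hJ₁.right.1.1 hJ₁.right.1.2
  have he := hC.val_eq
  obtain ⟨k₁, k₂, k₃, k₄⟩ := extreme_keeps (Y := Y) (β := β)
  simp only [wp_setR]
  generalize hs₂ : State.setR _ 3 _ = s₂
  have hw₂ : Setting R M K i j h x₀ s₂ := by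
    refine hJ₁.setting.congr ?_ (fun _ _ => ?_) ?_ ?_ <;> simp [← hs₂]
  have hdx : 0 < R 0 (s₁.nreg 71) - R 0 (s₁.nreg 70) := by linarith
  refine (extreme_spec hD.str hD.hK hD.ij hD.jK hD.width hw₂.window hw₂.rmem
    (dx := R 0 (s₁.nreg 71) - R 0 (s₁.nreg 70)) (dy := R Y (s₁.nreg 71) - R Y (s₁.nreg 70))
    (by simp [← hs₂, hJ₁.setting.rmem]) (by simp [← hs₂, hJ₁.setting.rmem]) hdx.le
    (.inl hdx)).mono ?_
  rintro τ₂ s₃ ⟨c₃, hT, hT'⟩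
  -- Both points kept reach the value of the edge, so their difference has its direction. The last
  -- search therefore runs in the true direction, now known.
  have hslope : (R 0 B - R 0 A) * (R Y (s₁.nreg 71) - R Y (s₁.nreg 70)) =
      (R Y B - R Y A) * (R 0 (s₁.nreg 71) - R 0 (s₁.nreg 70)) := by
    simp only [val] at *
    linarith
  refine wp_block_nil.2 ⟨?_, _, _, hdx, hT, hT', (hC.left_iff hdx hT).2 hslope.ge,
    hC.not_left hdx hT' hslope.le⟩
  have e : 10 * (3000 * (h + 2) + 40 + (3000 * (h + 2) + 100) + 110) * (h + 2) =
    60000 * (h + 2) ^ 2 + 2500 * (h + 2) := by ring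
  rw [e] at c₁
  have e' : (h + 2) ≤ (h + 2) ^ 2 := Nat.le_self_pow two_ne_zero _
  simp
  omega

end

/-! ### Locating the vertical line -/

/-- Computes the least power of two that is at least the number of points of the window, and the
position of the two blocks of this length that cover the window. -/
def prelude : Prog := block [
  .setN 2 (nc 16 (nl 0)), .setN 7 (nr 1 + nl 1 - nr 0), .setN 3 (nl 1), .setN 4 (nr 0),
  .setN 5 (nr 1), .setN 6 (nl 0), .setN 8 (nl 0),
  .loop (.nlt (nr 3) (nr 7)) (block [.setN 3 (nr 3 + nr 3), .setN 4 (.half (nr 4)),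
    .setN 5 (.half (nr 5)), .setN 6 (nr 6 + nr 2), .setN 8 (nr 8 + nl 1)]),
  .loop (.nlt (nl 0) (nr 8)) (block [.setN 4 (nr 4 + nr 4), .setN 5 (nr 5 + nr 5),
    .setN 8 (nr 8 - nl 1)])]

/-- There is no shift by a variable amount: the starts of the blocks are found by halving `h` times
and doubling `h` times. As `h` depends on the length of the window, not on `n`, so does the running
time. -/
theorem prelude_spec {s : State} {K i j : ℕ} (h16 : s.nmem 16 0 = 2 * 2 ^ K) (hi : s.nreg 0 = i)
    (hj : s.nreg 1 = j) (hij : i ≤ j) (hjK : j < 2 ^ K) :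
    WP prelude s fun τ s' => τ ≤ 100 * (1 + Nat.log 2 (j - i + 1)) ∧
      ∃ h, Window s.nmem K i j h s' ∧ h ≤ K ∧ j + 1 ≤ i + 2 ^ h ∧
        h ≤ 1 + Nat.log 2 (j - i + 1) := by
  simp only [prelude, wp_block_cons, wp_setN]
  generalize hs₁ : State.setN _ 8 _ = s₁
  set w := j - i + 1 with hw
  have hwK : w ≤ 2 ^ K := by omega
  refine (WP.loop (fun s' => s'.nmem = s.nmem ∧ s'.nreg 0 = i ∧ s'.nreg 1 = j ∧
    s'.nreg 2 = 2 * 2 ^ K ∧ s'.nreg 7 = w ∧ ∃ h, h ≤ K ∧ h ≤ 1 + Nat.log 2 w ∧ s'.nreg 3 = 2 ^ h ∧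
      s'.nreg 4 = i / 2 ^ h ∧ s'.nreg 5 = j / 2 ^ h ∧ s'.nreg 6 = h * (2 * 2 ^ K) ∧
      s'.nreg 8 = h) (fun s' => 30 * (1 + Nat.log 2 w - s'.nreg 8)) ?_ ?_).mono ?_
  · rintro s ⟨m, e0, e1, e2, e7, h, hK, hl, e3, e4, e5, e6, e8⟩ ht
    simp [e3, e7] at ht
    have h₁ : h ≤ Nat.log 2 w := Nat.le_log_of_pow_le (by omega) ht.le
    have h₂ : h < K := (Nat.pow_lt_pow_iff_right (by omega)).1 (ht.trans_le hwK)
    simp only [wp_block_cons, wp_setN, wp_block_nil]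
    refine ⟨⟨m, by simp [e0], by simp [e1], by simp [e2], by simp [e7], h + 1, h₂, by omega,
      ?_, ?_, ?_, ?_, by simp [e8]⟩, ?_, ?_⟩
    · simp [e3, pow_succ]; omega
    · simp [e4, Nat.div_div_eq_div_mul, pow_succ]
    · simp [e5, Nat.div_div_eq_div_mul, pow_succ]
    · simp [e6, e2, add_mul]
    · simp [e8]; omega
    · simp [e8]; omega
  · refine ⟨by simp [← hs₁], by simp [← hs₁, hi], by simp [← hs₁, hj], by simp [← hs₁, h16], ?_,
      0, by omega, by omega, by simp [← hs₁], by simp [← hs₁, hi], by simp [← hs₁, hj],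
      by simp [← hs₁], by simp [← hs₁]⟩
    simp [← hs₁, hi, hj]; omega
  rintro τ₂ s₂ ⟨⟨⟨m, e0, e1, e2, e7, h, hK, hl, e3, e4, e5, e6, e8⟩, ht⟩, c₂⟩
  simp [e3, e7] at ht
  refine (WP.loop (fun s' => s'.nmem = s.nmem ∧ s'.nreg 0 = i ∧ s'.nreg 1 = j ∧
    s'.nreg 2 = 2 * 2 ^ K ∧ s'.nreg 3 = 2 ^ h ∧ s'.nreg 6 = h * (2 * 2 ^ K) ∧
    ∃ l ≤ h, s'.nreg 8 = h - l ∧ s'.nreg 4 = i / 2 ^ h * 2 ^ l ∧ s'.nreg 5 = j / 2 ^ h * 2 ^ l)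
    (fun s' => 20 * s'.nreg 8) ?_ ?_).mono ?_
  · rintro s ⟨m, e0, e1, e2, e3, e6, l, hl, e8, e4, e5⟩ ht
    simp [e8] at ht
    simp only [wp_block_cons, wp_setN, wp_block_nil]
    refine ⟨⟨m, by simp [e0], by simp [e1], by simp [e2], by simp [e3], by simp [e6], l + 1,
      by omega, by simp [e8]; omega, ?_, ?_⟩, ?_, ?_⟩
    · simp [e4, pow_succ]; ring
    · simp [e5, pow_succ]; ring
    · simp [e8]; omega
    · simp [e8]; omega
  · exact ⟨m, e0, e1, e2, e3, e6, 0, by omega, by simp [e8], by simp [e4], by simp [e5]⟩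
  rintro τ₃ s₃ ⟨⟨⟨m, e0, e1, e2, e3, e6, l, hl', e8', e4, e5⟩, ht'⟩, c₃⟩
  simp [e8'] at ht'
  obtain rfl : h = l := by omega
  refine wp_block_nil.2 ⟨?_, h, ⟨m, e0, e1, e2, e3, e4, e5, e6⟩, hK, by omega, by omega⟩
  have c₁ : s₁.nreg 8 = 0 := by simp [← hs₁]
  clear hs₁
  simp [c₁, e8] at c₂ c₃ ⊢
  omega

/-- Finds the extreme points in a given direction. -/
def toward (dx dy : RExp) (Y β : ℕ) : Prog := block [.setR 2 dx, .setR 3 dy, extreme Y β]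

/-- Finds the edges over a cut of the upper and of the lower hull. -/
def bridges (cut : ℕ → Test) : Prog := block [
  .setN 84 (nl 1), bridge 1 0 cut, .setN 80 (nr 40), .setN 81 (nr 41),
  bridge 2 8 cut, .setN 82 (nr 40), .setN 83 (nr 41)]

/-- Finds the highest and the lowest point. -/
def column : Prog := block [
  .setN 84 (nl 2), toward (rl 1) (rl 0) 1 0, .setN 80 (nr 40),
  toward (rl 1) (rl 0) 2 8, .setN 82 (nr 40)]

/-- Locates the vertical line with abscissa in the real register `0`. -/
def core : Prog := block [prelude,
  toward (rl 0) (rl 1) 1 0, .setN 72 (nr 40),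
  toward (rl 0) (rl 0 - rl 1) 1 0, .setN 73 (nr 40), .setN 84 (nl 0),
  .cond (.rlt (rr 0) (rc 0 (nr 72))) .skip (.cond (.rlt (rc 0 (nr 73)) (rr 0)) .skip
    (.cond (.rlt (rc 0 (nr 72)) (rc 0 (nr 73)))
      (.cond (.rlt (rc 0 (nr 72)) (rr 0)) (bridges fun r => .rlt (rc 0 (nr r)) (rr 0))
        (bridges fun r => .neg (.rlt (rr 0) (rc 0 (nr r)))))
      column))]

theorem toward_keeps {dx dy : RExp} {Y β : ℕ} : (toward dx dy Y β).KeepsRMem ∧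
    (∀ b, (toward dx dy Y β).KeepsBank b) ∧ (∀ r < 2, (toward dx dy Y β).KeepsR r) ∧
    ∀ r, r < 20 ∨ 42 ≤ r → (toward dx dy Y β).KeepsN r := by
  obtain ⟨k₁, k₂, k₃, k₄⟩ := extreme_keeps (Y := Y) (β := β)
  refine ⟨?_, fun b => ?_, fun r h => ?_, fun r h => ?_⟩
  · simp [toward, Prog.KeepsRMem, k₁]
  · simp [toward, Prog.KeepsBank, k₂]
  · simp [toward, Prog.KeepsR, k₃]; omega
  · simp [toward, Prog.KeepsN, k₄ r (by omega) (by omega) (by omega)]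

theorem core_keeps : core.KeepsRMem ∧ (∀ b, core.KeepsBank b) ∧ ∀ r < 2, core.KeepsR r := by
  have t := fun dx dy Y β => toward_keeps (dx := dx) (dy := dy) (Y := Y) (β := β)
  have b := fun Y β cut => bridge_keeps (Y := Y) (β := β) (cut := cut)
  refine ⟨?_, fun k => ?_, fun r h => ?_⟩
  · simp [core, prelude, bridges, column, Prog.KeepsRMem, (t _ _ _ _).1, (b _ _ _).1]
  · simp [core, prelude, bridges, column, Prog.KeepsBank, (t _ _ _ _).2.1, (b _ _ _).2.1]
  · simp [core, prelude, bridges, column, Prog.KeepsR, (t _ _ _ _).2.2.1 r h,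
      (b _ _ _).2.2.1 r h]

/-- No point of the window is above the edge from `a` to `b`, which meets the vertical line at
`x₀` and cannot be prolonged. -/
def UpperEdge (x y : ℕ → ℝ) (i j : ℕ) (x₀ : ℝ) (a b : ℕ) : Prop :=
  x a ≤ x₀ ∧ x₀ ≤ x b ∧ x a < x b ∧
    ∃ dx dy, 0 < dx ∧ Opt x y i j dx dy (-1) a ∧ Opt x y i j dx dy 1 b

/-- The result of `core`. -/
structure Located (R : ℕ → ℕ → ℝ) (i j : ℕ) (x₀ : ℝ) (s : State) : Prop where
  mem_left : i ≤ s.nreg 72 ∧ s.nreg 72 ≤ j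
  mem_right : i ≤ s.nreg 73 ∧ s.nreg 73 ≤ j
  bounds : ∀ z, i ≤ z → z ≤ j → R 0 (s.nreg 72) ≤ R 0 z ∧ R 0 z ≤ R 0 (s.nreg 73)
  cases : (s.nreg 84 = 0 ∧ (x₀ < R 0 (s.nreg 72) ∨ R 0 (s.nreg 73) < x₀)) ∨
    (s.nreg 84 = 1 ∧ UpperEdge (R 0) (R 1) i j x₀ (s.nreg 80) (s.nreg 81) ∧
      UpperEdge (R 0) (R 2) i j x₀ (s.nreg 82) (s.nreg 83)) ∨
    (s.nreg 84 = 2 ∧ R 0 (s.nreg 72) = x₀ ∧ R 0 (s.nreg 73) = x₀ ∧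
      ((i ≤ s.nreg 80 ∧ s.nreg 80 ≤ j) ∧ ∀ z, i ≤ z → z ≤ j → R 1 z ≤ R 1 (s.nreg 80)) ∧
      ((i ≤ s.nreg 82 ∧ s.nreg 82 ≤ j) ∧ ∀ z, i ≤ z → z ≤ j → R 2 z ≤ R 2 (s.nreg 82)))

/-- What is known about the window. -/
structure WindowData (R : ℕ → ℕ → ℝ) (M : ℕ → ℕ → ℕ) (K i j h : ℕ) : Prop where
  upper : Structure (R 0) (R 1) M 0 K
  lower : Structure (R 0) (R 2) M 8 K
  hK : h ≤ K
  ij : i ≤ j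
  jK : j < 2 ^ K
  width : j + 1 ≤ i + 2 ^ h

section
variable {R : ℕ → ℕ → ℝ} {Y β : ℕ} {M : ℕ → ℕ → ℕ} {K i j h : ℕ} {x₀ : ℝ}

theorem toward_spec (hD : WindowData R M K i j h) (hS : Structure (R 0) (R Y) M β K) {s : State}
    (hs : Setting R M K i j h x₀ s) {e f : RExp} {dx dy : ℝ} (hec : e.cost ≤ 3) (hfc : f.cost ≤ 3)
    (he : e.eval s = dx) (hf : f.eval (s.setR 2 dx) = dy) (hdx : 0 ≤ dx) (hd : 0 < dx ∨ dy ≠ 0) :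
    WP (toward e f Y β) s fun τ s' => τ ≤ 3000 * (h + 2) + 10 ∧
      Opt (R 0) (R Y) i j dx dy (-1) (s'.nreg 40) ∧ Opt (R 0) (R Y) i j dx dy 1 (s'.nreg 41) ∧
      Setting R M K i j h x₀ s' ∧ ∀ r ≥ 70, s'.nreg r = s.nreg r := by
  have hk := toward_keeps (dx := e) (dy := f) (Y := Y) (β := β)
  have key : WP (toward e f Y β) s fun τ s' => τ ≤ 3000 * (h + 2) + 10 ∧
      Opt (R 0) (R Y) i j dx dy (-1) (s'.nreg 40) ∧
      Opt (R 0) (R Y) i j dx dy 1 (s'.nreg 41) := by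
    simp only [toward, wp_block_cons, wp_setR, he, hf]
    have hw : Setting R M K i j h x₀ ((s.setR 2 dx).setR 3 dy) :=
      hs.congr rfl (fun _ _ => rfl) rfl (by simp)
    refine (extreme_spec hS hD.hK hD.ij hD.jK hD.width hw.window hw.rmem (dx := dx) (dy := dy)
      (by simp) (by simp) hdx hd).mono ?_
    rintro τ s' ⟨c, h₁, h₂⟩
    exact wp_block_nil.2 ⟨by omega, h₁, h₂⟩
  refine key.and_exec.mono ?_
  rintro τ s' ⟨⟨c, h₁, h₂⟩, x'⟩
  exact ⟨c, h₁, h₂, hs.exec x' hk.2.1 (fun k hk' => hk.2.2.2 k (by omega)) hk.1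
    (hk.2.2.1 0 (by omega)), fun r hr => x'.nreg_eq (hk.2.2.2 r (by omega))⟩

/-- Stated for an abstract cut `L`, because the line at `x₀` itself is put on one side or the other
in the two applications. -/
theorem bridges_spec (hD : WindowData R M K i j h) {s : State} (hs : Setting R M K i j h x₀ s)
    {L : ℕ → Prop} {cut : ℕ → Test} (anti : ∀ a b, R 0 a ≤ R 0 b → L b → L a)
    (hcut : ∀ r s, s.rmem = R → s.rreg 0 = x₀ → ((cut r).holds s ↔ L (s.nreg r)))
    (hcost : ∀ r, (cut r).cost ≤ 10) (h₁ : ∀ a, L a → R 0 a ≤ x₀) (h₂ : ∀ a, ¬ L a → x₀ ≤ R 0 a)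
    (h72 : i ≤ s.nreg 72 ∧ s.nreg 72 ≤ j) (hL : L (s.nreg 72))
    (h73 : i ≤ s.nreg 73 ∧ s.nreg 73 ≤ j) (hL' : ¬ L (s.nreg 73)) :
    WP (bridges cut) s fun τ s' => τ ≤ 140020 * (h + 2) ^ 2 ∧ s'.nreg 84 = 1 ∧
      s'.nreg 72 = s.nreg 72 ∧ s'.nreg 73 = s.nreg 73 ∧
      UpperEdge (R 0) (R 1) i j x₀ (s'.nreg 80) (s'.nreg 81) ∧
      UpperEdge (R 0) (R 2) i j x₀ (s'.nreg 82) (s'.nreg 83) := by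
  have hlt : ∀ a b, L a → ¬ L b → R 0 a < R 0 b := fun a b ha hb =>
    not_le.1 fun h => hb (anti _ _ h ha)
  have data : ∀ {Y β : ℕ}, Structure (R 0) (R Y) M β K → ∃ A B,
      BridgeData R Y β M K i j h x₀ L A B cut := fun hS => by
    obtain ⟨A, B, hC⟩ := exists_crossing (y := R _) anti ⟨_, h72, hL⟩ ⟨_, h73, hL'⟩
    exact ⟨A, B, hS, hD.hK, hD.ij, hD.jK, hD.width, hC, hcut, hcost⟩
  obtain ⟨A, B, hU⟩ := data hD.upper
  obtain ⟨A', B', hW⟩ := data hD.lower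
  simp only [bridges, wp_block_cons, wp_setN]
  have hs₀ : Setting R M K i j h x₀ (s.setN 84 ((nl 1).eval s)) :=
    hs.congr rfl (fun k hk => by rw [State.setN_nreg, if_neg (by omega)]) rfl rfl
  refine (bridge_spec hU hs₀ (by simpa using h72) (by simpa using hL) (by simpa using h73)
    (by simpa using hL')).and_exec.mono ?_
  rintro τ₁ s₁ ⟨⟨c₁, dx, dy, hdx, a₁, a₂, a₃, a₄⟩, x₁⟩
  obtain ⟨k₁, k₂, k₃, k₄⟩ := bridge_keeps (Y := 1) (β := 0) (cut := cut)
  have hs₁ := hs₀.exec x₁ k₂ (fun k hk => k₄ k (by omega)) k₁ (k₃ 0 (by omega))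
  have f₁ := fun r hr => x₁.nreg_eq (k₄ r hr)
  simp only [NExp.eval_reg]
  generalize hs₂ : State.setN _ 81 _ = s₂
  have hS₂ : Setting R M K i j h x₀ s₂ := by
    refine hs₁.congr (by simp [← hs₂]) (fun k hk => ?_) (by simp [← hs₂]) (by simp [← hs₂])
    rw [← hs₂, State.setN_nreg, if_neg (by omega), State.setN_nreg, if_neg (by omega)]
  have g72 : s₂.nreg 72 = s.nreg 72 := by simp [← hs₂, f₁ 72 (by omega)]
  have g73 : s₂.nreg 73 = s.nreg 73 := by simp [← hs₂, f₁ 73 (by omega)]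
  have g80 : s₂.nreg 80 = s₁.nreg 40 := by simp [← hs₂]
  have g81 : s₂.nreg 81 = s₁.nreg 41 := by simp [← hs₂]
  have g84 : s₂.nreg 84 = 1 := by simp [← hs₂, f₁ 84 (by omega)]
  refine (bridge_spec hW hS₂ (by rwa [g72]) (by rwa [g72]) (by rwa [g73])
    (by rwa [g73])).and_exec.mono ?_
  rintro τ₂ s₃ ⟨⟨c₂, dx', dy', hdx', b₁, b₂, b₃, b₄⟩, x₃⟩
  obtain ⟨-, -, -, k₄'⟩ := bridge_keeps (Y := 2) (β := 8) (cut := cut)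
  have f₃ := fun r hr => x₃.nreg_eq (k₄' r hr)
  refine wp_block_nil.2 ⟨?_, by simp [f₃, g84], by simp [f₃, g72], by simp [f₃, g73], ?_, ?_⟩
  · have e : h + 2 ≤ (h + 2) ^ 2 := Nat.le_self_pow two_ne_zero _
    simp
    omega
  · simp only [State.setN_nreg]
    simp only [show (80 : ℕ) ≠ 83 by omega, show (81 : ℕ) ≠ 83 by omega,
      show (80 : ℕ) ≠ 82 by omega, show (81 : ℕ) ≠ 82 by omega, if_false,
      f₃ 80 (by omega), f₃ 81 (by omega), g80, g81]
    exact ⟨h₁ _ a₃, h₂ _ a₄, hlt _ _ a₃ a₄, dx, dy, hdx, a₁, a₂⟩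
  · simp only [State.setN_nreg]
    simp only [show (82 : ℕ) ≠ 83 by omega, if_false, if_true, show (41 : ℕ) ≠ 82 by omega]
    exact ⟨h₁ _ b₃, h₂ _ b₄, hlt _ _ b₃ b₄, dx', dy', hdx', b₁, b₂⟩

theorem column_spec (hD : WindowData R M K i j h) {s : State} (hs : Setting R M K i j h x₀ s) :
    WP column s fun τ s' => τ ≤ 6000 * (h + 2) + 40 ∧ s'.nreg 84 = 2 ∧
      s'.nreg 72 = s.nreg 72 ∧ s'.nreg 73 = s.nreg 73 ∧
      ((i ≤ s'.nreg 80 ∧ s'.nreg 80 ≤ j) ∧ ∀ z, i ≤ z → z ≤ j → R 1 z ≤ R 1 (s'.nreg 80)) ∧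
      ((i ≤ s'.nreg 82 ∧ s'.nreg 82 ≤ j) ∧ ∀ z, i ≤ z → z ≤ j → R 2 z ≤ R 2 (s'.nreg 82)) := by
  simp only [column, wp_block_cons, wp_setN]
  have hs₀ : Setting R M K i j h x₀ (s.setN 84 ((nl 2).eval s)) :=
    hs.congr rfl (fun k hk => by rw [State.setN_nreg, if_neg (by omega)]) rfl rfl
  refine (toward_spec (dx := 1) (dy := 0) hD hD.upper hs₀ (by simp) (by simp) (by simp) (by simp)
    zero_le_one (.inl one_pos)).mono ?_
  rintro τ₁ s₁ ⟨c₁, a₁, -, hs₁, f₁⟩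
  have hs₂ : Setting R M K i j h x₀ (s₁.setN 80 ((nr 40).eval s₁)) :=
    hs₁.congr rfl (fun k hk => by rw [State.setN_nreg, if_neg (by omega)]) rfl rfl
  refine (toward_spec (dx := 1) (dy := 0) hD hD.lower hs₂ (by simp) (by simp) (by simp) (by simp)
    zero_le_one (.inl one_pos)).mono ?_
  rintro τ₂ s₃ ⟨c₃, a₃, -, -, f₃⟩
  have hle : ∀ {y : ℕ → ℝ} {v : ℕ}, Opt (R 0) y i j 1 0 (-1) v →
      (i ≤ v ∧ v ≤ j) ∧ ∀ z, i ≤ z → z ≤ j → y z ≤ y v := fun h =>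
    ⟨h.1, fun z hz hz' => by simpa [val] using (h.2 z hz hz').val_le⟩
  refine wp_block_nil.2 ⟨by simp; omega, by simp [f₃, f₁], by simp [f₃, f₁], by simp [f₃, f₁],
    ?_, ?_⟩
  · simpa [f₃] using hle a₁
  · simpa using hle a₃

theorem core_spec {n : ℕ} {p : Fin n → ℝ × ℝ} {s : State} (hG : Good p s.nmem s.rmem)
    {i j : ℕ} (hi : s.nreg 0 = i) (hj : s.nreg 1 = j) (hij : i ≤ j) (hjn : j < n) :
    WP core s fun τ s' => τ ≤ 2000000 * (1 + Nat.log 2 (j - i + 1)) ^ 2 ∧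
      Located s.rmem i j (s.rreg 0) s' := by
  obtain ⟨K, hnK, h16, -, -, -, hU, hW⟩ := hG
  simp only [core, wp_block_cons]
  refine (prelude_spec h16 hi hj hij (hjn.trans_le hnK)).and_exec.mono ?_
  rintro τ₁ s₁ ⟨⟨c₁, h, hw, hK, hwidth, hlog⟩, x₁⟩
  have hD : WindowData s.rmem s.nmem K i j h := ⟨hU, hW, hK, hij, hjn.trans_le hnK, hwidth⟩
  have hs₁ : Setting s.rmem s.nmem K i j h (s.rreg 0) s₁ :=
    ⟨hw, x₁.rmem_eq (by simp [prelude, Prog.KeepsRMem]),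
      x₁.rreg_eq (by simp [prelude, Prog.KeepsR])⟩
  generalize s.rreg 0 = x₀ at *
  -- In the direction `(0, 1)` the functional is minus the abscissa, so the optimum is a leftmost
  -- point; `(0, -1)` gives a rightmost one.
  refine (toward_spec (dx := 0) (dy := 1) hD hU hs₁ (by simp) (by simp) (by simp) (by simp)
    le_rfl (by simp)).mono ?_
  rintro τ₂ s₂ ⟨c₂, a₂, -, hs₂, -⟩
  simp only [wp_setN]
  have hs₃ : Setting s.rmem s.nmem K i j h x₀ (s₂.setN 72 ((nr 40).eval s₂)) :=
    hs₂.congr rfl (fun k hk => by rw [State.setN_nreg, if_neg (by omega)]) rfl rfl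
  refine (toward_spec (dx := 0) (dy := -1) hD hU hs₃ (by simp) (by simp) (by simp) (by simp)
    le_rfl (by simp)).mono ?_
  rintro τ₄ s₄ ⟨c₄, a₄, -, hs₄, f₄⟩
  generalize hs₅ : State.setN _ 84 _ = s₅
  have hS₅ : Setting s.rmem s.nmem K i j h x₀ s₅ := by
    refine hs₄.congr (by simp [← hs₅]) (fun k hk => ?_) (by simp [← hs₅]) (by simp [← hs₅])
    rw [← hs₅, State.setN_nreg, if_neg (by omega), State.setN_nreg, if_neg (by omega)]
  have g72 : s₅.nreg 72 = s₂.nreg 40 := by simp [← hs₅, f₄]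
  have g73 : s₅.nreg 73 = s₄.nreg 40 := by simp [← hs₅]
  have g84 : s₅.nreg 84 = 0 := by simp [← hs₅]
  have m72 : i ≤ s₅.nreg 72 ∧ s₅.nreg 72 ≤ j := g72 ▸ a₂.1
  have m73 : i ≤ s₅.nreg 73 ∧ s₅.nreg 73 ≤ j := g73 ▸ a₄.1
  have hb : ∀ z, i ≤ z → z ≤ j →
      s.rmem 0 (s₅.nreg 72) ≤ s.rmem 0 z ∧ s.rmem 0 z ≤ s.rmem 0 (s₅.nreg 73) := by
    intro z hz hz'
    have h₁ := (a₂.2 z hz hz').val_le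
    have h₂ := (a₄.2 z hz hz').val_le
    simp only [val] at h₁ h₂
    rw [g72, g73]
    constructor <;> linarith
  clear hs₅
  have ht : ∀ c, c ≤ 160000 * (h + 2) ^ 2 →
      c ≤ 1440000 * (1 + Nat.log 2 (j - i + 1)) ^ 2 := by
    intro c hc
    -- From `h ≤ 1 + log w`; squaring turns the factor `3` into the quotient `9` of the two
    -- constants.
    have : h + 2 ≤ 3 * (1 + Nat.log 2 (j - i + 1)) := by omega
    calc c ≤ 160000 * (h + 2) ^ 2 := hc
      _ ≤ 160000 * (3 * (1 + Nat.log 2 (j - i + 1))) ^ 2 := by gcongr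
      _ = _ := by ring
  have hlog₂ : 1 + Nat.log 2 (j - i + 1) ≤ (1 + Nat.log 2 (j - i + 1)) ^ 2 :=
    Nat.le_self_pow two_ne_zero _
  have hh₂ : h + 2 ≤ (h + 2) ^ 2 := Nat.le_self_pow two_ne_zero _
  simp only [wp_cond, wp_skip, wp_block_nil, Test.holds_rlt, RExp.eval_reg, RExp.eval_cell,
    NExp.eval_reg, hS₅.rmem, hS₅.x0]
  -- A line outside the range of abscissas is reported as such. If the window is not vertical, both
  -- sides of the cut must be inhabited: a line to the right of the leftmost abscissa uses the cut
  -- `x < x₀`, a line through the leftmost abscissa uses `x ≤ x₀`. If leftmost and rightmost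
  -- abscissa agree, `column` takes over.
  refine ⟨fun h₁ => ⟨?_, m72, m73, hb, .inl ⟨g84, .inl h₁⟩⟩, fun h₁ =>
    ⟨fun h₂ => ⟨?_, m72, m73, hb, .inl ⟨g84, .inr h₂⟩⟩, fun h₂ => ⟨fun h₃ =>
      ⟨fun h₄ => ?_, fun h₄ => ?_⟩, fun h₃ => ?_⟩⟩⟩
  · have := ht (6000 * (h + 2) + 100) (by omega)
    simp; omega
  · have := ht (6000 * (h + 2) + 100) (by omega)
    simp; omega
  · refine (bridges_spec (L := fun a => s.rmem 0 a < x₀) hD hS₅ (fun a b h h' => h.trans_lt h')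
      (fun r s' h h' => by simp [h, h']) (by simp) (fun a h => h.le) (fun a h => not_lt.1 h)
      m72 h₄ m73 h₂).mono ?_
    rintro τ₆ s₆ ⟨c₆, e84, e72, e73, u₁, u₂⟩
    refine ⟨?_, e72 ▸ m72, e73 ▸ m73, fun z hz hz' => ?_, .inr (.inl ⟨e84, u₁, u₂⟩)⟩
    · have := ht (τ₆ + 6000 * (h + 2) + 150) (by omega)
      simp; omega
    · rw [e72, e73]; exact hb z hz hz'
  · refine (bridges_spec (L := fun a => s.rmem 0 a ≤ x₀) hD hS₅ (fun a b h h' => h.trans h')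
      (fun r s' h h' => by simp [h, h']) (by simp) (fun a h => h) (fun a h => (not_le.1 h).le)
      m72 (not_lt.1 h₁) m73 (not_le.2 ((not_lt.1 h₄).trans_lt h₃))).mono ?_
    rintro τ₆ s₆ ⟨c₆, e84, e72, e73, u₁, u₂⟩
    refine ⟨?_, e72 ▸ m72, e73 ▸ m73, fun z hz hz' => ?_, .inr (.inl ⟨e84, u₁, u₂⟩)⟩
    · have := ht (τ₆ + 6000 * (h + 2) + 150) (by omega)
      simp; omega
    · rw [e72, e73]; exact hb z hz hz'
  · refine (column_spec hD hS₅).mono ?_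
    rintro τ₆ s₆ ⟨c₆, e84, e72, e73, u₁, u₂⟩
    have hle := not_lt.1 h₃
    have hge := (hb _ m73.1 m73.2).1
    refine ⟨?_, e72 ▸ m72, e73 ▸ m73, fun z hz hz' => ?_, .inr (.inr ⟨e84, ?_, ?_, u₁, u₂⟩)⟩
    · have := ht (τ₆ + 6000 * (h + 2) + 150) (by omega)
      simp; omega
    · rw [e72, e73]; exact hb z hz hz'
    · rw [e72]; linarith
    · rw [e73]; linarith

end

/-! ### Hulls in the plane -/

/-- Twice the signed area of a triangle: positive if `q` is above the line from `a` to `b`. -/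
def area (a b q : ℝ × ℝ) : ℝ := (b.1 - a.1) * (q.2 - a.2) - (b.2 - a.2) * (q.1 - a.1)

section
variable {n : ℕ} {p : Fin n → ℝ × ℝ} {i j : Fin n}

theorem convex_hull : Convex ℝ (hull p i j) := convex_convexHull _ _

theorem isClosed_hull : IsClosed (hull p i j) :=
  ((Set.toFinite _).image _).isClosed_convexHull ℝ

theorem mem_hull {a : Fin n} (ha : a ∈ Set.Icc i j) : p a ∈ hull p i j :=
  subset_convexHull _ _ ⟨a, ha, rfl⟩

theorem hull_subset {S : Set (ℝ × ℝ)} (hS : Convex ℝ S) (h : ∀ z ∈ Set.Icc i j, p z ∈ S) :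
    hull p i j ⊆ S := convexHull_min (by rintro _ ⟨z, hz, rfl⟩; exact h z hz) hS

theorem IsEdge.subset {a b : Fin n} (h : IsEdge p i j a b) :
    segment ℝ (p a) (p b) ⊆ hull p i j := convex_hull.segment_subset (mem_hull h.1) (mem_hull h.2.1)

/-- The signed area as a continuous linear functional in the third point. -/
noncomputable def areaForm (a b : ℝ × ℝ) : StrongDual ℝ (ℝ × ℝ) :=
  (b.1 - a.1) • ContinuousLinearMap.snd ℝ ℝ ℝ - (b.2 - a.2) • ContinuousLinearMap.fst ℝ ℝ ℝ

theorem area_eq (a b q : ℝ × ℝ) : area a b q = areaForm a b q - areaForm a b a := by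
  simp [areaForm, area]; ring

theorem area_combo (a b u v : ℝ × ℝ) {s t : ℝ} (h : s + t = 1) :
    area a b (s • u + t • v) = s * area a b u + t * area a b v := by
  simp only [area_eq, map_add, map_smul, smul_eq_mul]
  linear_combination (areaForm a b a) * h

theorem fst_combo (u v : ℝ × ℝ) (s t : ℝ) : (s • u + t • v).1 = s * u.1 + t * v.1 := by simp

theorem area_vertical {a b : ℝ × ℝ} {x y₀ : ℝ} (h : area a b (x, y₀) = 0) (y : ℝ) :
    area a b (x, y) = (b.1 - a.1) * (y - y₀) := by
  simp only [area] at *; linarith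

theorem exists_mem_segment {a b : ℝ × ℝ} (hab : a.1 < b.1) {x : ℝ} (ha : a.1 ≤ x) (hb : x ≤ b.1) :
    ∃ y, (x, y) ∈ segment ℝ a b ∧ area a b (x, y) = 0 := by
  have h0 : 0 < b.1 - a.1 := by linarith
  refine ⟨a.2 + (x - a.1) / (b.1 - a.1) * (b.2 - a.2), ?_, ?_⟩
  · rw [segment_eq_image']
    refine ⟨(x - a.1) / (b.1 - a.1), ⟨by apply div_nonneg <;> linarith, ?_⟩, ?_⟩
    · rw [div_le_one h0]; linarith
    · ext
      · simp [div_mul_cancel₀ _ h0.ne']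
      · simp
  · simp only [area]; field_simp; ring

theorem mem_segment_of_area {a b q : ℝ × ℝ} (hab : a.1 < b.1) (ha : a.1 ≤ q.1) (hb : q.1 ≤ b.1)
    (h : area a b q = 0) : q ∈ segment ℝ a b := by
  obtain ⟨y, hy, hy'⟩ := exists_mem_segment hab ha hb
  have := area_vertical hy' q.2
  rw [Prod.mk.eta, h] at this
  have : q.2 = y := by
    rcases mul_eq_zero.1 this.symm with h | h <;> linarith
  rwa [show q = (q.1, y) by rw [← this]]

theorem area_eq_zero_of_mem {a b q : ℝ × ℝ} (h : q ∈ segment ℝ a b) : area a b q = 0 := by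
  obtain ⟨s, t, -, -, hst, rfl⟩ := h
  rw [area_combo _ _ _ _ hst]
  simp [area]; ring_nf; simp

/-- The segment from `p a` to `p b` crosses the vertical line at `x`, and the window lies below it
for `σ = 1`, above it for `σ = -1`; it contains all points of the window on its line. -/
structure OverEdge (p : Fin n → ℝ × ℝ) (i j : Fin n) (x σ : ℝ) (a b : Fin n) : Prop where
  memA : a ∈ Set.Icc i j
  memB : b ∈ Set.Icc i j
  lt : (p a).1 < (p b).1
  left : (p a).1 ≤ x
  right : x ≤ (p b).1
  side : ∀ z ∈ Set.Icc i j, σ * area (p a) (p b) (p z) < 0 ∨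
    (area (p a) (p b) (p z) = 0 ∧ (p a).1 ≤ (p z).1 ∧ (p z).1 ≤ (p b).1)

/-- The alternative describes an open half-plane together with a piece of its boundary line. This
set is convex, so what holds for the points of the window passes to their hull. -/
theorem OverEdge.hull_side {x σ : ℝ} {a b : Fin n} (h : OverEdge p i j x σ a b) {q : ℝ × ℝ}
    (hq : q ∈ hull p i j) : σ * area (p a) (p b) q < 0 ∨
    (area (p a) (p b) q = 0 ∧ (p a).1 ≤ q.1 ∧ q.1 ≤ (p b).1) := by
  refine hull_subset (S := {q | σ * area (p a) (p b) q < 0 ∨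
    (area (p a) (p b) q = 0 ∧ (p a).1 ≤ q.1 ∧ q.1 ≤ (p b).1)}) ?_ h.side hq
  rw [convex_iff_forall_pos]
  intro u hu v hv s t hs ht hst
  simp only [Set.mem_ofPred_eq, area_combo _ _ _ _ hst, fst_combo] at *
  rcases hu with hu | ⟨hu, hu₁, hu₂⟩ <;> rcases hv with hv | ⟨hv, hv₁, hv₂⟩
  · left; nlinarith
  · left; rw [hv]; nlinarith
  · left; rw [hu]; nlinarith
  · right
    have e₁ : s * (p a).1 + t * (p a).1 = (p a).1 := by rw [← add_mul, hst, one_mul]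
    have e₂ : s * (p b).1 + t * (p b).1 = (p b).1 := by rw [← add_mul, hst, one_mul]
    refine ⟨by simp [hu, hv], ?_, ?_⟩ <;> nlinarith

theorem OverEdge.hull_le {x σ : ℝ} {a b : Fin n} (h : OverEdge p i j x σ a b) {q : ℝ × ℝ}
    (hq : q ∈ hull p i j) : σ * area (p a) (p b) q ≤ 0 := by
  rcases h.hull_side hq with h | h
  · exact h.le
  · simp [h.1]

/-- The form `σ • areaForm` is maximal on the hull exactly along the segment, by the second case of
`hull_side`. Collinear windows that are not vertical need no separate treatment: the form is then
constant on the hull, which is the segment. -/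
theorem OverEdge.isEdge {x σ : ℝ} {a b : Fin n} (h : OverEdge p i j x σ a b) :
    IsEdge p i j a b := by
  refine ⟨h.memA, h.memB, fun e => h.lt.ne (by rw [e]), fun _ => ⟨σ • areaForm (p a) (p b), ?_⟩⟩
  have hform : ∀ q, (σ • areaForm (p a) (p b)) q =
      σ * area (p a) (p b) q + σ * areaForm (p a) (p b) (p a) := fun q => by
    simp [area_eq]; ring
  ext q
  simp only [Set.mem_ofPred_eq, hform]
  constructor
  · intro hq
    refine ⟨convex_hull.segment_subset (mem_hull h.memA) (mem_hull h.memB) hq, fun y hy => ?_⟩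
    have := h.hull_le hy
    rw [area_eq_zero_of_mem hq]
    linarith
  · rintro ⟨hq, hmax⟩
    have := hmax _ (mem_hull h.memA)
    rw [area_eq_zero_of_mem (left_mem_segment ℝ _ _)] at this
    rcases h.hull_side hq with hlt | ⟨h₁, h₂, h₃⟩
    · linarith
    · exact mem_segment_of_area h.lt h₂ h₃ h₁

theorem OverEdge.exists_mem {x σ : ℝ} {a b : Fin n} (h : OverEdge p i j x σ a b) :
    ∃ y₀, (x, y₀) ∈ segment ℝ (p a) (p b) ∧
      ∀ y, σ * area (p a) (p b) (x, y) = ((p b).1 - (p a).1) * (σ * (y - y₀)) := by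
  obtain ⟨y₀, h₁, h₂⟩ := exists_mem_segment h.lt h.left h.right
  exact ⟨y₀, h₁, fun y => by rw [area_vertical h₂]; ring⟩

/-- A point on a vertical line between two points of the hull is in the hull. -/
theorem mem_hull_of_between {x y₁ y₂ y : ℝ} (h₁ : (x, y₁) ∈ hull p i j)
    (h₂ : (x, y₂) ∈ hull p i j) (hy₁ : y₁ ≤ y) (hy₂ : y ≤ y₂) : (x, y) ∈ hull p i j := by
  refine convex_hull.segment_subset h₁ h₂ ?_
  rw [← Prod.image_mk_segment_right, segment_eq_Icc (hy₁.trans hy₂)]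
  exact ⟨y, ⟨hy₁, hy₂⟩, rfl⟩

/-! ### The hull, its interior and its boundary on a vertical line -/

section edges
variable {x : ℝ} {a b c d : Fin n}

/-- On the vertical line the sign of `area` is the sign of the height over the edge. A point between
the two edges thus lies on a vertical chord of the hull. -/
theorem OverEdge.mem_hull_iff (hU : OverEdge p i j x 1 a b) (hL : OverEdge p i j x (-1) c d)
    {y : ℝ} : (x, y) ∈ hull p i j ↔
      area (p a) (p b) (x, y) ≤ 0 ∧ 0 ≤ area (p c) (p d) (x, y) := by
  refine ⟨fun h => ⟨by simpa using hU.hull_le h, by simpa using hL.hull_le h⟩,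
    fun ⟨h₁, h₂⟩ => ?_⟩
  obtain ⟨u, hu, hu'⟩ := hU.exists_mem
  obtain ⟨l, hl, hl'⟩ := hL.exists_mem
  have h₁' := hu' y
  have h₂' := hl' y
  refine mem_hull_of_between (hL.isEdge.subset hl) (hU.isEdge.subset hu) ?_ ?_
  · by_contra! h
    nlinarith [mul_pos (sub_pos.2 hL.lt) (sub_pos.2 h)]
  · by_contra! h
    nlinarith [mul_pos (sub_pos.2 hU.lt) (sub_pos.2 h)]

/-- A nonzero linear form is open, so it cannot attain its maximum over the hull in the interior. -/
theorem OverEdge.lt_of_mem_interior {σ : ℝ} (hσ : σ ≠ 0) (h : OverEdge p i j x σ a b) {q : ℝ × ℝ}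
    (hq : q ∈ interior (hull p i j)) : σ * area (p a) (p b) q < 0 := by
  have hform : ∀ q, (σ • areaForm (p a) (p b)) q =
      σ * area (p a) (p b) q + σ * areaForm (p a) (p b) (p a) := fun q => by
    simp [area_eq]; ring
  have hne : σ • areaForm (p a) (p b) ≠ 0 := by
    intro h0
    have := DFunLike.congr_fun h0 (0, 1)
    simp [areaForm, hσ] at this
    linarith [h.lt]
  have hmem := (ContinuousLinearMap.isOpenMap_of_ne_zero _ hne).image_interior_subset
    (hull p i j) (Set.mem_image_of_mem _ hq)
  have hsub : (σ • areaForm (p a) (p b)) '' hull p i j ⊆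
      Set.Iic (σ * areaForm (p a) (p b) (p a)) := by
    rintro _ ⟨q, hq, rfl⟩
    rw [hform, Set.mem_Iic]
    linarith [h.hull_le hq]
  have := interior_mono hsub hmem
  rw [interior_Iic, Set.mem_Iio, hform] at this
  linarith

theorem fst_le_of_mem_hull {r : ℝ} (h : ∀ z ∈ Set.Icc i j, (p z).1 ≤ r) {q : ℝ × ℝ}
    (hq : q ∈ hull p i j) : q.1 ≤ r :=
  hull_subset (S := {q : ℝ × ℝ | q.1 ≤ r})
    (convex_halfSpace_le (f := Prod.fst) ⟨fun _ _ => rfl, fun _ _ => rfl⟩ r) h hq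

theorem le_fst_of_mem_hull {r : ℝ} (h : ∀ z ∈ Set.Icc i j, r ≤ (p z).1) {q : ℝ × ℝ}
    (hq : q ∈ hull p i j) : r ≤ q.1 :=
  hull_subset (S := {q : ℝ × ℝ | r ≤ q.1})
    (convex_halfSpace_ge (f := Prod.fst) ⟨fun _ _ => rfl, fun _ _ => rfl⟩ r) h hq

theorem snd_le_of_mem_hull {r : ℝ} (h : ∀ z ∈ Set.Icc i j, (p z).2 ≤ r) {q : ℝ × ℝ}
    (hq : q ∈ hull p i j) : q.2 ≤ r :=
  hull_subset (S := {q : ℝ × ℝ | q.2 ≤ r})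
    (convex_halfSpace_le (f := Prod.snd) ⟨fun _ _ => rfl, fun _ _ => rfl⟩ r) h hq

theorem le_snd_of_mem_hull {r : ℝ} (h : ∀ z ∈ Set.Icc i j, r ≤ (p z).2) {q : ℝ × ℝ}
    (hq : q ∈ hull p i j) : r ≤ q.2 :=
  hull_subset (S := {q : ℝ × ℝ | r ≤ q.2})
    (convex_halfSpace_ge (f := Prod.snd) ⟨fun _ _ => rfl, fun _ _ => rfl⟩ r) h hq

theorem fst_lt_of_mem_interior {r : ℝ} (h : ∀ z ∈ Set.Icc i j, (p z).1 ≤ r) {q : ℝ × ℝ}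
    (hq : q ∈ interior (hull p i j)) : q.1 < r := by
  have := isOpenMap_fst.image_interior_subset (hull p i j) (Set.mem_image_of_mem _ hq)
  have := interior_mono (t := Set.Iic r)
    (by rintro _ ⟨q, hq, rfl⟩; exact fst_le_of_mem_hull h hq) this
  rwa [interior_Iic] at this

theorem lt_fst_of_mem_interior {r : ℝ} (h : ∀ z ∈ Set.Icc i j, r ≤ (p z).1) {q : ℝ × ℝ}
    (hq : q ∈ interior (hull p i j)) : r < q.1 := by
  have := isOpenMap_fst.image_interior_subset (hull p i j) (Set.mem_image_of_mem _ hq)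
  have := interior_mono (t := Set.Ici r)
    (by rintro _ ⟨q, hq, rfl⟩; exact le_fst_of_mem_hull h hq) this
  rwa [interior_Ici] at this

/-- The chord of the hull from a point on the vertical line at `x` to a point at abscissa `x₁`. -/
theorem chord_mem_hull {u x₁ y₁ x' : ℝ} (hu : (x, u) ∈ hull p i j) (h₁ : (x₁, y₁) ∈ hull p i j)
    (hne : x₁ - x ≠ 0) (h : (x' - x) / (x₁ - x) ∈ Set.Icc (0 : ℝ) 1) :
    (x', u + (x' - x) / (x₁ - x) * (y₁ - u)) ∈ hull p i j := by
  have := convex_hull.add_smul_sub_mem hu h₁ h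
  convert this using 1
  ext
  · simp [div_mul_cancel₀ _ hne]
  · simp

/-- The points above and below `(x, y)` are joined by chords to a hull point strictly to the left
and to one strictly to the right. The region between these four chords is a neighbourhood of `(x,
y)`, and each point of it lies between two chords on its own vertical line. -/
theorem mem_interior_hull {l r u v y : ℝ} {yl yr : ℝ} (hl : (l, yl) ∈ hull p i j)
    (hr : (r, yr) ∈ hull p i j) (hv : (x, v) ∈ hull p i j) (hu : (x, u) ∈ hull p i j)
    (hlx : l < x) (hxr : x < r) (hvy : v < y) (hyu : y < u) : (x, y) ∈ interior (hull p i j) := by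
  let f : ℝ → ℝ → ℝ → ℝ → ℝ := fun w x₁ y₁ x' => w + (x' - x) / (x₁ - x) * (y₁ - w)
  have hf : ∀ w x₁ y₁, Continuous (f w x₁ y₁) := fun w x₁ y₁ => by fun_prop
  have hfx : ∀ w x₁ y₁, f w x₁ y₁ x = w := fun w x₁ y₁ => by simp [f]
  rw [mem_interior]
  refine ⟨{q | (l < q.1 ∧ q.1 < r) ∧ (f v l yl q.1 < q.2 ∧ q.2 < f u l yl q.1) ∧
    (f v r yr q.1 < q.2 ∧ q.2 < f u r yr q.1)}, ?_, ?_, ?_⟩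
  · rintro ⟨x', y'⟩ ⟨⟨h₁, h₂⟩, ⟨h₃, h₄⟩, h₅, h₆⟩
    simp only at h₁ h₂ h₃ h₄ h₅ h₆
    rcases le_total x x' with h | h
    · have ht : (x' - x) / (r - x) ∈ Set.Icc (0 : ℝ) 1 :=
        ⟨div_nonneg (by linarith) (by linarith), (div_le_one (by linarith)).2 (by linarith)⟩
      exact mem_hull_of_between (chord_mem_hull hv hr (by linarith) ht)
        (chord_mem_hull hu hr (by linarith) ht) h₅.le h₆.le
    · have ht : (x' - x) / (l - x) ∈ Set.Icc (0 : ℝ) 1 :=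
        ⟨div_nonneg_of_nonpos (by linarith) (by linarith),
          (div_le_one_of_neg (by linarith)).2 (by linarith)⟩
      exact mem_hull_of_between (chord_mem_hull hv hl (by linarith) ht)
        (chord_mem_hull hu hl (by linarith) ht) h₃.le h₄.le
  · have hg := fun w x₁ y₁ => (hf w x₁ y₁).comp (continuous_fst (X := ℝ) (Y := ℝ))
    exact ((isOpen_lt continuous_const continuous_fst).inter
      (isOpen_lt continuous_fst continuous_const)).inter
      (((isOpen_lt (hg _ _ _) continuous_snd).inter (isOpen_lt continuous_snd (hg _ _ _))).inter
        ((isOpen_lt (hg _ _ _) continuous_snd).inter (isOpen_lt continuous_snd (hg _ _ _))))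
  · simp only [Set.mem_ofPred_eq, hfx]
    exact ⟨⟨hlx, hxr⟩, ⟨hvy, hyu⟩, hvy, hyu⟩

theorem OverEdge.mem_interior_iff (hU : OverEdge p i j x 1 a b) (hL : OverEdge p i j x (-1) c d)
    {l r : Fin n} (hl : l ∈ Set.Icc i j) (hr : r ∈ Set.Icc i j)
    (hb : ∀ z ∈ Set.Icc i j, (p l).1 ≤ (p z).1 ∧ (p z).1 ≤ (p r).1) {y : ℝ} :
    (x, y) ∈ interior (hull p i j) ↔ (p l).1 < x ∧ x < (p r).1 ∧
      area (p a) (p b) (x, y) < 0 ∧ 0 < area (p c) (p d) (x, y) := by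
  constructor
  · intro h
    exact ⟨lt_fst_of_mem_interior (fun z hz => (hb z hz).1) h,
      fst_lt_of_mem_interior (fun z hz => (hb z hz).2) h,
      by simpa using hU.lt_of_mem_interior one_ne_zero h,
      by simpa using hL.lt_of_mem_interior (by norm_num) h⟩
  · rintro ⟨h₁, h₂, h₃, h₄⟩
    obtain ⟨u, hu, hu'⟩ := hU.exists_mem
    obtain ⟨v, hv, hv'⟩ := hL.exists_mem
    have hu' := hu' y
    have hv' := hv' y
    refine mem_interior_hull (mem_hull hl) (mem_hull hr) (hL.isEdge.subset hv)
      (hU.isEdge.subset hu) h₁ h₂ ?_ ?_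
    · by_contra! h
      nlinarith [mul_nonneg (sub_pos.2 hL.lt).le (sub_nonneg.2 h)]
    · by_contra! h
      nlinarith [mul_nonneg (sub_pos.2 hU.lt).le (sub_nonneg.2 h)]

theorem OverEdge.mem_frontier_iff (hU : OverEdge p i j x 1 a b) (hL : OverEdge p i j x (-1) c d)
    {l r : Fin n} (hl : l ∈ Set.Icc i j) (hr : r ∈ Set.Icc i j)
    (hb : ∀ z ∈ Set.Icc i j, (p l).1 ≤ (p z).1 ∧ (p z).1 ≤ (p r).1) {y : ℝ} :
    (x, y) ∈ frontier (hull p i j) ↔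
      (area (p a) (p b) (x, y) ≤ 0 ∧ 0 ≤ area (p c) (p d) (x, y)) ∧
      ¬ ((p l).1 < x ∧ x < (p r).1 ∧
        area (p a) (p b) (x, y) < 0 ∧ 0 < area (p c) (p d) (x, y)) := by
  rw [isClosed_hull.frontier_eq, Set.mem_sdiff, hU.mem_hull_iff hL,
    hU.mem_interior_iff hL hl hr hb]

end edges

/-! ### Windows on a vertical line -/

/-- All points of the window have abscissa `x`, and `t` and `b` are the highest and the lowest. -/
structure Vertical (p : Fin n → ℝ × ℝ) (i j : Fin n) (x : ℝ) (t b : Fin n) : Prop where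
  memT : t ∈ Set.Icc i j
  memB : b ∈ Set.Icc i j
  fst : ∀ z ∈ Set.Icc i j, (p z).1 = x
  bounds : ∀ z ∈ Set.Icc i j, (p b).2 ≤ (p z).2 ∧ (p z).2 ≤ (p t).2

theorem Vertical.mem_hull_iff {x : ℝ} {t b : Fin n} (h : Vertical p i j x t b) {q : ℝ × ℝ} :
    q ∈ hull p i j ↔ q.1 = x ∧ (p b).2 ≤ q.2 ∧ q.2 ≤ (p t).2 := by
  constructor
  · intro hq
    exact ⟨le_antisymm (fst_le_of_mem_hull (fun z hz => (h.fst z hz).le) hq)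
      (le_fst_of_mem_hull (fun z hz => (h.fst z hz).ge) hq),
      le_snd_of_mem_hull (fun z hz => (h.bounds z hz).1) hq,
      snd_le_of_mem_hull (fun z hz => (h.bounds z hz).2) hq⟩
  · rintro ⟨h₁, h₂, h₃⟩
    obtain ⟨q₁, q₂⟩ := q
    obtain rfl : q₁ = x := h₁
    have ht := mem_hull (p := p) h.memT
    have hb := mem_hull (p := p) h.memB
    rw [← Prod.mk.eta (p := p t), h.fst t h.memT] at ht
    rw [← Prod.mk.eta (p := p b), h.fst b h.memB] at hb
    exact mem_hull_of_between hb ht h₂ h₃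

/-- The hull has no interior, so membership in the boundary is the same question as containment. -/
theorem Vertical.frontier_eq {x : ℝ} {t b : Fin n} (h : Vertical p i j x t b) :
    frontier (hull p i j) = hull p i j := by
  have : interior (hull p i j) = ∅ := by
    refine Set.eq_empty_iff_forall_notMem.2 fun q hq => ?_
    have h₁ := fst_lt_of_mem_interior (fun z hz => (h.fst z hz).le) hq
    have h₂ := lt_fst_of_mem_interior (fun z hz => (h.fst z hz).ge) hq
    exact lt_asymm h₁ h₂
  rw [isClosed_hull.frontier_eq, this, Set.sdiff_empty]

theorem Vertical.isEdge {x : ℝ} {t b : Fin n} (h : Vertical p i j x t b)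
    (hlt : (p b).2 < (p t).2) : IsEdge p i j t b := by
  refine ⟨h.memT, h.memB, fun e => hlt.ne (by rw [e]), ?_⟩
  have : segment ℝ (p t) (p b) = hull p i j := by
    refine (convex_hull.segment_subset (mem_hull h.memT) (mem_hull h.memB)).antisymm fun q hq => ?_
    rw [h.mem_hull_iff] at hq
    rw [segment_symm, ← Prod.mk.eta (p := p t), ← Prod.mk.eta (p := p b), h.fst t h.memT,
      h.fst b h.memB, ← Prod.image_mk_segment_right, segment_eq_Icc hlt.le]
    exact ⟨q.2, hq.2, by rw [← hq.1]⟩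
  rw [this]

/-- Here all points of the window coincide. -/
theorem Vertical.not_isEdge {x : ℝ} {t b : Fin n} (h : Vertical p i j x t b)
    (hle : (p t).2 ≤ (p b).2) (u v : Fin n) : ¬ IsEdge p i j u v := fun he => by
  have hu := h.bounds u he.1
  have hv := h.bounds v he.2.1
  exact he.2.2.1 (Prod.ext ((h.fst u he.1).trans (h.fst v he.2.1).symm) (by linarith))

end

/-! ### The queries -/

/-- Position of the query point relative to the line through the points in the registers. -/
def areaExp (a b : ℕ) : RExp :=
  (rc 0 (nr b) - rc 0 (nr a)) * (rr 1 - rc 1 (nr a)) -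
    (rc 1 (nr b) - rc 1 (nr a)) * (rr 0 - rc 0 (nr a))

def yes : Prog := .setN 0 (nl 1)

def no : Prog := .setN 0 (nl 0)

def containQuery : Prog := block [core,
  .cond (.nlt (nr 84) (nl 1)) no
    (.cond (.nlt (nr 84) (nl 2))
      (.cond (.conj (.neg (.rlt (rl 0) (areaExp 80 81))) (.neg (.rlt (areaExp 82 83) (rl 0))))
        yes no)
      (.cond (.conj (.neg (.rlt (rr 1) (rc 1 (nr 82)))) (.neg (.rlt (rc 1 (nr 80)) (rr 1))))
        yes no))]

def memberQuery : Prog := block [core,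
  .cond (.nlt (nr 84) (nl 1)) no
    (.cond (.nlt (nr 84) (nl 2))
      (.cond (.conj
          (.conj (.neg (.rlt (rl 0) (areaExp 80 81))) (.neg (.rlt (areaExp 82 83) (rl 0))))
          (.neg (.conj (.rlt (rc 0 (nr 72)) (rr 0)) (.conj (.rlt (rr 0) (rc 0 (nr 73)))
            (.conj (.rlt (areaExp 80 81) (rl 0)) (.rlt (rl 0) (areaExp 82 83)))))))
        yes no)
      (.cond (.conj (.neg (.rlt (rr 1) (rc 1 (nr 82)))) (.neg (.rlt (rc 1 (nr 80)) (rr 1))))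
        yes no))]

def stabQuery : Prog := block [core,
  .cond (.nlt (nr 84) (nl 1)) no
    (.cond (.nlt (nr 84) (nl 2))
      (block [.setN 1 (nr 80), .setN 2 (nr 81), .setN 3 (nr 82), .setN 4 (nr 83), yes])
      (.cond (.rlt (rc 1 (nr 82)) (rc 1 (nr 80)))
        (block [.setN 1 (nr 80), .setN 2 (nr 82), .setN 3 (nr 80), .setN 4 (nr 82), yes])
        no))]

/-! ### Correctness of the three queries -/

section
variable {n : ℕ} {p : Fin n → ℝ × ℝ} {i j : Fin n} {x : ℝ}

/-- Translates optimality in index terms into a statement about the hull; `σ = -1` undoes the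
reflection of the lower tree. That `a` is the leftmost and `b` the rightmost optimum puts every
point of the window on the line between them. -/
theorem UpperEdge.overEdge {X Y : ℕ → ℝ} {σ : ℝ} {a b : ℕ} (hσ : σ ≠ 0)
    (hX : ∀ z : Fin n, X z = (p z).1) (hY : ∀ z : Fin n, Y z = σ * (p z).2)
    (h : UpperEdge X Y i j x a b) :
    ∃ a' b' : Fin n, a = a' ∧ b = b' ∧ OverEdge p i j x σ a' b' := by
  obtain ⟨hax, hxb, hab, dx, dy, hdx, ha, hb⟩ := h
  lift a to Fin n using ha.1.2.trans_lt j.2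
  lift b to Fin n using hb.1.2.trans_lt j.2
  refine ⟨a, b, rfl, rfl, ⟨ha.1, hb.1, by rwa [← hX, ← hX], by rwa [← hX], by rwa [← hX],
    fun z hz => ?_⟩⟩
  have hval := le_antisymm (hb.2 a ha.1.1 ha.1.2).val_le (ha.2 b hb.1.1 hb.1.2).val_le
  -- Since `a` and `b` have the same value, the direction `(dx, dy)` is parallel to the edge, and
  -- the area is, up to positive factors, the difference of `val`.
  have harea : dx * (σ * area (p a) (p b) (p z)) =
      ((p b).1 - (p a).1) * (val X Y dx dy z - val X Y dx dy a) := by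
    simp only [val, hX, hY, area] at hval ⊢
    linear_combination ((p z).1 - (p a).1) * hval
  have hab' : 0 < (p b).1 - (p a).1 := by rw [← hX, ← hX]; linarith
  rcases ha.2 z hz.1 hz.2 with h₁ | ⟨h₁, h₂⟩
  · left
    have : dx * (σ * area (p a) (p b) (p z)) < 0 := by
      rw [harea]; exact mul_neg_of_pos_of_neg hab' (by linarith)
    exact neg_of_mul_neg_right this hdx.le
  · right
    rcases hb.2 z hz.1 hz.2 with h₃ | ⟨h₃, h₄⟩
    · linarith
    · rw [h₁, sub_self, mul_zero] at harea
      rw [hX, hX] at h₂ h₄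
      refine ⟨?_, by linarith, by linarith⟩
      simpa [hdx.ne', hσ] using harea

/-- The result of `core` in geometric terms. -/
inductive Found (p : Fin n → ℝ × ℝ) (i j : Fin n) (x : ℝ) (s : State) : Prop
  | outside (h : s.nreg 84 = 0) (hx : ∀ q ∈ hull p i j, q.1 ≠ x)
  | proper (h : s.nreg 84 = 1) (l r a b c d : Fin n) (hl : s.nreg 72 = l) (hr : s.nreg 73 = r)
      (ha : s.nreg 80 = a) (hb : s.nreg 81 = b) (hc : s.nreg 82 = c) (hd : s.nreg 83 = d)
      (memL : l ∈ Set.Icc i j) (memR : r ∈ Set.Icc i j)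
      (bounds : ∀ z ∈ Set.Icc i j, (p l).1 ≤ (p z).1 ∧ (p z).1 ≤ (p r).1)
      (upper : OverEdge p i j x 1 a b) (lower : OverEdge p i j x (-1) c d)
  | vertical (h : s.nreg 84 = 2) (t b : Fin n) (ht : s.nreg 80 = t) (hb : s.nreg 82 = b)
      (hv : Vertical p i j x t b)

theorem Located.found {M : ℕ → ℕ → ℕ} {R : ℕ → ℕ → ℝ} (hG : Good p M R) {s : State}
    (h : Located R i j x s) : Found p i j x s := by
  obtain ⟨-, -, -, h₀, h₁, h₂, -, -⟩ := hG
  have hX : ∀ z : Fin n, R 0 z = (p z).1 := fun z => h₀ z z.2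
  have hY : ∀ z : Fin n, R 1 z = (p z).2 := fun z => h₁ z z.2
  have hY' : ∀ z : Fin n, R 2 z = -1 * (p z).2 := fun z => by
    rw [h₂ z z.2, hY]; ring
  obtain ⟨mL, mR, hb, hcases⟩ := h
  obtain ⟨l, hl⟩ : ∃ l : Fin n, s.nreg 72 = l := ⟨⟨_, mL.2.trans_lt j.2⟩, rfl⟩
  obtain ⟨r, hr⟩ : ∃ r : Fin n, s.nreg 73 = r := ⟨⟨_, mR.2.trans_lt j.2⟩, rfl⟩
  rw [hl] at mL
  rw [hr] at mR
  have hb' : ∀ z ∈ Set.Icc i j, (p l).1 ≤ (p z).1 ∧ (p z).1 ≤ (p r).1 := fun z hz => by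
    simpa only [hl, hr, hX] using hb z hz.1 hz.2
  rcases hcases with ⟨h84, hx⟩ | ⟨h84, hU, hL⟩ | ⟨h84, e₁, e₂, ⟨m₁, hU⟩, m₂, hL⟩
  · refine .outside h84 fun q hq e => ?_
    rw [hl, hr, hX, hX] at hx
    have := le_fst_of_mem_hull (fun z hz => (hb' z hz).1) hq
    have := fst_le_of_mem_hull (fun z hz => (hb' z hz).2) hq
    rcases hx with hx | hx <;> linarith
  · obtain ⟨a, b, ha, hb, hU⟩ := hU.overEdge one_ne_zero hX (by simpa using hY)
    obtain ⟨c, d, hc, hd, hL⟩ := hL.overEdge (σ := -1) (by norm_num) hX hY'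
    exact .proper h84 l r a b c d hl hr ha hb hc hd mL mR hb' hU hL
  · obtain ⟨t, ht⟩ : ∃ t : Fin n, s.nreg 80 = t := ⟨⟨_, m₁.2.trans_lt j.2⟩, rfl⟩
    obtain ⟨b, hb⟩ : ∃ b : Fin n, s.nreg 82 = b := ⟨⟨_, m₂.2.trans_lt j.2⟩, rfl⟩
    rw [ht] at m₁
    rw [hb] at m₂
    rw [hl, hX] at e₁
    rw [hr, hX] at e₂
    refine .vertical h84 t b ht hb ⟨m₁, m₂, fun z hz => ?_, fun z hz => ⟨?_, ?_⟩⟩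
    · exact le_antisymm ((hb' z hz).2.trans e₂.le) (e₁.ge.trans (hb' z hz).1)
    · have := hL z hz.1 hz.2
      rw [hb, hY', hY'] at this
      linarith
    · have := hU z hz.1 hz.2
      rwa [ht, hY, hY] at this

/-- What is known when `core` has run in a state with intact data structure. -/
structure Ran (p : Fin n → ℝ × ℝ) (i j : Fin n) (x y : ℝ) (s : State) : Prop where
  good : Good p s.nmem s.rmem
  found : Found p i j x s
  fst : ∀ z : Fin n, s.rmem 0 z = (p z).1
  snd : ∀ z : Fin n, s.rmem 1 z = (p z).2
  rx : s.rreg 0 = x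
  ry : s.rreg 1 = y

/-- The constant of `queryTime` leaves `1000` steps for the tests that follow `core`. Since `core`
writes no memory, the structure stays intact. -/
theorem core_ran {y : ℝ} {s : State} (hG : Good p s.nmem s.rmem) (hij : i ≤ j)
    (hi : s.nreg 0 = i) (hj : s.nreg 1 = j) (hx : s.rreg 0 = x) (hy : s.rreg 1 = y) :
    WP core s fun τ s' => τ + 1000 ≤ queryTime 2001000 i j ∧ Ran p i j x y s' := by
  refine (core_spec hG hi hj hij j.2).and_exec.mono ?_
  rintro τ s' ⟨⟨c, hl⟩, x'⟩
  have hm : s'.nmem = s.nmem := funext fun b => x'.nmem_eq (core_keeps.2.1 b)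
  have hr := x'.rmem_eq core_keeps.1
  rw [hx] at hl
  refine ⟨?_, by rwa [hm, hr], hl.found hG, fun z => ?_, fun z => ?_,
    (x'.rreg_eq (core_keeps.2.2 0 (by omega))).trans hx,
    (x'.rreg_eq (core_keeps.2.2 1 (by omega))).trans hy⟩
  · have : 1 ≤ (1 + Nat.log 2 (j - i + 1 : ℕ)) ^ 2 := Nat.one_le_pow _ _ (by omega)
    rw [queryTime]
    omega
  · obtain ⟨-, -, -, h₀, -⟩ := hG
    rw [hr]; exact h₀ z z.2
  · obtain ⟨-, -, -, -, h₁, -⟩ := hG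
    rw [hr]; exact h₁ z z.2

theorem Ran.eval_area {y : ℝ} {s : State} (h : Ran p i j x y s) {a b : ℕ} {a' b' : Fin n}
    (ha : s.nreg a = a') (hb : s.nreg b = b') :
    (areaExp a b).eval s = area (p a') (p b') (x, y) := by
  simp [areaExp, area, ha, hb, h.fst, h.snd, h.rx, h.ry]

theorem cost_areaExp (a b : ℕ) : (areaExp a b).cost = 21 := rfl

theorem wp_no {y : ℝ} {s : State} (hs : Ran p i j x y s) {P : Prop} {t : ℕ}
    (ht : t + 10 ≤ queryTime 2001000 i j) (hP : ¬ P) :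
    WP no s fun τ s' => t + τ ≤ queryTime 2001000 i j ∧ Good p s'.nmem s'.rmem ∧
      YesNoAnswer P s' := by
  simp only [no, wp_setN]
  exact ⟨by simp; omega, hs.good, .inr ⟨hP, by simp⟩⟩

theorem wp_yes_no {y : ℝ} {s : State} (hs : Ran p i j x y s) {P : Prop} {t : ℕ} {T : Test}
    (ht : t + T.cost + 10 ≤ queryTime 2001000 i j) (hT : T.holds s ↔ P) :
    WP (.cond T yes no) s fun τ s' => t + τ ≤ queryTime 2001000 i j ∧
      Good p s'.nmem s'.rmem ∧ YesNoAnswer P s' := by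
  simp only [wp_cond, yes, no, wp_setN, hT]
  exact ⟨fun h => ⟨by simp; omega, hs.good, .inl ⟨h, by simp⟩⟩,
    fun h => ⟨by simp; omega, hs.good, .inr ⟨h, by simp⟩⟩⟩

theorem containQuery_spec {y : ℝ} {s : State} (hG : Good p s.nmem s.rmem) (hij : i ≤ j)
    (hi : s.nreg 0 = i) (hj : s.nreg 1 = j) (hx : s.rreg 0 = x) (hy : s.rreg 1 = y) :
    WP containQuery s fun τ s' => τ ≤ queryTime 2001000 i j ∧ Good p s'.nmem s'.rmem ∧
      YesNoAnswer ((x, y) ∈ hull p i j) s' := by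
  simp only [containQuery, wp_block_cons]
  refine (core_ran hG hij hi hj hx hy).mono ?_
  rintro τ s ⟨c, hs⟩
  rw [wp_cond]
  simp only [wp_block_nil, Test.holds_nlt, NExp.eval_reg, NExp.eval_lit]
  rcases hs.found with ⟨h, hout⟩ |
    ⟨h, l, r, a, b, c', d, hl, hr, ha, hb, hc, hd, mL, mR, hlr, hU, hL⟩ |
    ⟨h, t, b, ht, hb, hv⟩
  · refine ⟨fun _ => ?_, fun h' => absurd h (by omega)⟩
    refine (wp_no (t := τ + 5) hs (P := (x, y) ∈ hull p i j) (by omega)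
      fun hq => hout _ hq rfl).mono ?_
    rintro τ' s' ⟨h₁, h₂⟩
    exact ⟨by simp; omega, h₂⟩
  · refine ⟨fun h' => absurd h (by omega), fun _ => ?_⟩
    rw [wp_cond]
    refine ⟨fun _ => ?_, fun h' => absurd h (by simp at h'; omega)⟩
    refine (wp_yes_no (t := τ + 9) (P := (x, y) ∈ hull p i j) hs
      (by simp [cost_areaExp]; omega) ?_).mono ?_
    · rw [hU.mem_hull_iff hL]
      simp [hs.eval_area ha hb, hs.eval_area hc hd]
    rintro τ' s' ⟨h₁, h₂⟩
    exact ⟨by simp; omega, h₂⟩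
  · refine ⟨fun h' => absurd h (by omega), fun _ => ?_⟩
    rw [wp_cond]
    refine ⟨fun h' => absurd h (by simp at h'; omega), fun _ => ?_⟩
    refine (wp_yes_no (t := τ + 9) (P := (x, y) ∈ hull p i j) hs
      (by simp; omega) ?_).mono ?_
    · rw [hv.mem_hull_iff]
      simp [ht, hb, hs.snd, hs.ry]
    rintro τ' s' ⟨h₁, h₂⟩
    exact ⟨by simp; omega, h₂⟩

theorem memberQuery_spec {y : ℝ} {s : State} (hG : Good p s.nmem s.rmem) (hij : i ≤ j)
    (hi : s.nreg 0 = i) (hj : s.nreg 1 = j) (hx : s.rreg 0 = x) (hy : s.rreg 1 = y) :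
    WP memberQuery s fun τ s' => τ ≤ queryTime 2001000 i j ∧ Good p s'.nmem s'.rmem ∧
      YesNoAnswer ((x, y) ∈ frontier (hull p i j)) s' := by
  simp only [memberQuery, wp_block_cons]
  refine (core_ran hG hij hi hj hx hy).mono ?_
  rintro τ s ⟨c, hs⟩
  rw [wp_cond]
  simp only [wp_block_nil, Test.holds_nlt, NExp.eval_reg, NExp.eval_lit]
  rcases hs.found with ⟨h, hout⟩ |
    ⟨h, l, r, a, b, c', d, hl, hr, ha, hb, hc, hd, mL, mR, hlr, hU, hL⟩ |
    ⟨h, t, b, ht, hb, hv⟩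
  · refine ⟨fun _ => ?_, fun h' => absurd h (by omega)⟩
    refine (wp_no (t := τ + 5) hs (P := (x, y) ∈ frontier (hull p i j)) (by omega)
      fun hq => hout _ (isClosed_hull.frontier_subset hq) rfl).mono ?_
    rintro τ' s' ⟨h₁, h₂⟩
    exact ⟨by simp; omega, h₂⟩
  · refine ⟨fun h' => absurd h (by omega), fun _ => ?_⟩
    rw [wp_cond]
    refine ⟨fun _ => ?_, fun h' => absurd h (by simp at h'; omega)⟩
    refine (wp_yes_no (t := τ + 9) (P := (x, y) ∈ frontier (hull p i j)) hs
      (by simp [cost_areaExp]; omega) ?_).mono ?_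
    · rw [hU.mem_frontier_iff hL mL mR hlr]
      simp only [Test.holds_conj, Test.holds_neg, Test.holds_rlt, RExp.eval_cell, NExp.eval_reg,
        RExp.eval_reg, RExp.eval_lit, Nat.cast_zero, hs.eval_area ha hb, hs.eval_area hc hd,
        hl, hr, hs.fst, hs.rx, not_lt]
    rintro τ' s' ⟨h₁, h₂⟩
    exact ⟨by simp; omega, h₂⟩
  · refine ⟨fun h' => absurd h (by omega), fun _ => ?_⟩
    rw [wp_cond]
    refine ⟨fun h' => absurd h (by simp at h'; omega), fun _ => ?_⟩
    refine (wp_yes_no (t := τ + 9) (P := (x, y) ∈ frontier (hull p i j)) hs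
      (by simp; omega) ?_).mono ?_
    · rw [hv.frontier_eq, hv.mem_hull_iff]
      simp [ht, hb, hs.snd, hs.ry]
    rintro τ' s' ⟨h₁, h₂⟩
    exact ⟨by simp; omega, h₂⟩

theorem stabQuery_spec {s : State} (hG : Good p s.nmem s.rmem) (hij : i ≤ j)
    (hi : s.nreg 0 = i) (hj : s.nreg 1 = j) (hx : s.rreg 0 = x) :
    WP stabQuery s fun τ s' => τ ≤ queryTime 2001000 i j ∧ Good p s'.nmem s'.rmem ∧
      StabAnswer p i j x s' := by
  simp only [stabQuery, wp_block_cons]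
  refine (core_ran hG hij hi hj hx rfl).mono ?_
  rintro τ s ⟨c, hs⟩
  simp only [no, yes, wp_cond, wp_block_cons, wp_block_nil, wp_setN, Test.holds_nlt,
    NExp.eval_reg, NExp.eval_lit, Test.holds_rlt, RExp.eval_cell]
  rcases hs.found with ⟨h, hout⟩ | ⟨h, l, r, a, b, c', d, -, -, ha, hb, hc, hd, -, -, -, hU, hL⟩ |
    ⟨h, t, b, ht, hb, hv⟩
  · refine ⟨fun _ => ⟨by simp; omega, hs.good, .inl ⟨by simp, fun a b y he hm => ?_⟩⟩,
      fun h' => absurd h (by omega)⟩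
    exact hout _ (he.subset hm) rfl
  · refine ⟨fun h' => absurd h (by omega), fun _ => ⟨fun _ => ⟨by simp; omega, hs.good, .inr
      ⟨by simp, ⟨a, b, by simp [ha], by simp [hb], hU.isEdge, ?_⟩,
        c', d, by simp [hc], by simp [hd], hL.isEdge, ?_⟩⟩, fun h' => absurd h (by omega)⟩⟩
    · obtain ⟨u, hu, hu'⟩ := hU.exists_mem
      refine ⟨u, hu, fun y hy => ?_⟩
      have h₁ := hU.hull_le hy
      rw [hu'] at h₁
      linarith [nonpos_of_mul_nonpos_right h₁ (sub_pos.2 hU.lt)]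
    · obtain ⟨u, hu, hu'⟩ := hL.exists_mem
      refine ⟨u, hu, fun y hy => ?_⟩
      have h₁ := hL.hull_le hy
      rw [hu'] at h₁
      linarith [nonpos_of_mul_nonpos_right h₁ (sub_pos.2 hL.lt)]
  · refine ⟨fun h' => absurd h (by omega), fun _ => ⟨fun h' => absurd h (by omega), fun _ => ?_⟩⟩
    rw [ht, hb, hs.snd, hs.snd]
    have et : (x, (p t).2) = p t := by rw [← hv.fst t hv.memT]
    have eb : (x, (p b).2) = p b := by rw [← hv.fst b hv.memB]
    -- If the highest and the lowest point differ, the whole window is one vertical edge, returned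
    -- for both ends of the line. If not, there is no edge to meet.
    refine ⟨fun hlt => ⟨by simp; omega, hs.good, .inr ⟨by simp,
      ⟨t, b, by simp [ht], by simp [hb], hv.isEdge hlt, (p t).2, ?_, fun y hy => ?_⟩,
      t, b, by simp [ht], by simp [hb], hv.isEdge hlt, (p b).2, ?_, fun y hy => ?_⟩⟩,
      fun hle => ⟨by simp; omega, hs.good, .inl ⟨by simp, fun u v y he _ =>
        hv.not_isEdge (not_lt.1 hle) u v he⟩⟩⟩
    · rw [et]; exact left_mem_segment ℝ _ _
    · exact (hv.mem_hull_iff.1 hy).2.2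
    · rw [eb]; exact right_mem_segment ℝ _ _
    · exact (hv.mem_hull_iff.1 hy).2.1

end

end WindowHull

theorem mainTheorem8 :
    ∃ (build stab member contain : WindowHull.Prog) (C : ℕ),
      ∀ (n : ℕ) (p : Fin n → ℝ × ℝ), 0 < n →
        -- `Ready s`: in the state `s`, the precomputed structure is present and intact
        ∃ Ready : WindowHull.State → Prop,
          WindowHull.HaltsWithin build (WindowHull.State.input p)
            (C * (n * (1 + Nat.log 2 n))) Ready ∧
          ∀ s : WindowHull.State, Ready s → ∀ i j : Fin n, i ≤ j →
            -- vertical line stabbing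
            (∀ x : ℝ,
              WindowHull.HaltsWithin stab ((s.window i j).setR 0 x)
                (WindowHull.queryTime C i j)
                (fun s' => Ready s' ∧ WindowHull.StabAnswer p i j x s')) ∧
            -- membership
            (∀ x y : ℝ,
              WindowHull.HaltsWithin member (((s.window i j).setR 0 x).setR 1 y)
                (WindowHull.queryTime C i j)
                (fun s' => Ready s' ∧
                  WindowHull.YesNoAnswer ((x, y) ∈ frontier (WindowHull.hull p i j)) s')) ∧
            -- containment
            (∀ x y : ℝ,
              WindowHull.HaltsWithin contain (((s.window i j).setR 0 x).setR 1 y)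
                (WindowHull.queryTime C i j)
                (fun s' => Ready s' ∧
                  WindowHull.YesNoAnswer ((x, y) ∈ WindowHull.hull p i j) s')) := by
  refine ⟨WindowHull.buildAll, WindowHull.stabQuery, WindowHull.memberQuery,
    WindowHull.containQuery, 2001000, fun n p hn =>
    -- Readiness concerns the memory only, so loading a query into the registers does not affect it,
    -- and it holds again after each query.
    ⟨fun s => WindowHull.Good p s.nmem s.rmem, WindowHull.WP.halts
      ((WindowHull.buildAll_spec p hn).mono fun t s' h => ⟨h.1.trans ?_, h.2⟩),
      fun s hs i j hij => ⟨fun x => ?_, fun x y => ?_, fun x y => ?_⟩⟩⟩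
  · exact Nat.mul_le_mul_right _ (by norm_num)
  · exact WindowHull.WP.halts (WindowHull.stabQuery_spec hs hij (by simp [WindowHull.State.window])
      (by simp [WindowHull.State.window]) (by simp))
  · exact WindowHull.WP.halts (WindowHull.memberQuery_spec hs hij (by simp [WindowHull.State.window])
      (by simp [WindowHull.State.window]) (by simp) (by simp))
  · exact WindowHull.WP.halts (WindowHull.containQuery_spec hs hij (by simp [WindowHull.State.window])
      (by simp [WindowHull.State.window]) (by simp) (by simp))
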